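/- There is a deterministic algorithm and a constant $c$ such that the following holds for all integers $1\le k\le n$ and all rational $0<\epsilon<1$. On input $(n,k,\epsilon)$ (numbers written in binary, $\epsilon$ as a fraction $a/b$ in lowest terms) the algorithm outputs a nonempty finite multiset $S$ of vectors in $\{0,1\}^n$, listed with repetitions, such that: 1. $S$ is $\epsilon$-almost $k$-wise independent in the $L_1$-norm, i.e. for all $1\le i_1<\cdots<i_k\le n$, $$\sum_{\sigma\in\{0,1\}^k}\left|\Pr_{s\in S}\left[(s_{i_1},\ldots,s_{i_k})=\sigma\right]-\frac1{2^k}\right|\le\epsilon,$$ where $s$ is uniformly distributed on the multiset $S$; 2. $|S|=\tilde O\left(\frac{2^k+\log n}{\epsilon^3}\right)$, i.e. $|S|\le c\,X\,(1+\log X)^c$ with $X=\frac{2^k+\log n}{\epsilon^3}$; 3. the algorithm runs in polynomial time: the number of bit operations is at most $c\,(n+2^k+1/\epsilon+\ell)^c$, where $\ell$ is the bit length of the denominator $b$ of $\epsilon$. -/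

import Mathlib

/-! ### Almost `k`-wise independent samples -/

/-- The restriction `D_I` of a distribution `D` on `{0,1}^n` to the coordinates
`I = (i_1 < ... < i_k)`: the law of `(s_{i_1}, ..., s_{i_k})` for `s ∼ D`. -/
noncomputable def restrictDist {n k : ℕ} (D : PMF (Fin n → Bool)) (I : Fin k ↪o Fin n) :
    PMF (Fin k → Bool) :=
  D.map (fun s j => s (I j))

/-- The distance in the `L_1`-norm of two distributions on a finite sample space. -/
noncomputable def l1Dist {α : Type*} [Fintype α] (D Q : PMF α) : ℝ :=
  ∑ a, |(D a).toReal - (Q a).toReal|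

/-- `Q` is `ε`-almost `k`-wise independent in the `L_1`-norm. -/
def AlmostKWiseL1 {n : ℕ} (k : ℕ) (ε : ℝ) (Q : PMF (Fin n → Bool)) : Prop :=
  ∀ I : Fin k ↪o Fin n,
    l1Dist (restrictDist Q I)
      (restrictDist (PMF.uniformOfFintype (Fin n → Bool)) I) ≤ ε

/-- The (nonempty) multiset `S` of vectors is an `ε`-almost `k`-wise independent set in the
`L_1`-norm: the uniform distribution on `S`, which gives each vector its multiplicity
divided by `|S|`, is `ε`-almost `k`-wise independent in the `L_1`-norm. -/
def IsAlmostKWiseL1Set {n : ℕ} (k : ℕ) (ε : ℝ) (S : Multiset (Fin n → Bool)) : Prop :=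
  ∃ h : S ≠ 0, AlmostKWiseL1 k ε (PMF.ofMultiset S h)

/-! ### A programming language with a bit-cost measure -/

/-- The data on which programs work: binary trees whose leaves carry natural numbers. -/
inductive SExp : Type
  | num (a : ℕ) : SExp
  | pair (u v : SExp) : SExp

/-- The number of symbols needed to write down a datum, with the numbers in binary. -/
def SExp.size : SExp → ℕ
  | .num a => 1 + a.size
  | .pair u v => 1 + u.size + v.size

/-- First component of a pair (`0` for a leaf). -/
def SExp.left : SExp → SExp
  | .pair u _ => u
  | .num _ => .num 0

/-- Second component of a pair (`0` for a leaf). -/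
def SExp.right : SExp → SExp
  | .pair _ v => v
  | .num _ => .num 0

/-- `1` for a pair and `0` for a leaf. -/
def SExp.isPair : SExp → SExp
  | .pair _ _ => .num 1
  | .num _ => .num 0

/-- Apply a binary operation to a pair of numbers (`0` on all other data). -/
def SExp.arith (op : ℕ → ℕ → ℕ) : SExp → SExp
  | .pair (.num a) (.num b) => .num (op a b)
  | _ => .num 0

/-- Programs: each maps a datum to a datum. -/
inductive Prog : Type
  /-- return the argument -/
  | id : Prog
  /-- return a fixed number -/
  | const (a : ℕ) : Prog
  /-- first component -/
  | left : Prog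
  /-- second component -/
  | right : Prog
  /-- test whether the argument is a pair -/
  | isPair : Prog
  /-- addition -/
  | add : Prog
  /-- truncated subtraction -/
  | sub : Prog
  /-- multiplication -/
  | mul : Prog
  /-- integer division -/
  | div : Prog
  /-- run both programs on the argument and pair the results -/
  | pair (f g : Prog) : Prog
  /-- run `g`, then `f` on its result -/
  | comp (f g : Prog) : Prog
  /-- run `g` if `c` returns the number `0`, and `f` otherwise -/
  | cond (c f g : Prog) : Prog
  /-- on a pair of a number `t` and a datum `v`, apply `f` to `v` repeatedly, `t` times -/
  | loop (f : Prog) : Prog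

/-- The result of a program on a datum. -/
def Prog.eval : Prog → SExp → SExp
  | .id => fun v => v
  | .const a => fun _ => .num a
  | .left => SExp.left
  | .right => SExp.right
  | .isPair => SExp.isPair
  | .add => SExp.arith (fun a b => a + b)
  | .sub => SExp.arith (fun a b => a - b)
  | .mul => SExp.arith (fun a b => a * b)
  | .div => SExp.arith (fun a b => a / b)
  | .pair f g => fun v => .pair (f.eval v) (g.eval v)
  | .comp f g => fun v => f.eval (g.eval v)
  | .cond c f g => fun v =>
      match c.eval v with
      | .num 0 => g.eval v
      | _ => f.eval v
  | .loop f => fun v =>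
      match v with
      | .pair (.num t) w => f.eval^[t] w
      | _ => .num 0

/-- The running time of a program on a datum, counted in bit operations. A primitive operation
is charged the square of the size of its argument, which pays for schoolbook arithmetic and
for copying; no operation gets its argument for free, so the time also bounds the size of
every intermediate datum. -/
def Prog.time : Prog → SExp → ℕ
  | .id => fun v => (v.size + 1) ^ 2
  | .const a => fun v => (v.size + a.size + 1) ^ 2
  | .left => fun v => (v.size + 1) ^ 2
  | .right => fun v => (v.size + 1) ^ 2
  | .isPair => fun v => (v.size + 1) ^ 2
  | .add => fun v => (v.size + 1) ^ 2
  | .sub => fun v => (v.size + 1) ^ 2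
  | .mul => fun v => (v.size + 1) ^ 2
  | .div => fun v => (v.size + 1) ^ 2
  | .pair f g => fun v => (v.size + 1) + f.time v + g.time v
  | .comp f g => fun v => 1 + g.time v + f.time (g.eval v)
  | .cond c f g => fun v => (v.size + 1) + c.time v +
      match c.eval v with
      | .num 0 => g.time v
      | _ => f.time v
  | .loop f => fun v => (v.size + 1) +
      match v with
      | .pair (.num t) w =>
          ∑ i ∈ Finset.range t, (1 + t.size + f.time (f.eval^[i] w))
      | _ => 0

/-! ### Encodings of the input and of the output -/

/-- A list of data as a datum: `[x, y, ...]` is `(x, (y, ... 0))`. -/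
def encodeList : List SExp → SExp
  | [] => .num 0
  | x :: l => .pair x (encodeList l)

/-- A vector of `{0,1}^n` as the list of its bits. -/
def encodeVec {n : ℕ} (x : Fin n → Bool) : SExp :=
  encodeList (List.ofFn fun i => .num (x i).toNat)

/-- A sample, listed with repetitions, as a datum. -/
def encodeSample {n : ℕ} (S : List (Fin n → Bool)) : SExp :=
  encodeList (S.map encodeVec)

/-- The input `(n, k, ε)`: all numbers in binary, the rational `ε > 0` by its numerator and
denominator. -/
def encodeInput (n k : ℕ) (ε : ℚ) : SExp :=
  .pair (.num n) (.pair (.num k) (.pair (.num ε.num.natAbs) (.num ε.den)))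

/-! ### Functions computable in polynomial time, with respect to a measure of the argument -/

/-! Write E for `Input.invEps`, an integer with 1/E ≤ ε, L for ⌊log₂ n⌋, and X for (2^k + log n)/ε³.
The sample is a composition: an inner sample, whose coordinates are the Q = 2^r elements of a finite
field, is pulled back to n coordinates along N hash functions. A coordinate, written in base Q, is
read as a polynomial of degree < d over the field; its h-th hash is the value at the element h.
Distinct polynomials agree at no more than d points, so a given k-tuple of coordinates has a
collision under at most k²d hashes. A collision costs at most 2 in L₁, and N = 4k²dE reduces the
average loss to 1/(2E) (`l1Error_hash_le`). The inner sample may therefore have error 1/(2E) on k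
distinct field elements. It is chosen in one of two ways.

If 8k³E ≤ 2^⌊L/k⌋, take Q = 2^⌊L/k⌋ and d = 2k. There are only Q^k ≤ n tuples of field elements, so
all can be inspected, and the method of conditional expectations applies: polynomials of degree < k
are picked one at a time. A random one is exactly uniform on k distinct points (`hitCount_gfEval`).
Progress is measured by `potential`, the product over patterns x of 1 + (1+λ)^{c_x}/(1+λ/2^k)^i.
Expanded, it is a sum over all sets of patterns, so it controls all 2^(2^k) tests at once and is
still computable in time polynomial in 2^k. It does not grow on average (`sum_potential_le`), and
its sum over all tuples starts at no more than Q^k 2^(2^k); hence m = O(E²(2^k + L)) polynomials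
suffice (`sum_abs_le_of_potential_le`). The sample size is N·m = O(k³E³(2^k + L)).

Otherwise L is at most k times O(log X), so d = L + 1 is polylogarithmic in X and powers of d are
affordable. The inner sample has Q² members (x, y); the bit at z is the low bit of y·∑_{i<k} (xz)^i.
Root counting bounds the bias of every nontrivial character by k/Q, and Parseval turns this into an
L₁ error of at most 2^{k/2}k/Q (`l1Error_gfGeom_sq_le`). Taking Q of order N·2^{k/2} gives sample
size N·Q² = O(N³2^k).

The running time is handled by a calculus of polynomial-time functions, closed under composition,
branching and bounded recursion. Naturals are measured there by their value, and only the huge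
integers of the potential argument and of the input fraction by their binary length (`BigNat`). -/

/-- A type whose elements are coded as data, with a measure that bounds the size of the code. -/
class Coded (α : Type) where
  enc : α → SExp
  meas : α → ℕ
  size_le : ∀ a, (enc a).size ≤ meas a

open Coded

theorem SExp.one_le_size (v : SExp) : 1 ≤ v.size := by
  cases v <;> simp only [SExp.size] <;> omega

theorem Coded.one_le_meas {α : Type} [Coded α] (a : α) : 1 ≤ meas a :=
  (SExp.one_le_size _).trans (size_le a)

/-- `g` is bounded by a polynomial in the measure of its argument. -/
def PolyBounded {α : Type} [Coded α] (g : α → ℕ) : Prop :=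
  ∃ c, ∀ a, g a ≤ c * meas a ^ c

/-- `f` is computed by a program in polynomial time, and its values are polynomially bounded. -/
@[fun_prop]
def PolyTime {α β : Type} [Coded α] [Coded β] (f : α → β) : Prop :=
  ∃ P : Prog, (∀ a, P.eval (enc a) = enc (f a)) ∧
    PolyBounded (fun a : α => P.time (enc a)) ∧ PolyBounded (fun a => meas (f a))

/-! ### Closure properties of polynomial bounds. -/

section PolyBounded

variable {α β : Type} [Coded α] [Coded β] {f g : α → ℕ}

theorem PolyBounded.of_le (A B : ℕ) (h : ∀ a, f a ≤ A * meas a ^ B) : PolyBounded f := by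
  refine ⟨A + B, fun a => (h a).trans ?_⟩
  exact Nat.mul_le_mul (by omega) (Nat.pow_le_pow_right (one_le_meas a) (by omega))

theorem PolyBounded.mono (hg : PolyBounded g) (h : ∀ a, f a ≤ g a) : PolyBounded f := by
  obtain ⟨c, hc⟩ := hg
  exact ⟨c, fun a => (h a).trans (hc a)⟩

theorem PolyBounded.const (n : ℕ) : PolyBounded (fun _ : α => n) :=
  PolyBounded.of_le n 0 (by simp)

theorem PolyBounded.meas : PolyBounded (fun a : α => meas a) :=
  PolyBounded.of_le 1 1 (by simp)

theorem PolyBounded.add (hf : PolyBounded f) (hg : PolyBounded g) :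
    PolyBounded (fun a => f a + g a) := by
  obtain ⟨c, hc⟩ := hf
  obtain ⟨d, hd⟩ := hg
  refine PolyBounded.of_le (c + d) (c + d) fun a => ?_
  rw [add_mul]
  exact Nat.add_le_add
    ((hc a).trans (Nat.mul_le_mul_left _ (Nat.pow_le_pow_right (one_le_meas a) (by omega))))
    ((hd a).trans (Nat.mul_le_mul_left _ (Nat.pow_le_pow_right (one_le_meas a) (by omega))))

theorem PolyBounded.mul (hf : PolyBounded f) (hg : PolyBounded g) :
    PolyBounded (fun a => f a * g a) := by
  obtain ⟨c, hc⟩ := hf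
  obtain ⟨d, hd⟩ := hg
  refine PolyBounded.of_le (c * d) (c + d) fun a => ?_
  calc f a * g a ≤ (c * Coded.meas a ^ c) * (d * Coded.meas a ^ d) := Nat.mul_le_mul (hc a) (hd a)
    _ = _ := by ring

theorem PolyBounded.pow (hf : PolyBounded f) : ∀ n : ℕ, PolyBounded (fun a => f a ^ n)
  | 0 => by simpa using PolyBounded.const 1
  | n + 1 => by simpa only [pow_succ] using (PolyBounded.pow hf n).mul hf

theorem PolyBounded.comp {f : β → ℕ} {g : α → β} (hf : PolyBounded f)
    (hg : PolyBounded (fun a => Coded.meas (g a))) : PolyBounded (fun a => f (g a)) := by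
  obtain ⟨c, hc⟩ := hf
  exact ((PolyBounded.const c).mul (hg.pow c)).mono fun a => hc (g a)

end PolyBounded

/-! ### Composition, arithmetic and branching in polynomial time. -/

section Basic

variable {α β γ : Type} [Coded α] [Coded β] [Coded γ]

theorem PolyTime.bound {f : α → β} (hf : PolyTime f) : PolyBounded (fun a => meas (f a)) := by
  obtain ⟨P, _, _, h⟩ := hf
  exact h

theorem PolyTime.of_primitive {f : α → β} (P : Prog) (h : ∀ a, P.eval (enc a) = enc (f a))
    (ht : ∀ v, P.time v = (v.size + 1) ^ 2) (hb : PolyBounded (fun a => meas (f a))) :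
    PolyTime f := by
  refine ⟨P, h, ?_, hb⟩
  refine ((PolyBounded.meas.add (PolyBounded.const 1)).pow 2).mono fun a => ?_
  rw [ht]
  exact Nat.pow_le_pow_left (Nat.add_le_add_right (size_le a) 1) 2

@[fun_prop]
theorem PolyTime.id : PolyTime (fun a : α => a) :=
  .of_primitive .id (fun _ => rfl) (fun _ => rfl) PolyBounded.meas

@[fun_prop]
theorem PolyTime.comp {f : β → γ} {g : α → β} (hf : PolyTime f) (hg : PolyTime g) :
    PolyTime (fun a => f (g a)) := by
  obtain ⟨P, hP, hPt, hPb⟩ := hf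
  obtain ⟨R, hR, hRt, hRb⟩ := hg
  refine ⟨.comp P R, fun a => by simp [Prog.eval, hP, hR], ?_, hPb.comp hRb⟩
  refine (((PolyBounded.const 1).add hRt).add (hPt.comp hRb)).mono fun a => ?_
  simp [Prog.time, hR]

/-- A program with a given constant value. -/
def SExp.constProg : SExp → Prog
  | .num a => .const a
  | .pair u v => .pair u.constProg v.constProg

theorem SExp.eval_constProg (w v : SExp) : w.constProg.eval v = w := by
  induction w with
  | num a => rfl
  | pair u w hu hw => simp [SExp.constProg, Prog.eval, hu, hw]

theorem SExp.polyBounded_constProg (w : SExp) :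
    PolyBounded (fun a : α => w.constProg.time (enc a)) := by
  induction w with
  | num n =>
    refine ((PolyBounded.meas.add (PolyBounded.const (n.size + 1))).pow 2).mono fun a => ?_
    simp only [SExp.constProg, Prog.time]
    have := size_le a
    exact Nat.pow_le_pow_left (by omega) 2
  | pair u v hu hv =>
    refine (((PolyBounded.meas.add (PolyBounded.const 1)).add hu).add hv).mono fun a => ?_
    have := size_le a
    simp only [SExp.constProg, Prog.time]
    omega

@[fun_prop]
theorem PolyTime.const (b : β) : PolyTime (fun _ : α => b) :=
  ⟨(enc b).constProg, fun _ => SExp.eval_constProg _ _, SExp.polyBounded_constProg _,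
    PolyBounded.const _⟩

/-- The measure is the value, not the binary length, so a number of polynomial measure may serve as
a loop counter. -/
instance : Coded ℕ where
  enc := .num
  meas n := n + 1
  size_le n := by
    have : n.size ≤ n := Nat.size_le.2 Nat.lt_two_pow_self
    simp only [SExp.size]
    omega

instance : Coded (α × β) where
  enc p := .pair (enc p.1) (enc p.2)
  meas p := 1 + meas p.1 + meas p.2
  size_le p := by
    have h1 := size_le p.1
    have h2 := size_le p.2
    simp only [SExp.size]
    omega

theorem meas_nat (n : ℕ) : meas n = n + 1 := rfl

theorem enc_nat (n : ℕ) : enc n = .num n := rfl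

theorem meas_prod (p : α × β) : meas p = 1 + meas p.1 + meas p.2 := rfl

theorem enc_prod (p : α × β) : enc p = .pair (enc p.1) (enc p.2) := rfl

@[fun_prop]
theorem PolyTime.fst : PolyTime (fun p : α × β => p.1) :=
  .of_primitive .left (fun _ => rfl) (fun _ => rfl)
    (PolyBounded.meas.mono fun p => by rw [meas_prod]; omega)

@[fun_prop]
theorem PolyTime.snd : PolyTime (fun p : α × β => p.2) :=
  .of_primitive .right (fun _ => rfl) (fun _ => rfl)
    (PolyBounded.meas.mono fun p => by rw [meas_prod]; omega)

@[fun_prop]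
theorem PolyTime.prodMk {f : α → β} {g : α → γ} (hf : PolyTime f) (hg : PolyTime g) :
    PolyTime (fun a => (f a, g a)) := by
  obtain ⟨P, hP, hPt, hPb⟩ := hf
  obtain ⟨R, hR, hRt, hRb⟩ := hg
  refine ⟨.pair P R, fun a => by simp [Prog.eval, hP, hR, enc_prod], ?_,
    ((PolyBounded.const 1).add hPb).add hRb⟩
  refine (((PolyBounded.meas.add (PolyBounded.const 1)).add hPt).add hRt).mono fun a => ?_
  have := size_le a
  simp only [Prog.time]
  omega

@[fun_prop]
theorem PolyTime.add {f g : α → ℕ} (hf : PolyTime f) (hg : PolyTime g) :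
    PolyTime (fun a => f a + g a) := by
  have h : PolyTime (fun p : ℕ × ℕ => p.1 + p.2) :=
    .of_primitive .add (fun _ => rfl) (fun _ => rfl)
      (PolyBounded.meas.mono fun p => by simp only [meas_prod, meas_nat]; omega)
  exact h.comp (hf.prodMk hg)

@[fun_prop]
theorem PolyTime.sub {f g : α → ℕ} (hf : PolyTime f) (hg : PolyTime g) :
    PolyTime (fun a => f a - g a) := by
  have h : PolyTime (fun p : ℕ × ℕ => p.1 - p.2) :=
    .of_primitive .sub (fun _ => rfl) (fun _ => rfl)
      (PolyBounded.meas.mono fun p => by simp only [meas_prod, meas_nat]; omega)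
  exact h.comp (hf.prodMk hg)

@[fun_prop]
theorem PolyTime.mul {f g : α → ℕ} (hf : PolyTime f) (hg : PolyTime g) :
    PolyTime (fun a => f a * g a) := by
  have h : PolyTime (fun p : ℕ × ℕ => p.1 * p.2) :=
    .of_primitive .mul (fun _ => rfl) (fun _ => rfl)
      ((PolyBounded.meas.pow 2).mono fun p => by simp only [meas_prod, meas_nat]; nlinarith)
  exact h.comp (hf.prodMk hg)

@[fun_prop]
theorem PolyTime.div {f g : α → ℕ} (hf : PolyTime f) (hg : PolyTime g) :
    PolyTime (fun a => f a / g a) := by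
  have h : PolyTime (fun p : ℕ × ℕ => p.1 / p.2) :=
    .of_primitive .div (fun _ => rfl) (fun _ => rfl)
      (PolyBounded.meas.mono fun p => by
        have := Nat.div_le_self p.1 p.2
        simp only [meas_prod, meas_nat]
        omega)
  exact h.comp (hf.prodMk hg)

@[fun_prop]
theorem PolyTime.mod {f g : α → ℕ} (hf : PolyTime f) (hg : PolyTime g) :
    PolyTime (fun a => f a % g a) := by
  simp only [Nat.mod_eq_sub_mul_div]
  fun_prop

@[fun_prop]
theorem PolyTime.natMin {f g : α → ℕ} (hf : PolyTime f) (hg : PolyTime g) :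
    PolyTime (fun a => min (f a) (g a)) := by
  have h : (fun a => min (f a) (g a)) = fun a => f a - (f a - g a) := by
    funext a
    omega
  rw [h]
  fun_prop

/-- Decision problems solved in polynomial time. -/
def PolyDec (p : α → Prop) : Prop :=
  ∃ χ : α → ℕ, PolyTime χ ∧ ∀ a, p a ↔ χ a ≠ 0

theorem PolyTime.ite {p : α → Prop} [DecidablePred p] {f g : α → β} (hp : PolyDec p)
    (hf : PolyTime f) (hg : PolyTime g) : PolyTime (fun a => if p a then f a else g a) := by
  obtain ⟨χ, ⟨C, hC, hCt, -⟩, hχ⟩ := hp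
  obtain ⟨P, hP, hPt, hPb⟩ := hf
  obtain ⟨R, hR, hRt, hRb⟩ := hg
  refine ⟨.cond C P R, fun a => ?_, ?_, ?_⟩
  · simp only [Prog.eval, hC, enc_nat, hP, hR]
    by_cases h : p a
    · have := (hχ a).1 h
      obtain ⟨m, hm⟩ := Nat.exists_eq_succ_of_ne_zero this
      simp [h, hm]
    · have : χ a = 0 := by
        by_contra h0
        exact h ((hχ a).2 h0)
      simp [h, this]
  · refine ((((PolyBounded.meas.add (PolyBounded.const 1)).add hCt).add hPt).add hRt).mono
      fun a => ?_
    have := size_le a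
    simp only [Prog.time]
    split <;> omega
  · refine (hPb.add hRb).mono fun a => ?_
    dsimp only
    split <;> omega

theorem PolyDec.le {f g : α → ℕ} (hf : PolyTime f) (hg : PolyTime g) :
    PolyDec (fun a => f a ≤ g a) :=
  ⟨fun a => 1 + g a - f a, by fun_prop, fun a => by dsimp only; omega⟩

theorem PolyDec.lt {f g : α → ℕ} (hf : PolyTime f) (hg : PolyTime g) :
    PolyDec (fun a => f a < g a) :=
  ⟨fun a => g a - f a, by fun_prop, fun a => by dsimp only; omega⟩

theorem PolyDec.not {p : α → Prop} (hp : PolyDec p) : PolyDec (fun a => ¬ p a) := by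
  obtain ⟨χ, hχ, h⟩ := hp
  exact ⟨fun a => 1 - χ a, by fun_prop, fun a => by dsimp only; rw [h]; omega⟩

theorem PolyDec.and {p q : α → Prop} (hp : PolyDec p) (hq : PolyDec q) :
    PolyDec (fun a => p a ∧ q a) := by
  obtain ⟨χ, hχ, h⟩ := hp
  obtain ⟨η, hη, h'⟩ := hq
  exact ⟨fun a => χ a * η a, by fun_prop, fun a => by simp [h, h']⟩

theorem PolyDec.imp {p q : α → Prop} (hp : PolyDec p) (hq : PolyDec q) :
    PolyDec (fun a => p a → q a) := by
  have := (hp.and hq.not).not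
  simpa only [not_and, not_not] using this

theorem PolyDec.iff {p q : α → Prop} (hp : PolyDec p) (h : ∀ a, q a ↔ p a) : PolyDec q := by
  obtain ⟨χ, hχ, h'⟩ := hp
  exact ⟨χ, hχ, fun a => (h a).trans (h' a)⟩

theorem PolyDec.eq {f g : α → ℕ} (hf : PolyTime f) (hg : PolyTime g) :
    PolyDec (fun a => f a = g a) :=
  ((PolyDec.le hf hg).and (PolyDec.le hg hf)).iff fun _ => le_antisymm_iff

theorem PolyDec.ne {f g : α → ℕ} (hf : PolyTime f) (hg : PolyTime g) :
    PolyDec (fun a => f a ≠ g a) :=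
  (PolyDec.eq hf hg).not

end Basic

/-! ### Bounded recursion, sums, counting and search. -/

section Loops

variable {α β σ : Type} [Coded α] [Coded β] [Coded σ]

/-- Polynomial growth in each round could compound to exponential growth, so a bound `B` on all
intermediate states has to be supplied. -/
theorem PolyTime.loop {F : σ → σ} {init : α → σ} {t : α → ℕ} {B : α → ℕ} (hF : PolyTime F)
    (hinit : PolyTime init) (ht : PolyTime t) (hB : PolyBounded B)
    (h : ∀ a, ∀ i ≤ t a, meas (F^[i] (init a)) ≤ B a) :
    PolyTime (fun a => F^[t a] (init a)) := by
  obtain ⟨P, hP, ⟨c, hc⟩, -⟩ := hF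
  obtain ⟨R, hR, hRt, hRb⟩ := hinit
  obtain ⟨T, hT, hTt, hTb⟩ := ht
  have key : ∀ a i, P.eval^[i] (enc a) = enc (F^[i] a) := by
    intro a i
    induction i with
    | zero => rfl
    | succ i ih => rw [Function.iterate_succ_apply', Function.iterate_succ_apply', ih, hP]
  have hTR : PolyBounded (fun a => (SExp.pair (enc (t a)) (enc (init a))).size) :=
    (((PolyBounded.const 1).add hTb).add hRb).mono fun a => by
      have h1 := size_le (t a)
      have h2 := size_le (init a)
      simp only [SExp.size]
      omega
  refine ⟨.comp (.loop P) (.pair T R), fun a => ?_, ?_, hB.mono fun a => h a _ le_rfl⟩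
  · simp only [Prog.eval, hT, hR, enc_nat, key]
  · refine ((PolyBounded.const 1).add (((PolyBounded.meas.add (PolyBounded.const 1)).add
      hTt).add hRt) |>.add ((hTR.add (PolyBounded.const 1)).add
      (hTb.mul ((PolyBounded.const 1).add hTb |>.add
        ((PolyBounded.const c).mul (hB.pow c)))))).mono fun a => ?_
    simp only [Prog.time, Prog.eval, hT, hR, enc_nat]
    gcongr
    · exact size_le a
    · calc _ ≤ ∑ i ∈ Finset.range (t a), (1 + meas (t a) + c * B a ^ c) := by
            refine Finset.sum_le_sum fun i hi => ?_
            rw [key]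
            have h1 : 1 + (t a).size ≤ meas (t a) := size_le (t a)
            have h2 : P.time (enc (F^[i] (init a))) ≤ c * meas (F^[i] (init a)) ^ c := hc _
            have h3 : c * meas (F^[i] (init a)) ^ c ≤ c * B a ^ c :=
              Nat.mul_le_mul_left _ (Nat.pow_le_pow_left (h a i (Finset.mem_range.1 hi).le) c)
            omega
        _ ≤ _ := by
            rw [Finset.sum_const, Finset.card_range, smul_eq_mul, meas_nat]
            exact Nat.mul_le_mul_right _ (Nat.le_succ _)

/-- Bounded recursion, when the intermediate results are polynomially bounded. -/
theorem PolyTime.natRec {F : α → ℕ → σ → σ} {init : α → σ} {t : α → ℕ} {R : α → ℕ → σ}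
    {B : α → ℕ} (hF : PolyTime (fun p : α × ℕ × σ => F p.1 p.2.1 p.2.2)) (hinit : PolyTime init)
    (ht : PolyTime t) (h0 : ∀ a, R a 0 = init a) (hs : ∀ a i, R a (i + 1) = F a i (R a i))
    (hB : PolyBounded B) (h : ∀ a, ∀ i ≤ t a, meas (R a i) ≤ B a) :
    PolyTime (fun a => R a (t a)) := by
  -- The body of a loop sees only its state, so the argument and a counter are carried along in it.
  have key : ∀ a i, (fun p : α × ℕ × σ => (p.1, p.2.1 + 1, F p.1 p.2.1 p.2.2))^[i]
      (a, 0, init a) = (a, i, R a i) := by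
    intro a i
    induction i with
    | zero => simp [h0]
    | succ i ih => rw [Function.iterate_succ_apply', ih, hs]
  have := PolyTime.loop (F := fun p : α × ℕ × σ => (p.1, p.2.1 + 1, F p.1 p.2.1 p.2.2))
    (init := fun a => (a, 0, init a)) (t := t)
    (B := fun a => 1 + meas a + (1 + meas (t a) + B a)) (by fun_prop) (by fun_prop) ht
    (((PolyBounded.const 1).add PolyBounded.meas).add
      (((PolyBounded.const 1).add ht.bound).add hB)) (fun a i hi => by
        rw [key]
        have := h a i hi
        simp only [meas_prod, meas_nat]
        omega)
  simp only [key] at this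
  exact (PolyTime.snd.comp PolyTime.snd).comp this

/-- Bounded iteration, when the intermediate results are polynomially bounded. -/
theorem PolyTime.iterate {F : α → σ → σ} {init : α → σ} {t : α → ℕ}
    {B : α → ℕ} (hF : PolyTime (fun p : α × σ => F p.1 p.2)) (hinit : PolyTime init)
    (ht : PolyTime t) (hB : PolyBounded B) (h : ∀ a i, meas ((F a)^[i] (init a)) ≤ B a) :
    PolyTime (fun a => (F a)^[t a] (init a)) :=
  PolyTime.natRec (F := fun a _ s => F a s) (R := fun a i => (F a)^[i] (init a))
    (hF.comp (f := fun p : α × σ => F p.1 p.2) (g := fun p : α × ℕ × σ => (p.1, p.2.2))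
      (by fun_prop)) hinit ht (fun _ => rfl)
    (fun a i => Function.iterate_succ_apply' _ _ _) hB (fun a i _ => h a i)

theorem PolyTime.sum {f : α → ℕ → ℕ} {t : α → ℕ} (hf : PolyTime (fun p : α × ℕ => f p.1 p.2))
    (ht : PolyTime t) : PolyTime (fun a => ∑ j ∈ Finset.range (t a), f a j) := by
  obtain ⟨c, hc⟩ := hf.bound
  refine PolyTime.natRec (F := fun a i s => s + f a i)
    (R := fun a i => ∑ j ∈ Finset.range i, f a j) (init := fun _ => 0)
    (B := fun a => meas (t a) * (c * (1 + meas a + meas (t a)) ^ c) + 1)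
    (PolyTime.add (by fun_prop) (hf.comp (f := fun p : α × ℕ => f p.1 p.2)
      (g := fun p : α × ℕ × ℕ => (p.1, p.2.1)) (by fun_prop))) (by fun_prop) ht
    (by simp) (fun a i => Finset.sum_range_succ _ _)
    ((ht.bound.mul ((PolyBounded.const c).mul
      ((((PolyBounded.const 1).add PolyBounded.meas).add ht.bound).pow c))).add
      (PolyBounded.const 1)) fun a i hi => ?_
  rw [meas_nat, add_le_add_iff_right]
  calc _ ≤ ∑ j ∈ Finset.range i, c * (1 + meas a + meas (t a)) ^ c := by
        refine Finset.sum_le_sum fun j hj => ?_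
        have h1 := hc (a, j)
        simp only [meas_nat] at h1
        refine (Nat.le_succ _).trans (h1.trans ?_)
        refine Nat.mul_le_mul_left _ (Nat.pow_le_pow_left ?_ c)
        have := Finset.mem_range.1 hj
        simp only [meas_prod, meas_nat]
        omega
    _ ≤ _ := by
        rw [Finset.sum_const, Finset.card_range, smul_eq_mul]
        exact Nat.mul_le_mul_right _ (by rw [meas_nat]; omega)

theorem PolyDec.ball {p : α → ℕ → Prop} {t : α → ℕ}
    (hp : PolyDec (fun x : α × ℕ => p x.1 x.2)) (ht : PolyTime t) :
    PolyDec (fun a => ∀ j < t a, p a j) := by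
  classical
  have h : PolyTime (fun x : α × ℕ => if p x.1 x.2 then 0 else 1) :=
    PolyTime.ite hp (.const 0) (.const 1)
  have h2 := PolyDec.eq (PolyTime.sum (f := fun a j => if p a j then 0 else 1) h ht) (.const 0)
  refine h2.iff fun a => ?_
  simp [Finset.sum_eq_zero_iff]

/-- The number of elements of a bounded range with a property. -/
theorem PolyTime.count {p : α → ℕ → Prop} [∀ a j, Decidable (p a j)] {t : α → ℕ}
    (hp : PolyDec (fun x : α × ℕ => p x.1 x.2)) (ht : PolyTime t) :
    PolyTime (fun a => ((Finset.range (t a)).filter (p a)).card) := by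
  have h : PolyTime (fun x : α × ℕ => if p x.1 x.2 then 1 else 0) :=
    PolyTime.ite hp (.const 1) (.const 0)
  simpa only [Finset.card_filter] using
    PolyTime.sum (f := fun a j => if p a j then 1 else 0) h ht

/-- The least `j < t` with a property, or `t`. -/
def boundedFind (p : ℕ → Prop) [DecidablePred p] (t : ℕ) : ℕ :=
  ((Finset.range t).filter fun j => ∀ i < j + 1, ¬ p i).card

theorem boundedFind_le (p : ℕ → Prop) [DecidablePred p] (t : ℕ) : boundedFind p t ≤ t :=
  (Finset.card_filter_le _ _).trans (Finset.card_range t).le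

theorem boundedFind_spec {p : ℕ → Prop} [DecidablePred p] {t : ℕ} (h : ∃ j < t, p j) :
    boundedFind p t < t ∧ p (boundedFind p t) := by
  obtain ⟨j, hj, hpj⟩ := h
  have hex : ∃ j, p j := ⟨j, hpj⟩
  have heq : ((Finset.range t).filter fun j => ∀ i < j + 1, ¬ p i)
      = Finset.range (Nat.find hex) := by
    ext i
    simp only [Finset.mem_filter, Finset.mem_range]
    constructor
    · rintro ⟨-, h⟩
      by_contra hlt
      exact h _ (by omega) (Nat.find_spec hex)
    · intro hi
      refine ⟨hi.trans_le ((Nat.find_min' hex hpj).trans hj.le), fun l hl => ?_⟩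
      exact Nat.find_min hex (by omega)
  rw [boundedFind, heq, Finset.card_range]
  exact ⟨(Nat.find_min' hex hpj).trans_lt hj, Nat.find_spec hex⟩

theorem PolyTime.boundedFind {p : α → ℕ → Prop} [∀ a, DecidablePred (p a)] {t : α → ℕ}
    (hp : PolyDec (fun x : α × ℕ => p x.1 x.2)) (ht : PolyTime t) :
    PolyTime (fun a => boundedFind (p a) (t a)) := by
  refine PolyTime.count (p := fun a j => ∀ i < j + 1, ¬ p a i) ?_ ht
  refine PolyDec.ball (p := fun (x : α × ℕ) i => ¬ p x.1 i) ?_ (by fun_prop)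
  obtain ⟨χ, hχ, h⟩ := hp.not
  exact ⟨fun x => χ (x.1.1, x.2), by fun_prop, fun x => h (x.1.1, x.2)⟩

-- An uncapped power may have exponential value. Capping after every multiplication gives the same
-- result as capping once at the end.
@[fun_prop]
theorem PolyTime.minPow {b j c : α → ℕ} (hb : PolyTime b) (hj : PolyTime j) (hc : PolyTime c) :
    PolyTime (fun a => min (b a ^ j a) (c a)) := by
  refine PolyTime.natRec (F := fun a _ s => min (s * b a) (c a))
    (R := fun a i => min (b a ^ i) (c a)) (init := fun a => min 1 (c a))
    (B := fun a => meas (c a)) (by fun_prop) (by fun_prop) hj (by simp) (fun a i => ?_)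
    hc.bound (fun a i _ => by simp only [meas_nat]; omega)
  rw [pow_succ]
  rcases le_total (b a ^ i) (c a) with h | h
  · rw [min_eq_left h]
  · rw [min_eq_right h]
    rcases Nat.eq_zero_or_pos (b a) with h0 | h0
    · simp [h0]
    · rw [min_eq_right (h.trans (Nat.le_mul_of_pos_right _ h0)),
        min_eq_right (Nat.le_mul_of_pos_right _ h0)]

theorem PolyTime.pow_of_le {b j c : α → ℕ} (hb : PolyTime b) (hj : PolyTime j) (hc : PolyTime c)
    (h : ∀ a, b a ^ j a ≤ c a) : PolyTime (fun a => b a ^ j a) := by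
  have := PolyTime.minPow hb hj hc
  rwa [funext fun a => min_eq_left (h a)] at this

/-- A power beyond `u` gives quotient 0 whatever its size, so digits can be extracted with capped
powers only. -/
theorem div_pow_eq_div_min (u q j : ℕ) : u / q ^ j = u / min (q ^ j) (u + 1) := by
  rcases le_total (q ^ j) (u + 1) with h | h
  · rw [min_eq_left h]
  · rw [min_eq_right h, Nat.div_eq_of_lt (by omega), Nat.div_eq_of_lt (by omega)]

@[fun_prop]
theorem PolyTime.divPow {u q j : α → ℕ} (hu : PolyTime u) (hq : PolyTime q) (hj : PolyTime j) :
    PolyTime (fun a => u a / q a ^ j a) := by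
  simp only [div_pow_eq_div_min]
  exact hu.div (.minPow hq hj (hu.add (.const 1)))

end Loops

/-! ### Integers of polynomial bit length. -/

section BigNat

/-- A natural number, measured by its binary length. -/
structure BigNat where
  val : ℕ

instance : Coded BigNat where
  enc b := .num b.val
  meas b := 1 + b.val.size
  size_le _ := le_rfl

/-- The number `f a` is computed in polynomial time; its binary length is then polynomially
bounded, but not necessarily its value. -/
@[fun_prop]
def PolyTimeBig {α : Type} [Coded α] (f : α → ℕ) : Prop :=
  PolyTime (fun a => BigNat.mk (f a))

variable {α β : Type} [Coded α] [Coded β] {f g : α → ℕ}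

theorem PolyTime.big (hf : PolyTime f) : PolyTimeBig f := by
  have h : PolyTime (fun n : ℕ => BigNat.mk n) :=
    .of_primitive .id (fun _ => rfl) (fun _ => rfl)
      (PolyBounded.meas.mono fun n => size_le n)
  exact h.comp hf

/-- The program is unchanged; only the measure of its output is replaced. -/
theorem PolyTime.of_big (hf : PolyTimeBig f) (hb : PolyBounded f) : PolyTime f := by
  obtain ⟨P, hP, hPt, -⟩ := hf
  exact ⟨P, hP, hPt, hb.add (PolyBounded.const 1)⟩

theorem PolyTimeBig.comp {f : β → ℕ} {g : α → β} (hf : PolyTimeBig f) (hg : PolyTime g) :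
    PolyTimeBig (fun a => f (g a)) :=
  PolyTime.comp (f := fun b => BigNat.mk (f b)) hf hg

theorem PolyTimeBig.val : PolyTimeBig (fun b : BigNat => b.val) :=
  PolyTime.id

theorem PolyTimeBig.bound (hf : PolyTimeBig f) : PolyBounded (fun a => (f a).size) :=
  (PolyTime.bound hf).mono fun _ => Nat.le_add_left _ _

theorem PolyTimeBig.binary {op : ℕ → ℕ → ℕ} (P : Prog) (hP : P.eval = SExp.arith op)
    (ht : ∀ v, P.time v = (v.size + 1) ^ 2) (hop : ∀ m n, (op m n).size ≤ m.size + n.size + 1)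
    (hf : PolyTimeBig f) (hg : PolyTimeBig g) : PolyTimeBig (fun a => op (f a) (g a)) := by
  have h : PolyTime (fun p : BigNat × BigNat => BigNat.mk (op p.1.val p.2.val)) := by
    refine .of_primitive P (fun p => by rw [hP]; rfl) ht (PolyBounded.meas.mono fun p => ?_)
    have : meas p = 1 + (1 + p.1.val.size) + (1 + p.2.val.size) := rfl
    have h2 : meas (BigNat.mk (op p.1.val p.2.val)) = 1 + (op p.1.val p.2.val).size := rfl
    have := hop p.1.val p.2.val
    omega
  exact h.comp (PolyTime.prodMk hf hg)

theorem PolyTimeBig.add (hf : PolyTimeBig f) (hg : PolyTimeBig g) :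
    PolyTimeBig (fun a => f a + g a) := by
  refine PolyTimeBig.binary .add rfl (fun _ => rfl) (fun m n => Nat.size_le.2 ?_) hf hg
  have h1 := Nat.lt_size_self m
  have h2 := Nat.lt_size_self n
  have h3 : 2 ^ m.size ≤ 2 ^ (m.size + n.size) := Nat.pow_le_pow_right (by omega) (by omega)
  have h4 : 2 ^ n.size ≤ 2 ^ (m.size + n.size) := Nat.pow_le_pow_right (by omega) (by omega)
  rw [pow_succ]
  omega

theorem PolyTimeBig.sub (hf : PolyTimeBig f) (hg : PolyTimeBig g) :
    PolyTimeBig (fun a => f a - g a) :=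
  PolyTimeBig.binary .sub rfl (fun _ => rfl)
    (fun m n => (Nat.size_le_size (Nat.sub_le m n)).trans (by omega)) hf hg

theorem PolyTimeBig.div (hf : PolyTimeBig f) (hg : PolyTimeBig g) :
    PolyTimeBig (fun a => f a / g a) :=
  PolyTimeBig.binary .div rfl (fun _ => rfl)
    (fun m n => (Nat.size_le_size (Nat.div_le_self m n)).trans (by omega)) hf hg

theorem PolyTimeBig.mul (hf : PolyTimeBig f) (hg : PolyTimeBig g) :
    PolyTimeBig (fun a => f a * g a) := by
  refine PolyTimeBig.binary .mul rfl (fun _ => rfl) (fun m n => Nat.size_le.2 ?_) hf hg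
  refine (Nat.mul_lt_mul'' (Nat.lt_size_self m) (Nat.lt_size_self n)).trans_le ?_
  rw [← pow_add]
  exact Nat.pow_le_pow_right (by omega) (by omega)

theorem PolyDec.le_big (hf : PolyTimeBig f) (hg : PolyTimeBig g) :
    PolyDec (fun a => f a ≤ g a) := by
  have h1 : PolyTimeBig (fun a => f a - g a) := hf.sub hg
  -- With truncated subtraction, x - (x - 1) is 0 for x = 0 and 1 otherwise: a sign bit of small
  -- value is obtained from a possibly huge difference.
  have h2 : PolyTimeBig (fun a => (f a - g a) - ((f a - g a) - 1)) :=
    h1.sub (h1.sub (PolyTime.const 1).big)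
  have h3 := PolyTime.of_big h2 ((PolyBounded.const 1).mono fun a => by omega)
  exact (PolyDec.eq h3 (.const 0)).iff fun a => by omega

theorem PolyTimeBig.sum {f : α → ℕ → ℕ} {t : α → ℕ}
    (hf : PolyTimeBig (fun p : α × ℕ => f p.1 p.2)) (ht : PolyTime t) :
    PolyTimeBig (fun a => ∑ j ∈ Finset.range (t a), f a j) := by
  obtain ⟨c, hc⟩ := hf.bound
  refine PolyTime.natRec (F := fun a i s => ⟨s.val + f a i⟩)
    (R := fun a i => BigNat.mk (∑ j ∈ Finset.range i, f a j)) (init := fun _ => ⟨0⟩)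
    (B := fun a => 1 + (meas (t a) + c * (1 + meas a + meas (t a)) ^ c))
    (PolyTimeBig.add (PolyTimeBig.comp PolyTimeBig.val (by fun_prop)) (PolyTimeBig.comp
      (f := fun p : α × ℕ => f p.1 p.2) (g := fun p : α × ℕ × BigNat => (p.1, p.2.1)) hf
      (by fun_prop))) (by fun_prop) ht
    (by simp) (fun a i => by rw [Finset.sum_range_succ])
    ((PolyBounded.const 1).add (ht.bound.add ((PolyBounded.const c).mul
      ((((PolyBounded.const 1).add PolyBounded.meas).add ht.bound).pow c)))) fun a i hi => ?_
  refine Nat.add_le_add_left (Nat.size_le.2 ?_) 1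
  have hj : ∀ j ∈ Finset.range i, f a j ≤ 2 ^ (c * (1 + meas a + meas (t a)) ^ c) := by
    intro j hj
    refine (Nat.size_le.1 ((hc (a, j)).trans ?_)).le
    refine Nat.mul_le_mul_left _ (Nat.pow_le_pow_left ?_ c)
    have := Finset.mem_range.1 hj
    simp only [meas_prod, meas_nat]
    omega
  refine (Finset.sum_le_card_nsmul _ _ _ hj).trans_lt ?_
  rw [Finset.card_range, smul_eq_mul, pow_add]
  refine Nat.mul_lt_mul_of_pos_right ?_ (by positivity)
  exact Nat.lt_two_pow_self.trans_le (Nat.pow_le_pow_right (by omega) (by rw [meas_nat]; omega))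

theorem PolyTimeBig.prod {f : α → ℕ → ℕ} {t : α → ℕ}
    (hf : PolyTimeBig (fun p : α × ℕ => f p.1 p.2)) (ht : PolyTime t) :
    PolyTimeBig (fun a => ∏ j ∈ Finset.range (t a), f a j) := by
  obtain ⟨c, hc⟩ := hf.bound
  refine PolyTime.natRec (F := fun a i s => ⟨s.val * f a i⟩)
    (R := fun a i => BigNat.mk (∏ j ∈ Finset.range i, f a j)) (init := fun _ => ⟨1⟩)
    (B := fun a => 1 + (meas (t a) * (c * (1 + meas a + meas (t a)) ^ c) + 1))
    (PolyTimeBig.mul (PolyTimeBig.comp PolyTimeBig.val (by fun_prop)) (PolyTimeBig.comp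
      (f := fun p : α × ℕ => f p.1 p.2) (g := fun p : α × ℕ × BigNat => (p.1, p.2.1)) hf
      (by fun_prop))) (by fun_prop) ht
    (by simp) (fun a i => by rw [Finset.prod_range_succ])
    ((PolyBounded.const 1).add ((ht.bound.mul ((PolyBounded.const c).mul
      ((((PolyBounded.const 1).add PolyBounded.meas).add ht.bound).pow c))).add
      (PolyBounded.const 1))) fun a i hi => ?_
  refine Nat.add_le_add_left (Nat.size_le.2 ?_) 1
  have hj : ∀ j ∈ Finset.range i, f a j ≤ 2 ^ (c * (1 + meas a + meas (t a)) ^ c) := by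
    intro j hj
    refine (Nat.size_le.1 ((hc (a, j)).trans ?_)).le
    refine Nat.mul_le_mul_left _ (Nat.pow_le_pow_left ?_ c)
    have := Finset.mem_range.1 hj
    simp only [meas_prod, meas_nat]
    omega
  refine (Finset.prod_le_pow_card _ _ _ hj).trans_lt ?_
  rw [Finset.card_range, ← pow_mul]
  refine Nat.pow_lt_pow_right (by omega) (Nat.lt_succ_of_le ?_)
  rw [mul_comm]
  exact Nat.mul_le_mul_right _ (by rw [meas_nat]; omega)

theorem PolyTimeBig.pow (hf : PolyTimeBig f) (hg : PolyTime g) :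
    PolyTimeBig (fun a => f a ^ g a) := by
  have h := PolyTimeBig.prod (f := fun a _ => f a) (t := g)
    (PolyTimeBig.comp (f := f) (g := fun p : α × ℕ => p.1) hf PolyTime.fst) hg
  simpa using h

end BigNat

/-! ### Lists: access by index and tabulation. -/

section Lists

variable {α β : Type} [Coded α] [Coded β]

theorem encodeList_size_le (l : List β) :
    (encodeList (l.map enc)).size ≤ 1 + (l.map fun x => 1 + meas x).sum := by
  induction l with
  | nil => simp [encodeList, SExp.size]
  | cons x l ih =>
    have := size_le x
    simp only [List.map_cons, encodeList, SExp.size, List.sum_cons]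
    omega

instance : Coded (List β) where
  enc l := encodeList (l.map enc)
  meas l := 1 + (l.map fun x => 1 + meas x).sum
  size_le := encodeList_size_le

theorem enc_list (l : List β) : enc l = encodeList (l.map enc) := rfl

theorem meas_list (l : List β) : meas l = 1 + (l.map fun x => 1 + meas x).sum := rfl

theorem meas_cons (x : β) (l : List β) : meas (x :: l) = 1 + meas x + meas l := by
  simp only [meas_list, List.map_cons, List.sum_cons]
  omega

@[fun_prop]
theorem PolyTime.cons {f : α → β} {g : α → List β} (hf : PolyTime f) (hg : PolyTime g) :
    PolyTime (fun a => f a :: g a) := by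
  obtain ⟨P, hP, hPt, hb⟩ := hf.prodMk hg
  exact ⟨P, hP, hPt, hb.mono fun a => by rw [meas_cons, meas_prod]⟩

theorem meas_tail_le (l : List β) : meas l.tail ≤ meas l := by
  cases l with
  | nil => exact le_rfl
  | cons x l =>
    rw [List.tail_cons, meas_cons]
    omega

theorem PolyTime.tail : PolyTime (fun l : List β => l.tail) :=
  .of_primitive .right (fun l => by cases l <;> rfl) (fun _ => rfl)
    (PolyBounded.meas.mono meas_tail_le)

theorem PolyTime.headD : PolyTime (fun l : List ℕ => l.headD 0) :=
  .of_primitive .left (fun l => by cases l <;> rfl) (fun _ => rfl)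
    (PolyBounded.meas.mono fun l => by
      cases l with
      | nil => exact le_rfl
      | cons x l =>
        rw [List.headD_cons, meas_cons]
        omega)

theorem List.headD_iterate_tail (l : List ℕ) (i : ℕ) :
    (List.tail^[i] l).headD 0 = l.getD i 0 := by
  induction i generalizing l with
  | zero => cases l <;> rfl
  | succ i ih =>
    rw [Function.iterate_succ_apply, ih]
    cases l <;> rfl

@[fun_prop]
theorem PolyTime.getD {l : α → List ℕ} {i : α → ℕ} (hl : PolyTime l) (hi : PolyTime i) :
    PolyTime (fun a => (l a).getD (i a) 0) := by
  simp only [← List.headD_iterate_tail]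
  refine PolyTime.headD.comp (PolyTime.iterate (F := fun _ => List.tail)
    (PolyTime.tail.comp PolyTime.snd) hl hi hl.bound fun a i => ?_)
  induction i with
  | zero => exact le_rfl
  | succ i ih =>
    rw [Function.iterate_succ_apply']
    exact (meas_tail_le _).trans ih

theorem PolyTime.mapRange {f : α → ℕ → β} {t : α → ℕ}
    (hf : PolyTime (fun p : α × ℕ => f p.1 p.2)) (ht : PolyTime t) :
    PolyTime (fun a => (List.range (t a)).map (f a)) := by
  obtain ⟨c, hc⟩ := hf.bound
  have h := PolyTime.natRec
    -- Lists grow at the head, so the table is built from its end: after `i` rounds the state is the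
    -- suffix of length `i`. The test `i < t a` makes the recurrence hold for every `i`, as
    -- `PolyTime.natRec` demands.
    (F := fun a i (s : List β) => if i < t a then f a (t a - (i + 1)) :: s else s)
    (R := fun a i => ((List.range (t a)).map (f a)).drop (t a - i)) (init := fun _ => [])
    (B := fun a => 1 + meas (t a) * (1 + c * (1 + meas a + meas (t a)) ^ c))
    (PolyTime.ite (PolyDec.lt (by fun_prop) (by fun_prop))
      (PolyTime.cons (hf.comp (f := fun p : α × ℕ => f p.1 p.2)
      (g := fun p : α × ℕ × List β => (p.1, t p.1 - (p.2.1 + 1))) (by fun_prop))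
      (by fun_prop)) (by fun_prop)) (by fun_prop) ht
    (by simp) (fun a i => ?_)
    ((PolyBounded.const 1).add (ht.bound.mul ((PolyBounded.const 1).add ((PolyBounded.const c).mul
      ((((PolyBounded.const 1).add PolyBounded.meas).add ht.bound).pow c))))) fun a i hi => ?_
  · simpa using h
  · split_ifs with h
    · rw [List.drop_eq_getElem_cons (by simp; omega)]
      simp only [List.getElem_map, List.getElem_range, List.cons.injEq, true_and]
      congr 1
      omega
    · rw [Nat.sub_eq_zero_of_le (by omega), Nat.sub_eq_zero_of_le (by omega)]
  · rw [meas_list, add_le_add_iff_left]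
    refine (List.sum_le_card_nsmul _ (1 + c * (1 + meas a + meas (t a)) ^ c) ?_).trans ?_
    · intro x hx
      simp only [List.mem_map] at hx
      obtain ⟨y, hy, rfl⟩ := hx
      obtain ⟨j, hj, rfl⟩ := List.mem_map.1 (List.mem_of_mem_drop hy)
      refine Nat.add_le_add_left ((hc (a, j)).trans ?_) 1
      refine Nat.mul_le_mul_left _ (Nat.pow_le_pow_left ?_ c)
      have := List.mem_range.1 hj
      simp only [meas_prod, meas_nat]
      omega
    · rw [smul_eq_mul]
      refine Nat.mul_le_mul_right _ ?_
      simp only [List.length_map, List.length_drop, List.length_range, meas_nat]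
      omega

end Lists

/-! ### Arithmetic of binary fields as polynomial-time functions on numbers. -/

section Arithmetic

/-- The product of `a` by the generator, in the field with `Q` elements given by the
polynomial with bits `f`; elements are numbers less than `Q`. -/
def gfDouble (f Q a : ℕ) : ℕ :=
  min (if 2 * a < Q then 2 * a else (2 * a) ^^^ f) Q

/-- One step of the multiplication algorithm. -/
def gfMulStep (f Q : ℕ) (s : ℕ × ℕ × ℕ) : ℕ × ℕ × ℕ :=
  (gfDouble f Q s.1, s.2.1 / 2, min (if s.2.1 % 2 = 0 then s.2.2 else s.2.2 ^^^ s.1) Q)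

/-- Product in the field with `Q` elements given by the polynomial with bits `f`. -/
def gfMul (f Q a b : ℕ) : ℕ :=
  ((gfMulStep f Q)^[b] (a, b, 0)).2.2

/-- One step of the evaluation of a polynomial. -/
def gfEvalStep (f Q x : ℕ) (s : ℕ × ℕ × ℕ) : ℕ × ℕ × ℕ :=
  (s.1 / Q, gfMul f Q s.2.1 x, min (s.2.2 ^^^ gfMul f Q (s.1 % Q) s.2.1) Q)

/-- Value at `x` of the polynomial of degree less than `t` whose coefficients are the digits of
`u` in base `Q`. -/
def gfEval (f Q u x t : ℕ) : ℕ :=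
  ((gfEvalStep f Q x)^[t] (u, 1, 0)).2.2

/-- Value at `z` of `y * (1 + X + ... + X ^ (t - 1))`. -/
def gfGeom (f Q y z t : ℕ) : ℕ :=
  (fun s => min (gfMul f Q s z ^^^ y) Q)^[t] 0

/-- Multiplication modulo the polynomial with bits `f` has no zero divisors. -/
def GfMulNoZeroDivisors (f Q : ℕ) : Prop :=
  ∀ a < Q, ∀ b < Q, a ≠ 0 → b ≠ 0 → gfMul f Q a b ≠ 0

open Classical in
/-- The bits of a polynomial that defines a field with `Q` elements. -/
noncomputable def gfPoly (Q : ℕ) : ℕ :=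
  Q + boundedFind (fun j => GfMulNoZeroDivisors (Q + j) Q) Q

variable {α : Type} [Coded α]

theorem sum_bits (m t : ℕ) : ∑ j ∈ Finset.range t, (m / 2 ^ j % 2) * 2 ^ j = m % 2 ^ t := by
  induction t with
  | zero => simp [Nat.mod_one]
  | succ t ih => rw [Finset.sum_range_succ, ih, Nat.mod_pow_succ, mul_comm]

/-- Exclusive or is not a primitive operation and is assembled bit by bit. The cap on 2^j is
harmless: it takes effect only where both bits vanish. -/
theorem xor_eq_sum (a b : ℕ) : a ^^^ b = ∑ j ∈ Finset.range (a + b),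
    ((a / 2 ^ j + b / 2 ^ j) % 2) * min (2 ^ j) (a + b + 1) := by
  have ha : a < 2 ^ (a + b) :=
    Nat.lt_two_pow_self.trans_le (Nat.pow_le_pow_right (by omega) (by omega))
  have hb : b < 2 ^ (a + b) :=
    Nat.lt_two_pow_self.trans_le (Nat.pow_le_pow_right (by omega) (by omega))
  rw [← Nat.mod_eq_of_lt (Nat.xor_lt_two_pow ha hb), ← sum_bits]
  refine Finset.sum_congr rfl fun j _ => ?_
  rw [Nat.xor_div_two_pow, Nat.xor_mod_two_eq]
  rcases le_total (2 ^ j) (a + b + 1) with h | h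
  · rw [min_eq_left h]
  · rw [Nat.div_eq_of_lt (show a < 2 ^ j by omega), Nat.div_eq_of_lt (show b < 2 ^ j by omega)]
    simp

@[fun_prop]
theorem PolyTime.xor {f g : α → ℕ} (hf : PolyTime f) (hg : PolyTime g) :
    PolyTime (fun a => f a ^^^ g a) := by
  simp only [xor_eq_sum]
  exact PolyTime.sum (f := fun a j => ((f a / 2 ^ j + g a / 2 ^ j) % 2) *
    min (2 ^ j) (f a + g a + 1)) (.mul (by fun_prop)
      (.minPow (by fun_prop) (by fun_prop) (by fun_prop))) (by fun_prop)

@[fun_prop]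
theorem PolyTime.gfDouble {f Q x : α → ℕ} (hf : PolyTime f) (hQ : PolyTime Q) (hx : PolyTime x) :
    PolyTime (fun a => gfDouble (f a) (Q a) (x a)) :=
  .natMin (.ite (.lt (by fun_prop) hQ) (by fun_prop) (by fun_prop)) hQ

theorem gfDouble_le (f Q a : ℕ) : gfDouble f Q a ≤ Q :=
  min_le_right _ _

/-- The caps at `Q` in the definitions make these bounds hold for arbitrary arguments, even if `f`
and `Q` define no field; polynomial time requires bounds without side conditions. -/
theorem gfMul_state_le (f Q a b i : ℕ) : ((gfMulStep f Q)^[i] (a, b, 0)).1 ≤ a + Q ∧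
    ((gfMulStep f Q)^[i] (a, b, 0)).2.1 ≤ b ∧ ((gfMulStep f Q)^[i] (a, b, 0)).2.2 ≤ Q := by
  induction i with
  | zero => simp
  | succ i ih =>
    rw [Function.iterate_succ_apply']
    exact ⟨(gfDouble_le _ _ _).trans (Nat.le_add_left _ _), (Nat.div_le_self _ _).trans ih.2.1,
      min_le_right _ _⟩

theorem gfMul_le (f Q a b : ℕ) : gfMul f Q a b ≤ Q :=
  (gfMul_state_le f Q a b b).2.2

@[fun_prop]
theorem PolyTime.gfMul {f Q x y : α → ℕ} (hf : PolyTime f) (hQ : PolyTime Q) (hx : PolyTime x)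
    (hy : PolyTime y) : PolyTime (fun a => gfMul (f a) (Q a) (x a) (y a)) := by
  have h := PolyTime.iterate (F := fun a => gfMulStep (f a) (Q a)) (init := fun a => (x a, y a, 0))
    (t := y) (B := fun a => 1 + (meas (x a) + meas (Q a)) + (1 + meas (y a) + meas (Q a)))
    (.prodMk (by fun_prop) (.prodMk (by fun_prop) (.natMin
      (.ite (.eq (by fun_prop) (by fun_prop)) (by fun_prop) (by fun_prop)) (by fun_prop))))
    (by fun_prop) hy
    (((PolyBounded.const 1).add (hx.bound.add hQ.bound)).add
      (((PolyBounded.const 1).add hy.bound).add hQ.bound)) (fun a i => by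
        have := gfMul_state_le (f a) (Q a) (x a) (y a) i
        simp only [meas_prod, meas_nat]
        omega)
  exact (PolyTime.snd.comp PolyTime.snd).comp h

theorem gfEval_state_le (f Q u x i : ℕ) : ((gfEvalStep f Q x)^[i] (u, 1, 0)).1 ≤ u ∧
    ((gfEvalStep f Q x)^[i] (u, 1, 0)).2.1 ≤ Q + 1 ∧
    ((gfEvalStep f Q x)^[i] (u, 1, 0)).2.2 ≤ Q := by
  induction i with
  | zero => simp
  | succ i ih =>
    rw [Function.iterate_succ_apply']
    exact ⟨(Nat.div_le_self _ _).trans ih.1, (gfMul_le _ _ _ _).trans (Nat.le_succ _),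
      min_le_right _ _⟩

@[fun_prop]
theorem PolyTime.gfEval {f Q u x t : α → ℕ} (hf : PolyTime f) (hQ : PolyTime Q) (hu : PolyTime u)
    (hx : PolyTime x) (ht : PolyTime t) :
    PolyTime (fun a => gfEval (f a) (Q a) (u a) (x a) (t a)) := by
  have h := PolyTime.iterate (F := fun a => gfEvalStep (f a) (Q a) (x a))
    (init := fun a => (u a, 1, 0)) (t := t)
    (B := fun a => 1 + meas (u a) + (1 + (meas (Q a) + 1) + meas (Q a)))
    (.prodMk (by fun_prop) (.prodMk (by fun_prop) (.natMin (by fun_prop) (by fun_prop))))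
    (by fun_prop) ht
    (((PolyBounded.const 1).add hu.bound).add
      (((PolyBounded.const 1).add (hQ.bound.add (PolyBounded.const 1))).add hQ.bound))
      (fun a i => by
        have := gfEval_state_le (f a) (Q a) (u a) (x a) i
        simp only [meas_prod, meas_nat]
        omega)
  exact (PolyTime.snd.comp PolyTime.snd).comp h

@[fun_prop]
theorem PolyTime.gfGeom {f Q y z t : α → ℕ} (hf : PolyTime f) (hQ : PolyTime Q) (hy : PolyTime y)
    (hz : PolyTime z) (ht : PolyTime t) :
    PolyTime (fun a => gfGeom (f a) (Q a) (y a) (z a) (t a)) := by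
  refine PolyTime.iterate (F := fun a s => min (_root_.gfMul (f a) (Q a) s (z a) ^^^ y a) (Q a))
    (init := fun _ => 0) (t := t) (B := fun a => meas (Q a))
    (.natMin (by fun_prop) (by fun_prop)) (by fun_prop) ht hQ.bound fun a i => ?_
  cases i with
  | zero => simp [meas_nat]
  | succ i =>
    rw [Function.iterate_succ_apply', meas_nat, meas_nat]
    omega

theorem PolyDec.noZeroDivisors {f Q : α → ℕ} (hf : PolyTime f) (hQ : PolyTime Q) :
    PolyDec (fun a => GfMulNoZeroDivisors (f a) (Q a)) := by
  refine PolyDec.ball (p := fun a x => ∀ b < Q a, x ≠ 0 → b ≠ 0 → gfMul (f a) (Q a) x b ≠ 0)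
    (PolyDec.ball (p := fun (a : α × ℕ) b => a.2 ≠ 0 → b ≠ 0 →
      gfMul (f a.1) (Q a.1) a.2 b ≠ 0) ?_ (by fun_prop)) hQ
  exact .imp (.ne (by fun_prop) (.const 0)) (.imp (.ne (by fun_prop) (.const 0))
    (.ne (by fun_prop) (.const 0)))

open Classical in
@[fun_prop]
theorem PolyTime.gfPoly {Q : α → ℕ} (hQ : PolyTime Q) : PolyTime (fun a => gfPoly (Q a)) :=
  .add hQ (.boundedFind (p := fun a j => GfMulNoZeroDivisors (Q a + j) (Q a))
    (.noZeroDivisors (by fun_prop) (by fun_prop)) hQ)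

end Arithmetic

/-! ### Numbers below 2^r as the elements of a field with 2^r elements. -/

section BinaryField

open Polynomial

variable {R : Type*} [CommRing R]

/-- The value at `θ` of the polynomial whose coefficients are the bits of a number. -/
def bitEval (θ : R) (a : ℕ) : R :=
  if _h : a = 0 then 0 else (a % 2 : ℕ) + θ * bitEval θ (a / 2)
termination_by a
decreasing_by omega

theorem bitEval_zero (θ : R) : bitEval θ 0 = 0 := by
  rw [bitEval, dif_pos rfl]

theorem bitEval_eq (θ : R) (a : ℕ) : bitEval θ a = (a % 2 : ℕ) + θ * bitEval θ (a / 2) := by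
  by_cases h : a = 0
  · simp [h, bitEval_zero]
  · rw [bitEval, dif_neg h]

theorem bitEval_one (θ : R) : bitEval θ 1 = 1 := by
  rw [bitEval_eq]
  simp [bitEval_zero]

theorem bitEval_two_mul (θ : R) (a : ℕ) : bitEval θ (2 * a) = θ * bitEval θ a := by
  rw [bitEval_eq]
  simp

theorem map_bitEval {S : Type*} [CommRing S] (g : R →+* S) (θ : R) (a : ℕ) :
    g (bitEval θ a) = bitEval (g θ) a := by
  induction a using Nat.strong_induction_on with
  | _ a ih =>
    by_cases h : a = 0
    · simp [h, bitEval_zero]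
    · rw [bitEval_eq θ, bitEval_eq (g θ), map_add, map_mul, ih (a / 2) (by omega), map_natCast]

/-- In characteristic 2 coefficients add without carry. -/
theorem bitEval_xor [CharP R 2] (θ : R) (a b : ℕ) :
    bitEval θ (a ^^^ b) = bitEval θ a + bitEval θ b := by
  induction a using Nat.strong_induction_on generalizing b with
  | _ a ih =>
    by_cases h : a = 0
    · simp [h, bitEval_zero]
    · rw [bitEval_eq θ a, bitEval_eq θ b, bitEval_eq θ (a ^^^ b), Nat.xor_div_two,
        ih (a / 2) (by omega), Nat.xor_mod_two_eq, ← CharP.cast_eq_mod, ← CharP.cast_eq_mod,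
        ← CharP.cast_eq_mod]
      push_cast
      ring

/-- The element `θ` is a root of the polynomial with bits `f`, which has degree `r`. -/
structure IsBinaryRoot (r f : ℕ) (θ : R) : Prop where
  le : 2 ^ r ≤ f
  lt : f < 2 ^ (r + 1)
  root : bitEval θ f = 0

variable [CharP R 2] {r f : ℕ} {θ : R}

theorem gfDouble_spec (h : IsBinaryRoot r f θ) {a : ℕ} (ha : a < 2 ^ r) :
    gfDouble f (2 ^ r) a < 2 ^ r ∧ bitEval θ (gfDouble f (2 ^ r) a) = θ * bitEval θ a := by
  have key : (if 2 * a < 2 ^ r then 2 * a else (2 * a) ^^^ f) < 2 ^ r ∧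
      bitEval θ (if 2 * a < 2 ^ r then 2 * a else (2 * a) ^^^ f) = θ * bitEval θ a := by
    split_ifs with h2
    · exact ⟨h2, bitEval_two_mul θ a⟩
    · refine ⟨?_, by rw [bitEval_xor, h.root, add_zero, bitEval_two_mul]⟩
      have hf := h.lt
      have hf' := h.le
      rw [pow_succ] at hf
      -- Both `2 * a` and `f` have leading bit r, so these bits cancel: this is reduction modulo the
      -- polynomial.
      have h0 : (2 * a ^^^ f) / 2 ^ r = 0 := by
        rw [Nat.xor_div_two_pow, Nat.div_eq_of_lt_le (k := 1) (by omega) (by omega),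
          Nat.div_eq_of_lt_le (k := 1) (by omega) (by omega)]
        rfl
      exact (Nat.div_eq_zero_iff_lt (by positivity)).1 h0
  rw [gfDouble, min_eq_left key.1.le]
  exact key

theorem gfMul_spec (h : IsBinaryRoot r f θ) {a b : ℕ} (ha : a < 2 ^ r) :
    gfMul f (2 ^ r) a b < 2 ^ r ∧
      bitEval θ (gfMul f (2 ^ r) a b) = bitEval θ a * bitEval θ b := by
  -- The invariant of binary multiplication: running multiple times remaining multiplier plus
  -- accumulator. After `b` rounds the multiplier b / 2^b is 0.
  have key : ∀ i, ((gfMulStep f (2 ^ r))^[i] (a, b, 0)).1 < 2 ^ r ∧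
      ((gfMulStep f (2 ^ r))^[i] (a, b, 0)).2.1 = b / 2 ^ i ∧
      ((gfMulStep f (2 ^ r))^[i] (a, b, 0)).2.2 < 2 ^ r ∧
      bitEval θ ((gfMulStep f (2 ^ r))^[i] (a, b, 0)).1 *
        bitEval θ ((gfMulStep f (2 ^ r))^[i] (a, b, 0)).2.1 +
        bitEval θ ((gfMulStep f (2 ^ r))^[i] (a, b, 0)).2.2 = bitEval θ a * bitEval θ b := by
    intro i
    induction i with
    | zero => simp [ha, bitEval_zero]
    | succ i ih =>
      rw [Function.iterate_succ_apply']
      generalize (gfMulStep f (2 ^ r))^[i] (a, b, 0) = s at ih ⊢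
      obtain ⟨x, y, z⟩ := s
      simp only at ih
      obtain ⟨h1, h2, h3, h4⟩ := ih
      obtain ⟨h5, h6⟩ := gfDouble_spec h h1
      have h7 : (if y % 2 = 0 then z else z ^^^ x) < 2 ^ r := by
        split_ifs
        · exact h3
        · exact Nat.xor_lt_two_pow h3 h1
      simp only [gfMulStep, min_eq_left h7.le]
      refine ⟨h5, by rw [h2, Nat.div_div_eq_div_mul, pow_succ], h7, ?_⟩
      rw [← h4, h6, bitEval_eq θ y]
      split_ifs with h8
      · rw [h8]
        push_cast
        ring
      · rw [show y % 2 = 1 by omega, bitEval_xor]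
        push_cast
        ring
  obtain ⟨-, h2, h3, h4⟩ := key b
  refine ⟨h3, ?_⟩
  rw [h2, Nat.div_eq_of_lt Nat.lt_two_pow_self, bitEval_zero, mul_zero, zero_add] at h4
  exact h4

theorem gfEval_spec (h : IsBinaryRoot r f θ) (hr : r ≠ 0) (u x t : ℕ) :
    gfEval f (2 ^ r) u x t < 2 ^ r ∧ bitEval θ (gfEval f (2 ^ r) u x t) =
      ∑ j ∈ Finset.range t, bitEval θ (u / (2 ^ r) ^ j % 2 ^ r) * bitEval θ x ^ j := by
  have key : ∀ i, ((gfEvalStep f (2 ^ r) x)^[i] (u, 1, 0)).1 = u / (2 ^ r) ^ i ∧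
      ((gfEvalStep f (2 ^ r) x)^[i] (u, 1, 0)).2.1 < 2 ^ r ∧
      bitEval θ ((gfEvalStep f (2 ^ r) x)^[i] (u, 1, 0)).2.1 = bitEval θ x ^ i ∧
      ((gfEvalStep f (2 ^ r) x)^[i] (u, 1, 0)).2.2 < 2 ^ r ∧
      bitEval θ ((gfEvalStep f (2 ^ r) x)^[i] (u, 1, 0)).2.2 =
        ∑ j ∈ Finset.range i, bitEval θ (u / (2 ^ r) ^ j % 2 ^ r) * bitEval θ x ^ j := by
    intro i
    induction i with
    | zero => simp [bitEval_zero, bitEval_one, Nat.one_lt_two_pow hr]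
    | succ i ih =>
      rw [Function.iterate_succ_apply', Finset.sum_range_succ]
      generalize (gfEvalStep f (2 ^ r) x)^[i] (u, 1, 0) = s at ih ⊢
      obtain ⟨v, p, z⟩ := s
      simp only at ih
      obtain ⟨h1, h2, h3, h4, h5⟩ := ih
      obtain ⟨h6, h7⟩ := gfMul_spec h h2 (b := x)
      obtain ⟨h8, h9⟩ := gfMul_spec h (Nat.mod_lt v (by positivity)) (b := p)
      have h10 := Nat.xor_lt_two_pow h4 h8
      simp only [gfEvalStep, min_eq_left h10.le]
      refine ⟨by rw [h1, Nat.div_div_eq_div_mul, pow_succ], h6, by rw [h7, h3, pow_succ], h10, ?_⟩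
      rw [bitEval_xor, h5, h9, h3, h1]
  exact (key t).2.2.2

theorem gfGeom_spec (h : IsBinaryRoot r f θ) {y : ℕ} (hy : y < 2 ^ r) (z t : ℕ) :
    gfGeom f (2 ^ r) y z t < 2 ^ r ∧ bitEval θ (gfGeom f (2 ^ r) y z t) =
      bitEval θ y * ∑ j ∈ Finset.range t, bitEval θ z ^ j := by
  induction t with
  | zero => simp [gfGeom, bitEval_zero]
  | succ t ih =>
    rw [gfGeom, Function.iterate_succ_apply']
    change min (gfMul f (2 ^ r) (gfGeom f (2 ^ r) y z t) z ^^^ y) (2 ^ r) < 2 ^ r ∧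
      bitEval θ (min (gfMul f (2 ^ r) (gfGeom f (2 ^ r) y z t) z ^^^ y) (2 ^ r)) = _
    obtain ⟨h1, h2⟩ := gfMul_spec h ih.1 (b := z)
    have h3 := Nat.xor_lt_two_pow h1 hy
    rw [min_eq_left h3.le]
    refine ⟨h3, ?_⟩
    -- Horner's rule.
    rw [bitEval_xor, h2, ih.2, Finset.sum_range_succ', Finset.mul_sum, mul_add, Finset.sum_mul,
      Finset.mul_sum]
    simp only [pow_succ, mul_assoc, pow_zero, mul_one]

theorem degree_bitEval_X_lt {r a : ℕ} (ha : a < 2 ^ r) :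
    (bitEval (X : (ZMod 2)[X]) a).degree < r := by
  induction r generalizing a with
  | zero =>
    rw [show a = 0 by simpa using ha, bitEval_zero, degree_zero]
    exact WithBot.bot_lt_coe _
  | succ r ih =>
    rw [pow_succ] at ha
    have h := ih (a := a / 2) (by omega)
    rw [bitEval_eq, degree_lt_iff_coeff_zero]
    rw [degree_lt_iff_coeff_zero] at h
    intro m hm
    obtain ⟨m, rfl⟩ : ∃ l, m = l + 1 := ⟨m - 1, by omega⟩
    rw [coeff_add, coeff_X_mul, h m (by omega), add_zero, ← C_eq_natCast, coeff_C_succ]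

theorem eq_zero_of_bitEval_X {a : ℕ} (h : bitEval (X : (ZMod 2)[X]) a = 0) : a = 0 := by
  induction a using Nat.strong_induction_on with
  | _ a ih =>
    by_contra h0
    rw [bitEval_eq] at h
    have h1 := congrArg (fun p => coeff p 0) h
    simp only [coeff_add, mul_coeff_zero, coeff_X_zero, zero_mul, add_zero, coeff_zero,
      ← C_eq_natCast, coeff_C_zero] at h1
    rw [ZMod.natCast_eq_zero_iff] at h1
    have h2 : a % 2 = 0 := by omega
    rw [h2, Nat.cast_zero, zero_add] at h
    have := ih (a / 2) (by omega) ((mul_eq_zero.1 h).resolve_left X_ne_zero)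
    omega

theorem exists_bitEval_X {r : ℕ} {p : (ZMod 2)[X]} (hp : p.degree < r) :
    ∃ a < 2 ^ r, bitEval (X : (ZMod 2)[X]) a = p := by
  induction r generalizing p with
  | zero => exact ⟨0, by simp, by
      rw [bitEval_zero, eq_comm, ← degree_eq_bot]
      exact Nat.WithBot.lt_zero_iff.1 hp⟩
  | succ r ih =>
    obtain ⟨a, ha, hap⟩ := ih (p := p.divX) (by
      rw [degree_lt_iff_coeff_zero] at hp ⊢
      intro m hm
      rw [coeff_divX]
      exact hp _ (by omega))
    have hlt := ZMod.val_lt (p.coeff 0)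
    refine ⟨2 * a + (p.coeff 0).val, by rw [pow_succ]; omega, ?_⟩
    rw [bitEval_eq, show (2 * a + (p.coeff 0).val) % 2 = (p.coeff 0).val by omega,
      show (2 * a + (p.coeff 0).val) / 2 = a by omega, hap, ← C_eq_natCast, ZMod.natCast_val,
      ZMod.cast_id', id, add_comm, X_mul]
    exact divX_mul_X_add p

theorem natDegree_bitEval_X {r f : ℕ} (h1 : 2 ^ r ≤ f) (h2 : f < 2 ^ (r + 1)) :
    (bitEval (X : (ZMod 2)[X]) f).natDegree = r := by
  have h0 : bitEval (X : (ZMod 2)[X]) f ≠ 0 := fun h => by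
    have := eq_zero_of_bitEval_X h
    have : 0 < 2 ^ r := by positivity
    omega
  apply le_antisymm
  · have := degree_bitEval_X_lt h2
    rw [degree_eq_natDegree h0] at this
    exact Nat.lt_succ_iff.1 (by exact_mod_cast this)
  · by_contra! hlt
    obtain ⟨a, ha, hap⟩ := exists_bitEval_X (r := r) (p := bitEval (X : (ZMod 2)[X]) f) (by
      rw [degree_eq_natDegree h0]
      exact_mod_cast hlt)
    have : a ^^^ f = 0 := eq_zero_of_bitEval_X (by
      rw [bitEval_xor, hap, CharTwo.add_self_eq_zero])
    rw [Nat.xor_eq_zero_iff] at this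
    omega

theorem eq_zero_of_bitEval_root {r f a : ℕ} (h1 : 2 ^ r ≤ f) (h2 : f < 2 ^ (r + 1))
    (ha : a < 2 ^ r) (h : bitEval (AdjoinRoot.root (bitEval (X : (ZMod 2)[X]) f)) a = 0) :
    a = 0 := by
  apply eq_zero_of_bitEval_X
  rw [AdjoinRoot.root, ← map_bitEval, AdjoinRoot.mk_eq_zero] at h
  refine eq_zero_of_dvd_of_degree_lt h ((degree_bitEval_X_lt ha).trans_le ?_)
  have := natDegree_bitEval_X h1 h2
  rw [degree_eq_natDegree, this]
  intro h0
  have := eq_zero_of_bitEval_X h0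
  have : 0 < 2 ^ r := by positivity
  omega

theorem bitEval_root_self (f : ℕ) :
    bitEval (AdjoinRoot.root (bitEval (X : (ZMod 2)[X]) f)) f = 0 := by
  rw [AdjoinRoot.root, ← map_bitEval, AdjoinRoot.mk_self]

theorem charP_adjoinRoot {g : (ZMod 2)[X]} (hg : g.natDegree ≠ 0) : CharP (AdjoinRoot g) 2 :=
  charP_of_injective_ringHom (AdjoinRoot.of.injective_of_degree_ne_zero fun h => hg
    (by rw [natDegree, h]; rfl)) 2

/-- The minimal polynomial of a primitive element of the field with 2^r elements. -/
theorem exists_irreducible_two (r : ℕ) (hr : r ≠ 0) :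
    ∃ p : (ZMod 2)[X], Irreducible p ∧ p.natDegree = r := by
  have : Fact (Nat.Prime 2) := ⟨Nat.prime_two⟩
  obtain ⟨θ, hθ⟩ := Field.exists_primitive_element (ZMod 2) (GaloisField 2 r)
  refine ⟨minpoly (ZMod 2) θ, minpoly.irreducible (.of_finite _ _), ?_⟩
  rw [(Field.primitive_element_iff_minpoly_natDegree_eq _ θ).1 hθ, GaloisField.finrank 2 hr]

/-- Modulo an irreducible polynomial the quotient is a field, and a code below 2^r represents 0 only
if it is 0. With the converse below, irreducibility becomes a finite check on the multiplication
table. -/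
theorem noZeroDivisors_of_irreducible {r f : ℕ} (hr : r ≠ 0) (h1 : 2 ^ r ≤ f)
    (h2 : f < 2 ^ (r + 1)) (hf : Irreducible (bitEval (X : (ZMod 2)[X]) f)) :
    GfMulNoZeroDivisors f (2 ^ r) := by
  have := charP_adjoinRoot (g := bitEval (X : (ZMod 2)[X]) f)
    (by rw [natDegree_bitEval_X h1 h2]; exact hr)
  have : Fact (Irreducible (bitEval (X : (ZMod 2)[X]) f)) := ⟨hf⟩
  intro a ha b hb ha0 hb0 hab
  have := (gfMul_spec (θ := AdjoinRoot.root (bitEval (X : (ZMod 2)[X]) f))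
    ⟨h1, h2, bitEval_root_self f⟩ ha (b := b)).2
  rw [hab, bitEval_zero, eq_comm, mul_eq_zero] at this
  rcases this with h | h
  · exact ha0 (eq_zero_of_bitEval_root h1 h2 ha h)
  · exact hb0 (eq_zero_of_bitEval_root h1 h2 hb h)

/-- Proper factors of the polynomial have degree below r, so their codes are nonzero numbers below
2^r with product 0. -/
theorem irreducible_of_noZeroDivisors {r f : ℕ} (hr : r ≠ 0) (h1 : 2 ^ r ≤ f)
    (h2 : f < 2 ^ (r + 1)) (hf : GfMulNoZeroDivisors f (2 ^ r)) :
    Irreducible (bitEval (X : (ZMod 2)[X]) f) := by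
  have hdeg := natDegree_bitEval_X h1 h2
  have := charP_adjoinRoot (g := bitEval (X : (ZMod 2)[X]) f) (by rw [hdeg]; exact hr)
  have h0 : bitEval (X : (ZMod 2)[X]) f ≠ 0 := fun h => by
    rw [h, natDegree_zero] at hdeg
    exact hr hdeg.symm
  refine ⟨fun h => hr (hdeg ▸ natDegree_eq_zero_of_isUnit h), fun p q hpq => ?_⟩
  by_contra! hcon
  have hp0 : p ≠ 0 := fun h => h0 (by rw [hpq, h, zero_mul])
  have hq0 : q ≠ 0 := fun h => h0 (by rw [hpq, h, mul_zero])
  have hp : 0 < p.natDegree := by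
    rw [Nat.pos_iff_ne_zero]
    exact fun h => hcon.1 (isUnit_iff_degree_eq_zero.2 (by rw [degree_eq_natDegree hp0, h]; rfl))
  have hq : 0 < q.natDegree := by
    rw [Nat.pos_iff_ne_zero]
    exact fun h => hcon.2 (isUnit_iff_degree_eq_zero.2 (by rw [degree_eq_natDegree hq0, h]; rfl))
  have hsum : r = p.natDegree + q.natDegree := by
    rw [← hdeg, hpq, natDegree_mul hp0 hq0]
  obtain ⟨a, ha, rfl⟩ := exists_bitEval_X (r := r) (p := p) (by
    rw [degree_eq_natDegree hp0]
    exact_mod_cast (by omega : p.natDegree < r))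
  obtain ⟨b, hb, rfl⟩ := exists_bitEval_X (r := r) (p := q) (by
    rw [degree_eq_natDegree hq0]
    exact_mod_cast (by omega : q.natDegree < r))
  refine hf a ha b hb (fun h => hp0 (by rw [h, bitEval_zero]))
    (fun h => hq0 (by rw [h, bitEval_zero])) ?_
  obtain ⟨hlt, hmul⟩ := gfMul_spec (θ := AdjoinRoot.root (bitEval (X : (ZMod 2)[X]) f))
    ⟨h1, h2, bitEval_root_self f⟩ ha (b := b)
  apply eq_zero_of_bitEval_root h1 h2 hlt
  rw [hmul, AdjoinRoot.root, ← map_bitEval, ← map_bitEval, ← map_mul, ← hpq, AdjoinRoot.mk_self]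

theorem gfPoly_spec {r : ℕ} (hr : r ≠ 0) : 2 ^ r ≤ gfPoly (2 ^ r) ∧ gfPoly (2 ^ r) < 2 ^ (r + 1) ∧
    Irreducible (bitEval (X : (ZMod 2)[X]) (gfPoly (2 ^ r))) := by
  classical
  obtain ⟨p, hp, hpr⟩ := exists_irreducible_two r hr
  obtain ⟨f, hf, rfl⟩ := exists_bitEval_X (r := r + 1) (p := p) (by
    rw [degree_eq_natDegree hp.ne_zero, hpr]
    exact_mod_cast Nat.lt_succ_self r)
  have hle : 2 ^ r ≤ f := by
    by_contra! h
    have := degree_bitEval_X_lt h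
    rw [degree_eq_natDegree hp.ne_zero, hpr] at this
    exact lt_irrefl _ this
  -- Adding `j < 2 ^ r` to 2^r yields every polynomial of degree exactly r, so the search meets an
  -- irreducible one.
  have hs := boundedFind_spec (p := fun j => GfMulNoZeroDivisors (2 ^ r + j) (2 ^ r)) (t := 2 ^ r)
    ⟨f - 2 ^ r, by rw [pow_succ] at hf; omega, by
      rw [Nat.add_sub_cancel' hle]
      exact noZeroDivisors_of_irreducible hr hle hf hp⟩
  have h1 : 2 ^ r ≤ gfPoly (2 ^ r) := Nat.le_add_right _ _
  have h2 : gfPoly (2 ^ r) < 2 ^ (r + 1) := by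
    rw [pow_succ, mul_two, gfPoly]
    exact Nat.add_lt_add_left (by convert! hs.1) _
  exact ⟨h1, h2, irreducible_of_noZeroDivisors hr h1 h2 (by
    rw [gfPoly]
    convert! hs.2)⟩

/-- The numbers less than `2 ^ r` are the elements of a field. -/
theorem exists_field_model {r : ℕ} (hr : r ≠ 0) : ∃ (F : Type) (_ : Field F) (_ : CharP F 2)
    (θ : F), IsBinaryRoot r (gfPoly (2 ^ r)) θ ∧
      Set.BijOn (bitEval θ) (Set.Iio (2 ^ r)) Set.univ := by
  obtain ⟨h1, h2, h3⟩ := gfPoly_spec hr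
  have hdeg := natDegree_bitEval_X h1 h2
  have : Fact (Irreducible (bitEval (X : (ZMod 2)[X]) (gfPoly (2 ^ r)))) := ⟨h3⟩
  have hchar := charP_adjoinRoot (g := bitEval (X : (ZMod 2)[X]) (gfPoly (2 ^ r)))
    (by rw [hdeg]; exact hr)
  refine ⟨AdjoinRoot (bitEval (X : (ZMod 2)[X]) (gfPoly (2 ^ r))), inferInstance, hchar,
    AdjoinRoot.root _, ⟨h1, h2, bitEval_root_self _⟩, fun _ _ => Set.mem_univ _, ?_, ?_⟩
  · intro a ha b hb hab
    rw [Set.mem_Iio] at ha hb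
    rw [← Nat.xor_eq_zero_iff]
    apply eq_zero_of_bitEval_root h1 h2 (Nat.xor_lt_two_pow ha hb)
    rw [bitEval_xor, hab, CharTwo.add_self_eq_zero]
  · intro z _
    obtain ⟨p, rfl⟩ := AdjoinRoot.mk_surjective z
    have hlt : (p % bitEval (X : (ZMod 2)[X]) (gfPoly (2 ^ r))).degree < r := by
      have := degree_mod_lt p h3.ne_zero
      rwa [degree_eq_natDegree h3.ne_zero, hdeg] at this
    obtain ⟨a, ha, hap⟩ := exists_bitEval_X hlt
    refine ⟨a, ha, ?_⟩
    rw [AdjoinRoot.root, ← map_bitEval, hap, AdjoinRoot.mk_eq_mk]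
    have := EuclideanDomain.mod_add_div p (bitEval (X : (ZMod 2)[X]) (gfPoly (2 ^ r)))
    refine ⟨-(p / bitEval (X : (ZMod 2)[X]) (gfPoly (2 ^ r))), ?_⟩
    linear_combination this

end BinaryField

/-! ### Fourier analysis on {0,1}^k: from small bias to small L₁ error. -/

section Fourier

variable {k : ℕ}

/-- The character of `{0,1}^k` given by a set of coordinates. -/
def boolChar (T x : Fin k → Bool) : ℝ :=
  ∏ j, if T j ∧ x j then -1 else 1

theorem boolChar_false (x : Fin k → Bool) : boolChar (fun _ => false) x = 1 := by
  simp [boolChar]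

theorem sum_boolChar_mul (x y : Fin k → Bool) :
    ∑ T, boolChar T x * boolChar T y = if x = y then 2 ^ k else 0 := by
  have h : ∀ T, boolChar T x * boolChar T y =
      ∏ j, (if T j ∧ x j then -1 else 1 : ℝ) * if T j ∧ y j then -1 else 1 := fun T => by
    rw [boolChar, boolChar, Finset.prod_mul_distrib]
  simp only [h]
  have h2 := Fintype.prod_sum (fun (j : Fin k) (b : Bool) =>
    (if b ∧ x j then -1 else 1 : ℝ) * if b ∧ y j then -1 else 1)
  rw [← h2]
  split_ifs with hxy
  · subst hxy
    have : ∀ j, ∑ b : Bool, ((if b ∧ x j then -1 else 1 : ℝ) * if b ∧ x j then -1 else 1) = 2 := by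
      intro j
      rw [Fintype.sum_bool]
      cases x j <;> norm_num
    rw [Finset.prod_congr rfl fun j _ => this j]
    simp
  · obtain ⟨j, hj⟩ := Function.ne_iff.1 hxy
    apply Finset.prod_eq_zero (Finset.mem_univ j)
    rw [Fintype.sum_bool]
    revert hj
    cases x j <;> cases y j <;> norm_num

theorem sum_boolChar (T : Fin k → Bool) (hT : T ≠ fun _ => false) : ∑ x, boolChar T x = 0 := by
  have h := sum_boolChar_mul T fun _ => false
  rw [if_neg hT] at h
  rw [← h]
  refine Finset.sum_congr rfl fun x _ => ?_
  simp [boolChar, and_comm]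

theorem parseval_bool (p : (Fin k → Bool) → ℝ) :
    ∑ T, (∑ x, p x * boolChar T x) ^ 2 = 2 ^ k * ∑ x, p x ^ 2 := by
  calc ∑ T, (∑ x, p x * boolChar T x) ^ 2
      = ∑ T, ∑ x, ∑ y, p x * p y * (boolChar T x * boolChar T y) := by
        refine Finset.sum_congr rfl fun T _ => ?_
        rw [sq, Finset.sum_mul_sum]
        exact Finset.sum_congr rfl fun x _ => Finset.sum_congr rfl fun y _ => by ring
    _ = ∑ x, ∑ y, p x * p y * ∑ T, boolChar T x * boolChar T y := by
        rw [Finset.sum_comm]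
        refine Finset.sum_congr rfl fun x _ => ?_
        rw [Finset.sum_comm]
        exact Finset.sum_congr rfl fun y _ => by rw [Finset.mul_sum]
    _ = _ := by
        simp only [sum_boolChar_mul, mul_ite, mul_zero, Finset.sum_ite_eq, Finset.mem_univ, if_true]
        rw [Finset.mul_sum]
        exact Finset.sum_congr rfl fun x _ => by ring

/-- Cauchy–Schwarz over the 2^k points loses a factor 2^k, which is exactly the factor in Parseval's
identity. -/
theorem sq_sum_abs_le (p : (Fin k → Bool) → ℝ) :
    (∑ x, |p x|) ^ 2 ≤ ∑ T, (∑ x, p x * boolChar T x) ^ 2 := by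
  rw [parseval_bool]
  refine sq_sum_le_card_mul_sum_sq.trans_eq ?_
  simp

/-- The number of indices `l < M` at which a sequence takes a given value. -/
def hitCount (M : ℕ) (v : ℕ → Fin k → Bool) (x : Fin k → Bool) : ℕ :=
  ((Finset.range M).filter fun l => v l = x).card

/-- The distance, in the `L_1`-norm, of the law of `v l`, with `l < M` uniform, to the uniform
distribution. -/
noncomputable def l1Error (M : ℕ) (v : ℕ → Fin k → Bool) : ℝ :=
  ∑ x, |(hitCount M v x : ℝ) / M - 1 / 2 ^ k|

theorem sum_hitCount_mul (M : ℕ) (v : ℕ → Fin k → Bool) (g : (Fin k → Bool) → ℝ) :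
    ∑ x, (hitCount M v x : ℝ) * g x = ∑ l ∈ Finset.range M, g (v l) := by
  simp only [hitCount, Finset.card_filter, Nat.cast_sum, Finset.sum_mul]
  rw [Finset.sum_comm]
  refine Finset.sum_congr rfl fun l _ => ?_
  simp

/-- The Fourier coefficients of the difference to the uniform law are the biases of the nontrivial
characters, at most η each; the trivial coefficient vanishes because both laws have total mass 1. -/
theorem l1Error_sq_le {M : ℕ} (hM : 0 < M) (v : ℕ → Fin k → Bool) {η : ℝ}
    (h : ∀ T ≠ fun _ => false, |∑ l ∈ Finset.range M, boolChar T (v l)| ≤ η * M) :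
    l1Error M v ^ 2 ≤ 2 ^ k * η ^ 2 := by
  have hM' : (0 : ℝ) < M := by exact_mod_cast hM
  refine (sq_sum_abs_le _).trans ?_
  have hT : ∀ T : Fin k → Bool,
      (∑ x, ((hitCount M v x : ℝ) / M - 1 / 2 ^ k) * boolChar T x) ^ 2 ≤ η ^ 2 := by
    intro T
    have h1 : ∑ x, ((hitCount M v x : ℝ) / M - 1 / 2 ^ k) * boolChar T x =
        (∑ l ∈ Finset.range M, boolChar T (v l)) / M - (∑ x, boolChar T x) / 2 ^ k := by
      rw [← sum_hitCount_mul, Finset.sum_div, Finset.sum_div, ← Finset.sum_sub_distrib]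
      exact Finset.sum_congr rfl fun x _ => by ring
    rw [h1]
    by_cases hT : T = fun _ => false
    · subst hT
      simp only [boolChar_false, Finset.sum_const, Finset.card_range, Finset.card_univ,
        Fintype.card_pi, Fintype.card_bool, Finset.prod_const, Fintype.card_fin, nsmul_eq_mul,
        mul_one, Nat.cast_pow, Nat.cast_ofNat]
      rw [div_self hM'.ne', div_self (by positivity), sub_self, sq, zero_mul]
      exact sq_nonneg η
    · rw [sum_boolChar T hT, zero_div, sub_zero]
      refine sq_le_sq.2 (le_trans ?_ (le_abs_self η))
      rw [abs_div, abs_of_pos hM', div_le_iff₀ hM']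
      exact h T hT
  refine (Finset.sum_le_card_nsmul _ _ _ fun T _ => hT T).trans_eq ?_
  simp

/-- The case η = 0 of the preceding bound: a law with no bias at all is uniform. -/
theorem hitCount_eq_of_sum_boolChar_eq_zero {M : ℕ} (hM : 0 < M) (v : ℕ → Fin k → Bool)
    (h : ∀ T ≠ fun _ => false, ∑ l ∈ Finset.range M, boolChar T (v l) = 0) (x : Fin k → Bool) :
    hitCount M v x * 2 ^ k = M := by
  have h1 := l1Error_sq_le hM v (η := 0) (fun T hT => by rw [h T hT]; simp)
  have h2 : l1Error M v = 0 := by nlinarith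
  rw [l1Error, Finset.sum_eq_zero_iff_of_nonneg fun _ _ => abs_nonneg _] at h2
  have h3 := abs_eq_zero.1 (h2 x (Finset.mem_univ x))
  have hM' : (M : ℝ) ≠ 0 := by exact_mod_cast hM.ne'
  rw [sub_eq_zero, div_eq_div_iff hM' (by positivity), one_mul] at h3
  exact_mod_cast h3

end Fourier

/-! ### Sums over mixed-radix indices and base-Q digits. -/

section RangeSums

theorem sum_range_mul_div_mod {R : Type*} [AddCommMonoid R] (N M : ℕ) (h : ℕ → ℕ → R) :
    ∑ s ∈ Finset.range (N * M), h (s / M) (s % M) =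
      ∑ i ∈ Finset.range N, ∑ j ∈ Finset.range M, h i j := by
  induction N with
  | zero => simp
  | succ N ih =>
    rw [Nat.succ_mul, Finset.sum_range_add, ih, Finset.sum_range_succ]
    congr 1
    refine Finset.sum_congr rfl fun j hj => ?_
    have hj := Finset.mem_range.1 hj
    rw [mul_comm, Nat.mul_add_div (by omega), Nat.mul_add_mod, Nat.div_eq_of_lt hj, add_zero,
      Nat.mod_eq_of_lt hj]

theorem mod_pow_div_pow_mod (u Q : ℕ) {i t : ℕ} (hi : i < t) :
    u % Q ^ t / Q ^ i % Q = u / Q ^ i % Q := by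
  obtain ⟨m, rfl⟩ := Nat.exists_eq_add_of_lt hi
  rw [show i + m + 1 = i + (m + 1) by ring, pow_add, Nat.mod_mul_right_div_self,
    Nat.mod_mod_of_dvd _ (dvd_pow_self Q (Nat.succ_ne_zero m))]

theorem sum_range_pow_prod_digits {R : Type*} [CommSemiring R] (Q t : ℕ) (g : ℕ → ℕ → R) :
    ∑ u ∈ Finset.range (Q ^ t), ∏ i ∈ Finset.range t, g i (u / Q ^ i % Q) =
      ∏ i ∈ Finset.range t, ∑ a ∈ Finset.range Q, g i a := by
  induction t with
  | zero => simp
  | succ t ih =>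
    rw [Finset.prod_range_succ, ← ih, mul_comm, Finset.sum_mul_sum,
      ← sum_range_mul_div_mod (N := Q) (M := Q ^ t)
        (h := fun a u => g t a * ∏ i ∈ Finset.range t, g i (u / Q ^ i % Q)), pow_succ']
    refine Finset.sum_congr rfl fun u hu => ?_
    have hu := Finset.mem_range.1 hu
    rw [Finset.prod_range_succ, mul_comm]
    congr 1
    · rw [Nat.mod_eq_of_lt (Nat.div_lt_of_lt_mul (by rwa [mul_comm]))]
    · exact Finset.prod_congr rfl fun i hi => by
        rw [mod_pow_div_pow_mod u Q (Finset.mem_range.1 hi)]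

theorem exists_digit_ne {Q t i i' : ℕ} (hi : i < Q ^ t) (hi' : i' < Q ^ t) (h : i ≠ i') :
    ∃ j < t, i / Q ^ j % Q ≠ i' / Q ^ j % Q := by
  by_contra! hcon
  have : ∀ s ≤ t, i % Q ^ s = i' % Q ^ s := by
    intro s hs
    induction s with
    | zero => simp [Nat.mod_one]
    | succ s ih => rw [Nat.mod_pow_succ, Nat.mod_pow_succ, ih (by omega), hcon s (by omega)]
  have := this t le_rfl
  rw [Nat.mod_eq_of_lt hi, Nat.mod_eq_of_lt hi'] at this
  exact h this

end RangeSums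

/-! ### Root counting, Vandermonde, and an additive character of the field. -/

section FieldCounting

open Polynomial

variable {F : Type} [Field F]

theorem card_filter_sum_pow_le (s : Finset F) [DecidableEq F] (t : ℕ) (c : ℕ → F)
    (hc : ∃ i < t, c i ≠ 0) :
    (s.filter fun x => ∑ i ∈ Finset.range t, c i * x ^ i = 0).card ≤ t := by
  obtain ⟨i, hi, hci⟩ := hc
  set p : F[X] := ∑ i ∈ Finset.range t, C (c i) * X ^ i with hp
  have hcoeff : p.coeff i = c i := by
    simp [hp, coeff_C_mul, coeff_X_pow, hi]
  have hp0 : p ≠ 0 := fun h => hci (by rw [← hcoeff, h, coeff_zero])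
  have hdeg : p.natDegree ≤ t := by
    refine natDegree_sum_le_of_forall_le _ _ fun j hj => (natDegree_C_mul_X_pow_le _ _).trans ?_
    exact (Finset.mem_range.1 hj).le
  calc _ ≤ p.roots.toFinset.card := by
        refine Finset.card_le_card fun x hx => ?_
        rw [Multiset.mem_toFinset, mem_roots hp0, IsRoot.def, hp, eval_finsetSum]
        simpa using (Finset.mem_filter.1 hx).2
    _ ≤ Multiset.card p.roots := Multiset.toFinset_card_le _
    _ ≤ t := (card_roots' p).trans hdeg

/-- Vandermonde: the indicator of a nonempty subset of k distinct points cannot be orthogonal to the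
first k powers. -/
theorem exists_sum_pow_ne_zero {k : ℕ} {T : Fin k → Bool} (hT : T ≠ fun _ => false)
    {z : Fin k → F} (hz : Function.Injective z) :
    ∃ i < k, ∑ j, (if T j then z j ^ i else 0) ≠ 0 := by
  by_contra! hcon
  have h := Matrix.eq_zero_of_forall_pow_sum_mul_pow_eq_zero
    (f := z) (v := fun j => if T j then (1 : F) else 0) hz (fun i =>
      (Finset.sum_congr rfl fun j _ => by rw [ite_mul, one_mul, zero_mul]).trans (hcon i i.2))
  apply hT
  funext j
  have := congrFun h j
  by_contra hj
  simp [Bool.eq_true_of_not_eq_false hj] at this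

/-- The parity of the code of a field element, as a sign. -/
noncomputable def codeSign (θ : F) (r : ℕ) (z : F) : ℝ :=
  (-1) ^ Function.invFunOn (bitEval θ) (Set.Iio (2 ^ r)) z

variable {θ : F} {r : ℕ}

theorem codeSign_bitEval (h : Set.BijOn (bitEval θ) (Set.Iio (2 ^ r)) Set.univ) {a : ℕ}
    (ha : a < 2 ^ r) : codeSign θ r (bitEval θ a) = (-1) ^ a := by
  rw [codeSign, h.injOn.leftInvOn_invFunOn ha]

theorem neg_one_pow_xor (a b : ℕ) : (-1 : ℝ) ^ (a ^^^ b) = (-1) ^ a * (-1) ^ b := by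
  rw [← pow_add, neg_one_pow_eq_pow_mod_two, Nat.xor_mod_two_eq, ← neg_one_pow_eq_pow_mod_two]

/-- Addition is exclusive or of codes, whose lowest bit is additive modulo 2. So the sign is an
additive character of the field. -/
theorem codeSign_add [CharP F 2] (h : Set.BijOn (bitEval θ) (Set.Iio (2 ^ r)) Set.univ) (z w : F) :
    codeSign θ r (z + w) = codeSign θ r z * codeSign θ r w := by
  obtain ⟨a, ha, rfl⟩ := h.surjOn (Set.mem_univ z)
  obtain ⟨b, hb, rfl⟩ := h.surjOn (Set.mem_univ w)
  rw [← bitEval_xor, codeSign_bitEval h (Nat.xor_lt_two_pow ha hb), codeSign_bitEval h ha,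
    codeSign_bitEval h hb, neg_one_pow_xor]

theorem codeSign_zero (h : Set.BijOn (bitEval θ) (Set.Iio (2 ^ r)) Set.univ) :
    codeSign θ r 0 = 1 := by
  rw [← bitEval_zero θ, codeSign_bitEval h (by positivity), pow_zero]

theorem codeSign_sum [CharP F 2] (h : Set.BijOn (bitEval θ) (Set.Iio (2 ^ r)) Set.univ) {ι : Type*}
    (s : Finset ι) (z : ι → F) :
    codeSign θ r (∑ j ∈ s, z j) = ∏ j ∈ s, codeSign θ r (z j) := by
  classical
  induction s using Finset.induction_on with
  | empty => simp [codeSign_zero h]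
  | insert j s hj ih => rw [Finset.sum_insert hj, Finset.prod_insert hj, codeSign_add h, ih]

theorem sum_range_bitEval [Fintype F] (h : Set.BijOn (bitEval θ) (Set.Iio (2 ^ r)) Set.univ)
    (g : F → ℝ) : ∑ a ∈ Finset.range (2 ^ r), g (bitEval θ a) = ∑ z, g z :=
  Finset.sum_nbij (bitEval θ) (by simp)
    (by simpa [Finset.coe_range] using h.injOn)
    (by simpa [Finset.coe_range] using h.surjOn) (fun _ _ => rfl)

theorem sum_codeSign_mul [CharP F 2] [Fintype F] [DecidableEq F] (hr : r ≠ 0)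
    (h : Set.BijOn (bitEval θ) (Set.Iio (2 ^ r)) Set.univ) (w : F) :
    ∑ z, codeSign θ r (z * w) = if w = 0 then 2 ^ r else 0 := by
  split_ifs with hw
  · subst hw
    rw [← sum_range_bitEval h]
    simp [codeSign_zero h]
  · have h1 : ∑ z, codeSign θ r (z * w) = ∑ z, codeSign θ r z :=
      Fintype.sum_equiv (Equiv.mulRight₀ w hw) _ _ (fun _ => rfl)
    -- The character is nontrivial, since 1 has code 1: translation by 1 permutes the summands and
    -- flips their signs, so the sum is 0.
    have h2 : ∑ z, codeSign θ r (z + 1) = ∑ z, codeSign θ r z :=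
      Fintype.sum_equiv (Equiv.addRight 1) _ _ (fun _ => rfl)
    have h3 : codeSign θ r 1 = -1 := by
      rw [← bitEval_one θ, codeSign_bitEval h (Nat.one_lt_two_pow hr), pow_one]
    simp only [codeSign_add h, h3, mul_neg, mul_one, Finset.sum_neg_distrib] at h2
    rw [h1]
    linarith

theorem boolChar_parity [CharP F 2] (h : Set.BijOn (bitEval θ) (Set.Iio (2 ^ r)) Set.univ) {k : ℕ}
    (T : Fin k → Bool) (a : Fin k → ℕ) (ha : ∀ j, a j < 2 ^ r) :
    boolChar T (fun j => decide (a j % 2 = 1)) =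
      codeSign θ r (∑ j, if T j then bitEval θ (a j) else 0) := by
  rw [codeSign_sum h, boolChar]
  refine Finset.prod_congr rfl fun j _ => ?_
  by_cases hT : T j
  · simp only [hT, true_and, if_true, decide_eq_true_eq]
    rw [codeSign_bitEval h (ha j), neg_one_pow_eq_pow_mod_two]
    rcases Nat.mod_two_eq_zero_or_one (a j) with h0 | h0 <;> simp [h0]
  · simp [hT, codeSign_zero h]

end FieldCounting

/-! ### The three polynomial families: k-wise independent, small-bias, and hashing. -/

section Families

variable {r k : ℕ} {z : Fin k → ℕ}

/-- Evaluations of the polynomials of degree less than `k` are `k`-wise independent. -/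
theorem hitCount_gfEval (hr : r ≠ 0) (hz : ∀ j, z j < 2 ^ r) (hinj : Function.Injective z)
    (x : Fin k → Bool) :
    hitCount ((2 ^ r) ^ k)
      (fun u j => decide (gfEval (gfPoly (2 ^ r)) (2 ^ r) u (z j) k % 2 = 1)) x * 2 ^ k =
      (2 ^ r) ^ k := by
  classical
  obtain ⟨F, _, _, θ, hroot, hbij⟩ := exists_field_model hr
  have : Finite F := Set.finite_univ_iff.1 (hbij.finite_iff_finite.1 (Set.finite_Iio _))
  have : Fintype F := Fintype.ofFinite F
  refine hitCount_eq_of_sum_boolChar_eq_zero (by positivity) _ (fun T hT => ?_) x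
  obtain ⟨i, hi, hne⟩ := exists_sum_pow_ne_zero hT (z := fun j => bitEval θ (z j))
    (fun j j' hj => hinj (hbij.injOn (hz j) (hz j') hj))
  -- The sum of the values at the points of `T` is linear in the coefficients of `u`, with the power
  -- sums as weights. The character therefore factors over the digits of `u`, and a digit with
  -- nonzero weight makes its factor sum to 0.
  calc _ = ∑ u ∈ Finset.range ((2 ^ r) ^ k), ∏ i ∈ Finset.range k,
        codeSign θ r (bitEval θ (u / (2 ^ r) ^ i % 2 ^ r) *
          ∑ j, if T j then bitEval θ (z j) ^ i else 0) := by
        refine Finset.sum_congr rfl fun u _ => ?_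
        rw [boolChar_parity hbij T _ (fun j => (gfEval_spec hroot hr u (z j) k).1),
          ← codeSign_sum hbij]
        congr 1
        simp only [Finset.mul_sum]
        rw [Finset.sum_comm]
        refine Finset.sum_congr rfl fun j _ => ?_
        split_ifs
        · exact (gfEval_spec hroot hr u (z j) k).2
        · simp
    _ = 0 := by
        rw [sum_range_pow_prod_digits (g := fun i a => codeSign θ r (bitEval θ a *
          ∑ j, if T j then bitEval θ (z j) ^ i else 0))]
        refine Finset.prod_eq_zero (Finset.mem_range.2 hi) ?_
        rw [sum_range_bitEval hbij (fun y => codeSign θ r (y *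
          ∑ j, if T j then bitEval θ (z j) ^ i else 0)), sum_codeSign_mul hr hbij, if_neg hne]

/-- The polynomials with geometric coefficients form an almost `k`-wise independent family. -/
theorem l1Error_gfGeom_sq_le (hr : r ≠ 0) (hz : ∀ j, z j < 2 ^ r) (hinj : Function.Injective z) :
    l1Error (2 ^ r * 2 ^ r) (fun s j => decide (gfGeom (gfPoly (2 ^ r)) (2 ^ r) (s % 2 ^ r)
      (gfMul (gfPoly (2 ^ r)) (2 ^ r) (z j) (s / 2 ^ r)) k % 2 = 1)) ^ 2 ≤
      2 ^ k * ((k : ℝ) / 2 ^ r) ^ 2 := by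
  classical
  obtain ⟨F, _, _, θ, hroot, hbij⟩ := exists_field_model hr
  have : Finite F := Set.finite_univ_iff.1 (hbij.finite_iff_finite.1 (Set.finite_Iio _))
  have : Fintype F := Fintype.ofFinite F
  refine l1Error_sq_le (by positivity) _ fun T hT => ?_
  have hc := exists_sum_pow_ne_zero hT (z := fun j => bitEval θ (z j))
    (fun j j' hj => hinj (hbij.injOn (hz j) (hz j') hj))
  have h1 := card_filter_sum_pow_le (Finset.univ : Finset F) k _ hc
  -- For fixed x the sum over y cancels unless x is a root of the polynomial whose coefficients are
  -- the power sums of `T`. By `h1` there are at most k such x, each contributing 2^r.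
  have h2 : ∑ s ∈ Finset.range (2 ^ r * 2 ^ r), boolChar T (fun j =>
      decide (gfGeom (gfPoly (2 ^ r)) (2 ^ r) (s % 2 ^ r)
        (gfMul (gfPoly (2 ^ r)) (2 ^ r) (z j) (s / 2 ^ r)) k % 2 = 1)) =
      2 ^ r * (Finset.univ.filter fun x : F => ∑ i ∈ Finset.range k,
        (∑ j, if T j then bitEval θ (z j) ^ i else 0) * x ^ i = 0).card := by
    rw [sum_range_mul_div_mod (2 ^ r) (2 ^ r) (fun x y => boolChar T (fun j =>
      decide (gfGeom (gfPoly (2 ^ r)) (2 ^ r) y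
        (gfMul (gfPoly (2 ^ r)) (2 ^ r) (z j) x) k % 2 = 1))), Finset.card_filter, Nat.cast_sum,
      Finset.mul_sum, ← sum_range_bitEval hbij]
    refine Finset.sum_congr rfl fun x _ => ?_
    have h3 : ∀ y ∈ Finset.range (2 ^ r), boolChar T (fun j =>
        decide (gfGeom (gfPoly (2 ^ r)) (2 ^ r) y
          (gfMul (gfPoly (2 ^ r)) (2 ^ r) (z j) x) k % 2 = 1)) =
        codeSign θ r (bitEval θ y * ∑ i ∈ Finset.range k,
          (∑ j, if T j then bitEval θ (z j) ^ i else 0) * bitEval θ x ^ i) := by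
      intro y hy
      have hy := Finset.mem_range.1 hy
      rw [boolChar_parity hbij T _ (fun j => (gfGeom_spec hroot hy _ k).1)]
      congr 1
      simp only [Finset.mul_sum, Finset.sum_mul]
      rw [Finset.sum_comm]
      refine Finset.sum_congr rfl fun j _ => ?_
      split_ifs
      · rw [(gfGeom_spec hroot hy _ k).2, (gfMul_spec hroot (hz j)).2, Finset.mul_sum]
        simp only [mul_pow]
      · simp
    rw [Finset.sum_congr rfl h3, sum_range_bitEval hbij (fun y => codeSign θ r (y *
      ∑ i ∈ Finset.range k, (∑ j, if T j then bitEval θ (z j) ^ i else 0) * bitEval θ x ^ i)),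
      sum_codeSign_mul hr hbij]
    split_ifs <;> simp
  rw [h2, abs_of_nonneg (by positivity)]
  push_cast
  rw [div_mul_eq_mul_div, mul_comm (2 ^ r : ℝ) (_ : ℝ), ← mul_assoc, mul_div_assoc,
    div_self (by positivity), mul_one]
  exact mul_le_mul_of_nonneg_right (by exact_mod_cast h1) (by positivity)

/-- Two numbers collide under few of the evaluations of their digit polynomials. -/
theorem card_gfEval_eq_le (hr : r ≠ 0) {N d i i' : ℕ} (hN : N ≤ 2 ^ r) (hi : i < (2 ^ r) ^ d)
    (hi' : i' < (2 ^ r) ^ d) (hne : i ≠ i') :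
    ((Finset.range N).filter fun h => gfEval (gfPoly (2 ^ r)) (2 ^ r) i h d =
      gfEval (gfPoly (2 ^ r)) (2 ^ r) i' h d).card ≤ d := by
  classical
  obtain ⟨F, _, _, θ, hroot, hbij⟩ := exists_field_model hr
  have : Finite F := Set.finite_univ_iff.1 (hbij.finite_iff_finite.1 (Set.finite_Iio _))
  have : Fintype F := Fintype.ofFinite F
  obtain ⟨j, hj, hjne⟩ := exists_digit_ne hi hi' hne
  -- A collision at `h` is a root of the difference of the two digit polynomials, which is nonzero
  -- because the numbers differ in some digit.
  have h1 := card_filter_sum_pow_le (Finset.univ : Finset F) d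
    (fun j => bitEval θ (i / (2 ^ r) ^ j % 2 ^ r) - bitEval θ (i' / (2 ^ r) ^ j % 2 ^ r))
    ⟨j, hj, fun h => hjne (hbij.injOn (Nat.mod_lt _ (by positivity))
      (Nat.mod_lt _ (by positivity)) (sub_eq_zero.1 h))⟩
  refine le_trans (Finset.card_le_card_of_injOn (bitEval θ) (fun h hh => ?_) ?_) h1
  · simp only [Finset.coe_filter, Finset.mem_range, Set.mem_ofPred_eq, Finset.mem_univ,
      true_and] at hh ⊢
    simp only [sub_mul, Finset.sum_sub_distrib]
    rw [← (gfEval_spec hroot hr i h d).2, ← (gfEval_spec hroot hr i' h d).2, hh.2, sub_self]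
  · intro a ha b hb hab
    simp only [Finset.coe_filter, Finset.mem_range, Set.mem_ofPred_eq] at ha hb
    exact hbij.injOn (Set.mem_Iio.2 (by omega)) (Set.mem_Iio.2 (by omega)) hab

end Families

/-! ### The potential function of the greedy construction. -/

section Potential

variable {k : ℕ}

/-- The potential of a sequence of `i` patterns with hit counts `c`; it is small only if the
pattern frequencies are close to uniform. -/
noncomputable def potential (lam : ℝ) (i : ℕ) (c : (Fin k → Bool) → ℕ) : ℝ :=
  ∏ x, (1 + (1 + lam) ^ c x / (1 + lam / 2 ^ k) ^ i)

theorem potential_nonneg {lam : ℝ} (hl : 0 < lam) (i : ℕ) (c : (Fin k → Bool) → ℕ) :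
    0 ≤ potential lam i c :=
  Finset.prod_nonneg fun _ _ => by positivity

theorem one_add_sum_le_prod {ι : Type*} (s : Finset ι) (a : ι → ℝ) (ha : ∀ i, 0 ≤ a i) :
    1 + ∑ i ∈ s, a i ≤ ∏ i ∈ s, (1 + a i) := by
  classical
  induction s using Finset.induction_on with
  | empty => simp
  | insert j s hj ih =>
    rw [Finset.sum_insert hj, Finset.prod_insert hj]
    have h1 : 0 ≤ ∑ i ∈ s, a i := Finset.sum_nonneg fun i _ => ha i
    nlinarith [ha j]

/-- Raising the count of one pattern changes a single factor, so the mean over uniform patterns is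
∏(1+z_x) times 1 plus a sum; that is at most a product over x, which recombines to the old
potential. -/
theorem sum_potential_le {lam : ℝ} (hl : 0 < lam) (i B : ℕ) (c : (Fin k → Bool) → ℕ)
    (v : ℕ → Fin k → Bool) (hv : ∀ x, hitCount B v x * 2 ^ k = B) :
    ∑ u ∈ Finset.range B, potential lam (i + 1) (fun x => c x + if v u = x then 1 else 0) ≤
      B * potential lam i c := by
  set w : (Fin k → Bool) → ℝ := fun x => (1 + lam) ^ c x / (1 + lam / 2 ^ k) ^ i with hw
  set z : (Fin k → Bool) → ℝ := fun x => w x / (1 + lam / 2 ^ k) with hz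
  have hw0 : ∀ x, 0 < w x := fun x => by positivity
  have hz0 : ∀ x, 0 < z x := fun x => by positivity
  -- Here `z` is `w` renormalised for one more step, and the factor of the pattern hit grows by
  -- (1+(1+λ)z)/(1+z) = 1 + λz/(1+z).
  have h1 : ∀ u, potential lam (i + 1) (fun x => c x + if v u = x then 1 else 0) =
      (∏ x, (1 + z x)) * (1 + lam * (z (v u) / (1 + z (v u)))) := by
    intro u
    have h2 : ∏ x, (if v u = x then 1 + lam * (z x / (1 + z x)) else 1) =
        1 + lam * (z (v u) / (1 + z (v u))) := by
      simp
    rw [← h2, ← Finset.prod_mul_distrib]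
    refine Finset.prod_congr rfl fun x _ => ?_
    have hx := hz0 x
    have h3 : (1 + lam) ^ c x / (1 + lam / 2 ^ k) ^ (i + 1) = z x := by
      simp only [hz, hw, pow_succ, div_div]
    dsimp only
    split_ifs
    · rw [pow_succ (1 + lam) (c x), mul_div_right_comm, h3]
      field_simp
      ring
    · rw [add_zero, h3, mul_one]
  have h4 : ∑ u ∈ Finset.range B, (1 + lam * (z (v u) / (1 + z (v u)))) =
      B * (1 + ∑ x, lam / 2 ^ k * (z x / (1 + z x))) := by
    rw [Finset.sum_add_distrib, ← Finset.mul_sum, ← sum_hitCount_mul B v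
      (fun x => z x / (1 + z x)), mul_add, Finset.mul_sum, Finset.mul_sum]
    congr 1
    · simp
    · refine Finset.sum_congr rfl fun x _ => ?_
      have : (hitCount B v x : ℝ) * 2 ^ k = B := by exact_mod_cast hv x
      rw [← this]
      field_simp
  have h5 : ∀ x, (1 + z x) * (1 + lam / 2 ^ k * (z x / (1 + z x))) = 1 + w x := by
    intro x
    have hx := hz0 x
    have : w x = z x * (1 + lam / 2 ^ k) := by
      rw [hz]
      field_simp
    rw [this]
    field_simp
    ring
  simp only [h1]
  rw [← Finset.mul_sum, h4, mul_left_comm]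
  refine mul_le_mul_of_nonneg_left ?_ (Nat.cast_nonneg B)
  calc _ ≤ (∏ x, (1 + z x)) * ∏ x, (1 + lam / 2 ^ k * (z x / (1 + z x))) := by
        refine mul_le_mul_of_nonneg_left (one_add_sum_le_prod _ _ fun x => ?_)
          (Finset.prod_nonneg fun x _ => ?_)
        · have := hz0 x
          positivity
        · have := hz0 x
          positivity
    _ = _ := by
        rw [← Finset.prod_mul_distrib]
        exact Finset.prod_congr rfl fun x _ => h5 x

/-- Expanding the product, the term of the set `P` of overrepresented patterns is at most the
potential. Its logarithm compares the frequency of `P` with |P|/2^k, and the L₁ error is twice that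
excess. -/
theorem sum_abs_le_of_potential_le {lam M : ℝ} (hl : 0 < lam) {m : ℕ} (hm : 0 < m)
    {c : (Fin k → Bool) → ℕ} (hc : ∑ x, c x = m) (h : potential lam m c ≤ Real.exp M) :
    ∑ x, |(c x : ℝ) / m - 1 / 2 ^ k| ≤ 2 * (M / (lam * m) + lam) := by
  have hm' : (0 : ℝ) < m := by exact_mod_cast hm
  have hc' : ∑ x, (c x : ℝ) = m := by exact_mod_cast hc
  have hcard : (Finset.univ : Finset (Fin k → Bool)).card = 2 ^ k := by simp
  set P := Finset.univ.filter fun x => 0 ≤ (c x : ℝ) / m - 1 / 2 ^ k with hP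
  have hsum : ∑ x, ((c x : ℝ) / m - 1 / 2 ^ k) = 0 := by
    rw [Finset.sum_sub_distrib, ← Finset.sum_div, hc', div_self hm'.ne', Finset.sum_const, hcard]
    simp
  -- The deviations sum to 0, so positive and negative parts have equal mass.
  have habs : ∑ x, |(c x : ℝ) / m - 1 / 2 ^ k| = 2 * ∑ x ∈ P, ((c x : ℝ) / m - 1 / 2 ^ k) := by
    have : ∀ x, |(c x : ℝ) / m - 1 / 2 ^ k| =
        2 * (if 0 ≤ (c x : ℝ) / m - 1 / 2 ^ k then (c x : ℝ) / m - 1 / 2 ^ k else 0) -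
          ((c x : ℝ) / m - 1 / 2 ^ k) := by
      intro x
      split_ifs with h0
      · rw [abs_of_nonneg h0]
        ring
      · rw [abs_of_neg (not_le.1 h0)]
        ring
    simp only [this]
    rw [Finset.sum_sub_distrib, hsum, sub_zero, ← Finset.mul_sum, hP, Finset.sum_filter]
  have hprod : ∏ x ∈ P, (1 + lam) ^ c x / (1 + lam / 2 ^ k) ^ m ≤ Real.exp M := by
    refine le_trans ?_ h
    rw [hP, Finset.prod_filter]
    refine Finset.prod_le_prod (fun x _ => by split_ifs <;> positivity) fun x _ => ?_
    have : 0 < (1 + lam) ^ c x / (1 + lam / 2 ^ k) ^ m := by positivity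
    split_ifs <;> linarith
  have hlog := Real.log_le_log (Finset.prod_pos fun x _ => by positivity) hprod
  rw [Real.log_exp, Real.log_prod (fun x _ => by positivity)] at hlog
  have hterm : ∀ x, (c x : ℝ) * (lam / (1 + lam)) - m * (lam / 2 ^ k) ≤
      Real.log ((1 + lam) ^ c x / (1 + lam / 2 ^ k) ^ m) := by
    intro x
    rw [Real.log_div (by positivity) (by positivity), Real.log_pow, Real.log_pow]
    refine sub_le_sub (mul_le_mul_of_nonneg_left ?_ (Nat.cast_nonneg _))
      (mul_le_mul_of_nonneg_left ?_ (Nat.cast_nonneg _))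
    · have := Real.one_sub_inv_le_log_of_pos (x := 1 + lam) (by positivity)
      refine le_trans (le_of_eq ?_) this
      field_simp
      ring
    · have := Real.log_le_sub_one_of_pos (x := 1 + lam / 2 ^ k) (by positivity)
      linarith
  have h1 := (Finset.sum_le_sum fun x (_ : x ∈ P) => hterm x).trans hlog
  set s : ℝ := ∑ x ∈ P, (c x : ℝ) with hs
  have hs_le : s ≤ m := by
    rw [← hc']
    exact Finset.sum_le_sum_of_subset_of_nonneg (Finset.subset_univ _)
      fun _ _ _ => Nat.cast_nonneg _
  rw [Finset.sum_sub_distrib, ← Finset.sum_mul, ← hs, Finset.sum_const, nsmul_eq_mul] at h1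
  rw [habs, Finset.sum_sub_distrib, ← Finset.sum_div, ← hs, Finset.sum_const, nsmul_eq_mul]
  refine mul_le_mul_of_nonneg_left ?_ zero_le_two
  have hs0 : 0 ≤ s := Finset.sum_nonneg fun _ _ => Nat.cast_nonneg _
  -- The second-order loss, at most λ² per hit and hence `m * lam ^ 2` in all, is the source of the
  -- additive `lam` in the conclusion.
  have h2 : s * (lam / (1 + lam)) ≥ s * lam - m * lam ^ 2 := by
    have h3 : lam / (1 + lam) ≥ lam - lam ^ 2 := by
      rw [ge_iff_le, le_div_iff₀ (by positivity)]
      nlinarith [pow_pos hl 3]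
    nlinarith [mul_le_mul_of_nonneg_left h3 hs0, sq_nonneg lam]
  have h4 : s / m - P.card * (1 / 2 ^ k) =
      (s * lam - P.card * (m * (lam / 2 ^ k))) / (lam * m) := by
    field_simp
  rw [h4, div_le_iff₀ (by positivity)]
  have h5 : (M / (lam * m) + lam) * (lam * m) = M + m * lam ^ 2 := by
    field_simp
  rw [h5]
  linarith

end Potential

/-! ### The greedy algorithm in exact integer arithmetic. -/

section Greedy

/-- The evaluation of the polynomial `u` on the tuple `A` has the bit pattern `x`. -/
def HasPattern (f Q k u A x : ℕ) : Prop :=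
  ∀ j < k, gfEval f Q u (A / Q ^ j % Q) k % 2 = x / 2 ^ j % 2

/-- The digits of `A` in base `Q` are distinct. -/
def DistinctDigits (Q k A : ℕ) : Prop :=
  ∀ i < k, ∀ j < k, i ≠ j → A / Q ^ i % Q ≠ A / Q ^ j % Q

open Classical in
/-- The number of the first `i` polynomials of a list with a given pattern. -/
noncomputable def patternCount (f Q k : ℕ) (l : List ℕ) (i A x : ℕ) : ℕ :=
  ((Finset.range i).filter fun s => HasPattern f Q k (l.getD s 0) A x).card

open Classical in
/-- The sum of the potentials of all tuples of distinct field elements, with denominators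
cleared; `K = 2 ^ k`, `B = Q ^ k`, and `1 / e` is the parameter of the potential. -/
noncomputable def totalPotential (f Q k K B e : ℕ) (l : List ℕ) (i : ℕ) : ℕ :=
  ∑ A ∈ Finset.range B, if DistinctDigits Q k A then
    ∏ x ∈ Finset.range K, ((e * (e * K + 1)) ^ i + (e + 1) ^ patternCount f Q k l i A x *
      e ^ (i - patternCount f Q k l i A x) * (e * K) ^ i) else 0

/-- A list of polynomials, of which each keeps the potential from growing. -/
noncomputable def greedyList (f Q k K B e : ℕ) : ℕ → List ℕ
  | 0 => []
  | i + 1 => boundedFind (fun u => totalPotential f Q k K B e (u :: greedyList f Q k K B e i)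
      (i + 1) ≤ totalPotential f Q k K B e (greedyList f Q k K B e i) i *
        (e * (e * K + 1)) ^ K) B :: greedyList f Q k K B e i

variable {α : Type} [Coded α] {f Q k K B e u A x i : α → ℕ} {l : α → List ℕ}

theorem PolyDec.hasPattern (hf : PolyTime f) (hQ : PolyTime Q) (hk : PolyTime k) (hu : PolyTime u)
    (hA : PolyTime A) (hx : PolyTime x) :
    PolyDec (fun a => HasPattern (f a) (Q a) (k a) (u a) (A a) (x a)) :=
  .ball (p := fun a j => gfEval (f a) (Q a) (u a) (A a / Q a ^ j % Q a) (k a) % 2 =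
    x a / 2 ^ j % 2) (.eq (by fun_prop) (by fun_prop)) hk

theorem PolyDec.distinctDigits (hQ : PolyTime Q) (hk : PolyTime k) (hA : PolyTime A) :
    PolyDec (fun a => DistinctDigits (Q a) (k a) (A a)) :=
  .ball (p := fun a i => ∀ j < k a, i ≠ j → A a / Q a ^ i % Q a ≠ A a / Q a ^ j % Q a)
    (.ball (p := fun (a : α × ℕ) j => a.2 ≠ j →
      A a.1 / Q a.1 ^ a.2 % Q a.1 ≠ A a.1 / Q a.1 ^ j % Q a.1)
      (.imp (.ne (by fun_prop) (by fun_prop)) (.ne (by fun_prop) (by fun_prop))) (by fun_prop)) hk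

open Classical in
@[fun_prop]
theorem PolyTime.patternCount (hf : PolyTime f) (hQ : PolyTime Q) (hk : PolyTime k)
    (hl : PolyTime l) (hi : PolyTime i) (hA : PolyTime A) (hx : PolyTime x) :
    PolyTime (fun a => patternCount (f a) (Q a) (k a) (l a) (i a) (A a) (x a)) :=
  .count (p := fun a s => HasPattern (f a) (Q a) (k a) ((l a).getD s 0) (A a) (x a))
    (.hasPattern (by fun_prop) (by fun_prop) (by fun_prop) (by fun_prop) (by fun_prop)
      (by fun_prop)) hi

open Classical in
theorem PolyTimeBig.ite {p : α → Prop} {f g : α → ℕ} (hp : PolyDec p)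
    (hf : PolyTimeBig f) (hg : PolyTimeBig g) :
    PolyTimeBig (fun a => if p a then f a else g a) := by
  have h : PolyTime (fun a => if p a then BigNat.mk (f a) else BigNat.mk (g a)) :=
    PolyTime.ite hp hf hg
  rw [PolyTimeBig]
  convert h using 2
  split_ifs <;> rfl

/-- The value is exponential, as the exponents multiply up to about `i * K`, but its bit length is
polynomial. -/
theorem PolyTimeBig.totalPotential (hf : PolyTime f) (hQ : PolyTime Q) (hk : PolyTime k)
    (hK : PolyTime K) (hB : PolyTime B) (he : PolyTime e) (hl : PolyTime l) (hi : PolyTime i) :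
    PolyTimeBig
      (fun a => totalPotential (f a) (Q a) (k a) (K a) (B a) (e a) (l a) (i a)) := by
  classical
  refine .sum (f := fun a A => if DistinctDigits (Q a) (k a) A then
    ∏ x ∈ Finset.range (K a), ((e a * (e a * K a + 1)) ^ i a +
      (e a + 1) ^ patternCount (f a) (Q a) (k a) (l a) (i a) A x *
      e a ^ (i a - patternCount (f a) (Q a) (k a) (l a) (i a) A x) * (e a * K a) ^ i a) else 0)
    (.ite (.distinctDigits (by fun_prop) (by fun_prop) (by fun_prop)) ?_ (PolyTime.const 0).big) hB
  refine .prod (f := fun (a : α × ℕ) x => ((e a.1 * (e a.1 * K a.1 + 1)) ^ i a.1 +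
      (e a.1 + 1) ^ patternCount (f a.1) (Q a.1) (k a.1) (l a.1) (i a.1) a.2 x *
      e a.1 ^ (i a.1 - patternCount (f a.1) (Q a.1) (k a.1) (l a.1) (i a.1) a.2 x) *
        (e a.1 * K a.1) ^ i a.1)) ?_ (by fun_prop)
  exact .add (.pow (PolyTime.big (by fun_prop)) (by fun_prop))
    (.mul (.mul (.pow (PolyTime.big (by fun_prop)) (by fun_prop))
      (.pow (PolyTime.big (by fun_prop)) (by fun_prop)))
      (.pow (PolyTime.big (by fun_prop)) (by fun_prop)))

/-- A search that fails returns `B`, so the list stays small for arbitrary parameters. -/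
theorem meas_greedyList_le (f Q k K B e i : ℕ) :
    meas (greedyList f Q k K B e i) ≤ 1 + i * (B + 2) := by
  induction i with
  | zero => simp [greedyList, meas_list]
  | succ i ih =>
    rw [greedyList, meas_cons, meas_nat]
    have := boundedFind_le (fun u => totalPotential f Q k K B e (u :: greedyList f Q k K B e i)
      (i + 1) ≤ totalPotential f Q k K B e (greedyList f Q k K B e i) i *
        (e * (e * K + 1)) ^ K) B
    rw [add_mul]
    omega

@[fun_prop]
theorem PolyTime.greedyList (hf : PolyTime f) (hQ : PolyTime Q) (hk : PolyTime k)
    (hK : PolyTime K) (hB : PolyTime B) (he : PolyTime e) (hi : PolyTime i) :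
    PolyTime (fun a => greedyList (f a) (Q a) (k a) (K a) (B a) (e a) (i a)) := by
  refine .natRec (F := fun a i l => _root_.boundedFind (fun u =>
    totalPotential (f a) (Q a) (k a) (K a) (B a) (e a) (u :: l) (i + 1) ≤
      totalPotential (f a) (Q a) (k a) (K a) (B a) (e a) l i *
        (e a * (e a * K a + 1)) ^ K a) (B a) :: l) (init := fun _ => [])
    (R := fun a i => _root_.greedyList (f a) (Q a) (k a) (K a) (B a) (e a) i)
    (B := fun a => 1 + meas (i a) * (meas (B a) + 1)) ?_ (by fun_prop) hi (fun _ => rfl)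
    (fun _ _ => rfl) ?_ fun a j hj => ?_
  · refine .cons (.boundedFind (p := fun (a : α × ℕ × List ℕ) u =>
      totalPotential (f a.1) (Q a.1) (k a.1) (K a.1) (B a.1) (e a.1) (u :: a.2.2) (a.2.1 + 1) ≤
        totalPotential (f a.1) (Q a.1) (k a.1) (K a.1) (B a.1) (e a.1) a.2.2 a.2.1 *
          (e a.1 * (e a.1 * K a.1 + 1)) ^ K a.1) ?_ (by fun_prop)) (by fun_prop)
    refine .le_big (.totalPotential ?_ ?_ ?_ ?_ ?_ ?_ ?_ ?_) (.mul (.totalPotential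
      ?_ ?_ ?_ ?_ ?_ ?_ ?_ ?_) (.pow (PolyTime.big ?_) ?_))
    all_goals fun_prop
  · exact (PolyBounded.const 1).add (hi.bound.mul (hB.bound.add (PolyBounded.const 1)))
  · refine (meas_greedyList_le _ _ _ _ _ _ _).trans ?_
    simp only [meas_nat]
    gcongr; omega

end Greedy

/-! ### Correctness of the greedy algorithm. -/

section GreedyBound

variable {r k : ℕ}

/-- The bits of a number, as a pattern. -/
def bitPattern (k x : ℕ) : Fin k → Bool :=
  fun j => decide (x / 2 ^ (j : ℕ) % 2 = 1)

theorem prod_bitPattern (g : (Fin k → Bool) → ℝ) :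
    ∏ x ∈ Finset.range (2 ^ k), g (bitPattern k x) = ∏ x, g x := by
  have hinj : Set.InjOn (bitPattern k) (Finset.range (2 ^ k)) := by
    intro x hx y hy hxy
    by_contra hne
    obtain ⟨j, hj, hjne⟩ := exists_digit_ne (Q := 2) (Finset.mem_range.1 hx)
      (Finset.mem_range.1 hy) hne
    have := congrFun hxy ⟨j, hj⟩
    simp only [bitPattern, decide_eq_decide] at this
    omega
  refine Finset.prod_nbij (bitPattern k) (by simp) hinj ?_ fun _ _ => rfl
  exact Finset.surjOn_of_injOn_of_card_le _ (by simp [Set.MapsTo]) hinj (by simp)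

/-- The patterns of a list of polynomials on a tuple. -/
def listPattern (f Q : ℕ) (l : List ℕ) (z : Fin k → ℕ) (s : ℕ) : Fin k → Bool :=
  fun j => decide (gfEval f Q (l.getD s 0) (z j) k % 2 = 1)

theorem patternCount_eq (f Q : ℕ) (l : List ℕ) (i A x : ℕ) :
    patternCount f Q k l i A x =
      hitCount i (listPattern f Q l fun j : Fin k => A / Q ^ (j : ℕ) % Q) (bitPattern k x) := by
  classical
  rw [patternCount, hitCount]
  congr 1
  refine Finset.filter_congr fun s _ => ?_
  rw [funext_iff, HasPattern, Fin.forall_iff]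
  refine forall₂_congr fun j hj => ?_
  simp only [listPattern, bitPattern, decide_eq_decide]
  omega

theorem hitCount_cons (f Q u : ℕ) (l : List ℕ) (i : ℕ) (z : Fin k → ℕ) (x : Fin k → Bool) :
    hitCount (i + 1) (listPattern f Q (u :: l) z) x = hitCount i (listPattern f Q l z) x +
      if (fun j => decide (gfEval f Q u (z j) k % 2 = 1)) = x then 1 else 0 := by
  simp only [hitCount, Finset.card_filter]
  rw [Finset.sum_range_succ']
  rfl

theorem hitCount_le (M : ℕ) (v : ℕ → Fin k → Bool) (x : Fin k → Bool) : hitCount M v x ≤ M :=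
  (Finset.card_filter_le _ _).trans (Finset.card_range M).le

/-- For λ = 1/e one has 1+λ = (e+1)/e and 1+λ/2^k = (e·2^k+1)/(e·2^k). Each of the 2^k factors is
cleared by (e(e·2^k+1))^i, which explains the integer form of `totalPotential`. -/
theorem prod_eq_potential {e : ℕ} (he : 0 < e) (f Q : ℕ) (l : List ℕ) (i A : ℕ) :
    ((∏ x ∈ Finset.range (2 ^ k), ((e * (e * 2 ^ k + 1)) ^ i + (e + 1) ^ patternCount f Q k l i A x *
      e ^ (i - patternCount f Q k l i A x) * (e * 2 ^ k) ^ i) : ℕ) : ℝ) =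
    ((e * (e * 2 ^ k + 1) : ℕ) : ℝ) ^ (i * 2 ^ k) * potential (1 / e : ℝ) i
      (hitCount i (listPattern f Q l fun j : Fin k => A / Q ^ (j : ℕ) % Q)) := by
  have he' : (0 : ℝ) < e := by exact_mod_cast he
  rw [potential, ← prod_bitPattern, pow_mul, Nat.cast_prod]
  have hconst : ∀ y : ℝ, y ^ 2 ^ k = ∏ _x ∈ Finset.range (2 ^ k), y := fun y => by simp
  rw [hconst, ← Finset.prod_mul_distrib]
  refine Finset.prod_congr rfl fun x _ => ?_
  rw [patternCount_eq]
  have hc := hitCount_le i (listPattern f Q l fun j : Fin k => A / Q ^ (j : ℕ) % Q) (bitPattern k x)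
  generalize hitCount i (listPattern f Q l fun j : Fin k => A / Q ^ (j : ℕ) % Q)
    (bitPattern k x) = c at hc ⊢
  obtain ⟨m, rfl⟩ := Nat.exists_eq_add_of_le hc
  rw [Nat.add_sub_cancel_left, show (1 : ℝ) + 1 / e = (e + 1) / e by field_simp,
    show (1 : ℝ) + 1 / e / 2 ^ k = (e * 2 ^ k + 1) / (e * 2 ^ k) by field_simp]
  push_cast
  rw [div_pow, div_pow]
  field_simp
  rw [mul_pow (e : ℝ) (e * 2 ^ k + 1), pow_add (e : ℝ) c m]
  generalize ((e : ℝ) * 2 ^ k + 1) ^ (c + m) = X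
  generalize ((e : ℝ) * 2 ^ k) ^ (c + m) = Y
  ring

open Classical in
theorem totalPotential_eq {e : ℕ} (he : 0 < e) (f Q B : ℕ) (l : List ℕ) (i : ℕ) :
    (totalPotential f Q k (2 ^ k) B e l i : ℝ) = ((e * (e * 2 ^ k + 1) : ℕ) : ℝ) ^ (i * 2 ^ k) *
      ∑ A ∈ Finset.range B, if DistinctDigits Q k A then potential (1 / e : ℝ) i
        (hitCount i (listPattern f Q l fun j : Fin k => A / Q ^ (j : ℕ) % Q)) else 0 := by
  rw [totalPotential, Nat.cast_sum, Finset.mul_sum]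
  refine Finset.sum_congr rfl fun A _ => ?_
  split_ifs
  · exact prod_eq_potential he f Q l i A
  · simp

theorem DistinctDigits.injective {Q A : ℕ} (h : DistinctDigits Q k A) :
    Function.Injective fun j : Fin k => A / Q ^ (j : ℕ) % Q := by
  intro i j hij
  by_contra hne
  exact h i i.2 j j.2 (fun h => hne (Fin.ext h)) hij

/-- Averaging: for every tuple of distinct elements the mean of the potential over all `u` does not
grow, hence neither does the mean of the total. The extra factor accounts for the larger common
denominator. -/
theorem exists_totalPotential_le (hr : r ≠ 0) {e : ℕ} (he : 0 < e) (l : List ℕ) (i : ℕ) :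
    ∃ u < (2 ^ r) ^ k,
      totalPotential (gfPoly (2 ^ r)) (2 ^ r) k (2 ^ k) ((2 ^ r) ^ k) e (u :: l) (i + 1) ≤
        totalPotential (gfPoly (2 ^ r)) (2 ^ r) k (2 ^ k) ((2 ^ r) ^ k) e l i *
          (e * (e * 2 ^ k + 1)) ^ 2 ^ k := by
  classical
  have he' : (0 : ℝ) < e := by exact_mod_cast he
  set f := gfPoly (2 ^ r) with hf
  set Q := 2 ^ r with hQ
  set B := Q ^ k with hB
  have hBpos : 0 < B := by positivity
  by_contra! hcon
  have h1 : ∀ u ∈ Finset.range B,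
      (totalPotential f Q k (2 ^ k) B e l i * (e * (e * 2 ^ k + 1)) ^ 2 ^ k : ℝ) <
        totalPotential f Q k (2 ^ k) B e (u :: l) (i + 1) :=
    fun u hu => by exact_mod_cast hcon u (Finset.mem_range.1 hu)
  have h2 := Finset.sum_lt_sum_of_nonempty (Finset.nonempty_range_iff.2 hBpos.ne') h1
  rw [Finset.sum_const, Finset.card_range, nsmul_eq_mul] at h2
  simp only [totalPotential_eq he] at h2
  rw [← Finset.mul_sum, Finset.sum_comm] at h2
  have hpos : (0 : ℝ) < ((e * (e * 2 ^ k + 1) : ℕ) : ℝ) := by positivity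
  have h3 : ∑ A ∈ Finset.range B, ∑ u ∈ Finset.range B, (if DistinctDigits Q k A then
      potential (1 / e : ℝ) (i + 1) (hitCount (i + 1)
        (listPattern f Q (u :: l) fun j : Fin k => A / Q ^ (j : ℕ) % Q)) else 0) ≤
      B * ∑ A ∈ Finset.range B, if DistinctDigits Q k A then potential (1 / e : ℝ) i
        (hitCount i (listPattern f Q l fun j : Fin k => A / Q ^ (j : ℕ) % Q)) else 0 := by
    rw [Finset.mul_sum]
    refine Finset.sum_le_sum fun A _ => ?_
    split_ifs with hA
    · have := sum_potential_le (lam := 1 / e) (by positivity) i B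
        (hitCount i (listPattern f Q l fun j : Fin k => A / Q ^ (j : ℕ) % Q))
        (fun u j => decide (gfEval f Q u (A / Q ^ (j : ℕ) % Q) k % 2 = 1))
        (hitCount_gfEval hr (fun j => Nat.mod_lt _ (by positivity)) hA.injective)
      refine le_trans (le_of_eq ?_) this
      refine Finset.sum_congr rfl fun u _ => ?_
      congr 1
      funext x
      exact hitCount_cons f Q u l i _ x
    · simp
  have h4 := mul_le_mul_of_nonneg_left h3 (pow_pos hpos ((i + 1) * 2 ^ k)).le
  have h5 : ((e * (e * 2 ^ k + 1) : ℕ) : ℝ) = (e * (e * 2 ^ k + 1) : ℝ) := by push_cast; ring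
  rw [add_mul, one_mul, pow_add] at h4 h2
  rw [h5] at h2 h4
  linarith

theorem totalPotential_greedyList_le (hr : r ≠ 0) {e : ℕ} (he : 0 < e) (i : ℕ) :
    totalPotential (gfPoly (2 ^ r)) (2 ^ r) k (2 ^ k) ((2 ^ r) ^ k) e
      (greedyList (gfPoly (2 ^ r)) (2 ^ r) k (2 ^ k) ((2 ^ r) ^ k) e i) i ≤
      (2 ^ r) ^ k * 2 ^ 2 ^ k * (e * (e * 2 ^ k + 1)) ^ (i * 2 ^ k) := by
  induction i with
  | zero =>
    rw [totalPotential, zero_mul, pow_zero, mul_one]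
    -- At the start each of the 2^k factors is 1 + 1, and there are at most Q^k tuples.
    refine (Finset.sum_le_card_nsmul _ _ (2 ^ 2 ^ k) fun A _ => ?_).trans_eq (by simp)
    split_ifs
    · simp [patternCount]
    · positivity
  | succ i ih =>
    rw [greedyList]
    refine (boundedFind_spec (exists_totalPotential_le hr he _ i)).2.trans ?_
    rw [add_mul, one_mul, pow_add, ← mul_assoc]
    exact Nat.mul_le_mul_right _ ih

/-- The list of polynomials found by the algorithm is almost `k`-wise independent. -/
theorem l1Error_greedyList_le (hr : r ≠ 0) {e m : ℕ} (he : 0 < e) (hm : 0 < m) {M : ℝ}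
    (hM : ((2 ^ r) ^ k * 2 ^ 2 ^ k : ℝ) ≤ Real.exp M) {z : Fin k → ℕ} (hz : ∀ j, z j < 2 ^ r)
    (hinj : Function.Injective z) :
    l1Error m (listPattern (gfPoly (2 ^ r)) (2 ^ r)
      (greedyList (gfPoly (2 ^ r)) (2 ^ r) k (2 ^ k) ((2 ^ r) ^ k) e m) z) ≤
      2 * (M * e / m + 1 / e) := by
  classical
  have he' : (0 : ℝ) < e := by exact_mod_cast he
  obtain ⟨A, hA, hAz⟩ : ∃ A < (2 ^ r) ^ k, (fun j : Fin k => A / (2 ^ r) ^ (j : ℕ) % 2 ^ r) = z := by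
    refine ⟨finFunctionFinEquiv fun j => ⟨z j, hz j⟩, (finFunctionFinEquiv _).2, ?_⟩
    funext j
    have := congrFun (finFunctionFinEquiv.symm_apply_apply fun j : Fin k =>
      (⟨z j, hz j⟩ : Fin (2 ^ r))) j
    exact congrArg Fin.val this
  have hAd : DistinctDigits (2 ^ r) k A := by
    intro i hi j hj hij h
    apply hij
    have h1 := congrFun hAz ⟨i, hi⟩
    have h2 := congrFun hAz ⟨j, hj⟩
    have := hinj (h1.symm.trans (h.trans h2))
    exact congrArg Fin.val this
  set L := greedyList (gfPoly (2 ^ r)) (2 ^ r) k (2 ^ k) ((2 ^ r) ^ k) e m with hL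
  have h1 : (totalPotential (gfPoly (2 ^ r)) (2 ^ r) k (2 ^ k) ((2 ^ r) ^ k) e L m : ℝ) ≤
      (((2 ^ r) ^ k * 2 ^ 2 ^ k * (e * (e * 2 ^ k + 1)) ^ (m * 2 ^ k) : ℕ) : ℝ) :=
    Nat.cast_le.2 (totalPotential_greedyList_le hr he m)
  rw [totalPotential_eq he, Nat.cast_mul ((2 ^ r) ^ k * 2 ^ 2 ^ k),
    Nat.cast_pow (e * (e * 2 ^ k + 1)), mul_comm] at h1
  have h2 := le_of_mul_le_mul_right h1 (by positivity)
  -- The potential of the given tuple is one term of a sum of nonnegative ones.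
  have h3 := (Finset.single_le_sum (fun A _ => by
    split_ifs
    · exact potential_nonneg (by positivity) _ _
    · exact le_rfl) (Finset.mem_range.2 hA)).trans h2
  rw [if_pos hAd, hAz] at h3
  have h4 := sum_abs_le_of_potential_le (lam := 1 / e) (by positivity) hm
    (c := hitCount m (listPattern (gfPoly (2 ^ r)) (2 ^ r) L z)) (by
      have := sum_hitCount_mul m (listPattern (gfPoly (2 ^ r)) (2 ^ r) L z) (fun _ => 1)
      simp only [mul_one, Finset.sum_const, Finset.card_range, nsmul_eq_mul] at this
      exact_mod_cast this) (h3.trans (by push_cast; exact hM))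
  refine h4.trans_eq ?_
  congr 2
  field_simp

end GreedyBound

/-! ### Composition with hash functions. -/

section Composition

variable {k : ℕ}

theorem sum_hitCount (M : ℕ) (v : ℕ → Fin k → Bool) : ∑ x, (hitCount M v x : ℝ) = M := by
  have := sum_hitCount_mul M v (fun _ => 1)
  simpa using this

theorem l1Error_le_two {M : ℕ} (hM : 0 < M) (v : ℕ → Fin k → Bool) : l1Error M v ≤ 2 := by
  have hM' : (0 : ℝ) < M := by exact_mod_cast hM
  calc l1Error M v ≤ ∑ x, ((hitCount M v x : ℝ) / M + 1 / 2 ^ k) := by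
        refine Finset.sum_le_sum fun x _ => (abs_sub _ _).trans_eq ?_
        rw [abs_of_nonneg (by positivity), abs_of_nonneg (by positivity)]
    _ = 2 := by
        rw [Finset.sum_add_distrib, ← Finset.sum_div, sum_hitCount, div_self hM'.ne']
        simp
        norm_num

/-- The combined law is the average of the laws for fixed first index, and the L₁ distance is
convex. -/
theorem l1Error_mul_le {N M : ℕ} (hN : 0 < N) (hM : 0 < M) (w : ℕ → ℕ → Fin k → Bool) :
    l1Error (N * M) (fun s => w (s / M) (s % M)) ≤
      (∑ h ∈ Finset.range N, l1Error M (w h)) / N := by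
  have hM' : (0 : ℝ) < M := by exact_mod_cast hM
  have hN' : (0 : ℝ) < N := by exact_mod_cast hN
  have h1 : ∀ x, hitCount (N * M) (fun s => w (s / M) (s % M)) x =
      ∑ h ∈ Finset.range N, hitCount M (w h) x := by
    intro x
    simp only [hitCount, Finset.card_filter]
    exact sum_range_mul_div_mod N M (fun h l => if w h l = x then 1 else 0)
  simp only [l1Error]
  rw [Finset.sum_comm, Finset.sum_div]
  refine Finset.sum_le_sum fun x _ => ?_
  have h2 : (hitCount (N * M) (fun s => w (s / M) (s % M)) x : ℝ) / (N * M : ℕ) - 1 / 2 ^ k =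
      (∑ h ∈ Finset.range N, ((hitCount M (w h) x : ℝ) / M - 1 / 2 ^ k)) / N := by
    rw [h1, Finset.sum_sub_distrib, ← Finset.sum_div]
    push_cast
    simp only [Finset.sum_const, Finset.card_range, nsmul_eq_mul]
    field_simp
  rw [h2, abs_div, abs_of_pos hN']
  exact div_le_div_of_nonneg_right (Finset.abs_sum_le_sum_abs _ _) hN'.le

/-- Composition of a family that is almost `k`-wise independent on `Q` coordinates with hash
functions that have few collisions. -/
theorem l1Error_hash_le {N M n Q d : ℕ} (hN : 0 < N) (hM : 0 < M) {H : ℕ → ℕ → ℕ}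
    {bit : ℕ → ℕ → Bool} {δ : ℝ} (hδ : 0 ≤ δ) (hH : ∀ h i, H h i < Q)
    (hcol : ∀ i < n, ∀ j < n, i ≠ j →
      ((Finset.range N).filter fun h => H h i = H h j).card ≤ d)
    (hbit : ∀ z : Fin k → ℕ, (∀ j, z j < Q) → Function.Injective z →
      l1Error M (fun l j => bit l (z j)) ≤ δ)
    {I : Fin k → ℕ} (hI : ∀ j, I j < n) (hinj : Function.Injective I) :
    l1Error (N * M) (fun s j => bit (s % M) (H (s / M) (I j))) ≤ δ + 2 * (k ^ 2 * d) / N := by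
  classical
  have hN' : (0 : ℝ) < N := by exact_mod_cast hN
  refine (l1Error_mul_le hN hM (fun h l j => bit l (H h (I j)))).trans ?_
  rw [div_le_iff₀ hN', add_mul, div_mul_cancel₀ _ hN'.ne']
  set bad := (Finset.range N).filter fun h => ¬ Function.Injective fun j => H h (I j) with hbad
  have h1 : ∀ h ∈ Finset.range N, l1Error M (fun l j => bit l (H h (I j))) ≤
      δ + 2 * (if ¬ Function.Injective (fun j => H h (I j)) then 1 else 0) := by
    intro h _
    split_ifs with hi
    · have := hbit _ (fun j => hH h (I j)) hi
      linarith
    · have := l1Error_le_two hM (fun l j => bit l (H h (I j)))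
      linarith
  refine (Finset.sum_le_sum h1).trans ?_
  rw [Finset.sum_add_distrib, ← Finset.mul_sum, ← Finset.sum_filter, ← hbad, Finset.sum_const,
    Finset.sum_const, Finset.card_range, nsmul_eq_mul, nsmul_eq_mul, mul_one, mul_comm δ]
  -- Union bound over the at most k² ordered pairs of positions.
  have h2 : bad.card ≤ k ^ 2 * d := by
    have hsub : bad ⊆ (Finset.univ.filter fun p : Fin k × Fin k => p.1 ≠ p.2).biUnion fun p =>
        (Finset.range N).filter fun h => H h (I p.1) = H h (I p.2) := by
      intro h hh
      rw [hbad, Finset.mem_filter, Function.Injective] at hh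
      push Not at hh
      obtain ⟨hh1, i, j, hij, hne⟩ := hh
      simp only [Finset.mem_biUnion, Finset.mem_filter, Finset.mem_univ, true_and, Prod.exists]
      exact ⟨i, j, hne, hh1, hij⟩
    refine (Finset.card_le_card hsub).trans ((Finset.card_biUnion_le_card_mul _ _ d ?_).trans ?_)
    · intro p hp
      exact hcol _ (hI _) _ (hI _) fun h => (Finset.mem_filter.1 hp).2 (hinj h)
    · refine Nat.mul_le_mul_right _ ((Finset.card_filter_le _ _).trans_eq ?_)
      simp [sq]
  have h3 : (bad.card : ℝ) ≤ k ^ 2 * d := by exact_mod_cast h2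
  linarith

end Composition

/-! ### From hit counts to probability mass functions. -/

section Distributions

variable {n k : ℕ}

/-- Translation by a vector `e` extending the difference of two patterns maps one fibre of the
restriction onto the other, so all 2^k fibres have equal size. -/
theorem card_restrict_eq {I : Fin k → Fin n} (hI : Function.Injective I) (x : Fin k → Bool) :
    (Finset.univ.filter fun a : Fin n → Bool => x = fun j => a (I j)).card * 2 ^ k = 2 ^ n := by
  have hconst : ∀ y : Fin k → Bool,
      (Finset.univ.filter fun a : Fin n → Bool => y = fun j => a (I j)).card =
      (Finset.univ.filter fun a : Fin n → Bool => x = fun j => a (I j)).card := by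
    intro y
    set e : Fin n → Bool := Function.extend I (fun j => xor (x j) (y j)) fun _ => false
    have he : ∀ j, e (I j) = xor (x j) (y j) := fun j => hI.extend_apply _ _ j
    have hmap : ∀ a : Fin n → Bool, ∀ y z : Fin k → Bool, (∀ j, e (I j) = xor (z j) (y j)) →
        (y = fun j => a (I j)) → z = fun j => xor (a (I j)) (e (I j)) := by
      intro a y z h hy
      funext j
      rw [h j, congrFun hy j]
      cases a (I j) <;> cases z j <;> rfl
    refine Finset.card_nbij' (fun a i => xor (a i) (e i)) (fun a i => xor (a i) (e i)) ?_ ?_ ?_ ?_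
    · intro a ha
      simp only [Finset.coe_filter, Finset.mem_univ, true_and, Set.mem_ofPred_eq] at ha ⊢
      exact hmap a y x he ha
    · intro a ha
      simp only [Finset.coe_filter, Finset.mem_univ, true_and, Set.mem_ofPred_eq] at ha ⊢
      exact hmap a x y (fun j => by rw [he, Bool.xor_comm]) ha
    · intro a _
      funext i
      simp
    · intro a _
      funext i
      simp
  have h := Finset.card_eq_sum_card_fiberwise (f := fun (a : Fin n → Bool) (j : Fin k) => a (I j))
    (s := Finset.univ) (t := Finset.univ) (fun _ _ => Finset.mem_coe.2 (Finset.mem_univ _))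
  simp only [Finset.card_univ, Fintype.card_pi, Fintype.card_bool, Finset.prod_const,
    Fintype.card_fin] at h
  rw [h, Finset.sum_congr rfl fun y _ =>
    (congrArg Finset.card (Finset.filter_congr fun a _ => eq_comm)).trans (hconst y)]
  simp [mul_comm]

theorem toReal_restrictDist (D : PMF (Fin n → Bool)) (I : Fin k ↪o Fin n) (x : Fin k → Bool) :
    (restrictDist D I x).toReal =
      ∑ a ∈ Finset.univ.filter (fun a : Fin n → Bool => x = fun j => a (I j)), (D a).toReal := by
  rw [restrictDist, PMF.map_apply, tsum_fintype, ENNReal.toReal_sum, Finset.sum_filter]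
  · refine Finset.sum_congr rfl fun a _ => ?_
    split_ifs <;> simp
  · intro a _
    split_ifs
    · exact D.apply_ne_top a
    · simp

theorem toReal_restrictDist_uniform (I : Fin k ↪o Fin n) (x : Fin k → Bool) :
    (restrictDist (PMF.uniformOfFintype (Fin n → Bool)) I x).toReal = 1 / 2 ^ k := by
  rw [toReal_restrictDist]
  simp only [PMF.uniformOfFintype_apply, Finset.sum_const, nsmul_eq_mul]
  have h : ((Finset.univ.filter fun a : Fin n → Bool => x = fun j => a (I j)).card : ℝ) * 2 ^ k =
      2 ^ n := by exact_mod_cast card_restrict_eq I.injective x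
  rw [eq_div_iff (by positivity)]
  simp only [Fintype.card_pi, Fintype.card_bool, Finset.prod_const, Finset.card_univ,
    Fintype.card_fin, ENNReal.toReal_inv]
  push_cast
  rw [ENNReal.toReal_pow, ENNReal.toReal_ofNat, mul_right_comm, h, mul_inv_cancel₀ (by positivity)]

theorem toReal_restrictDist_ofMultiset {M : ℕ} (vec : ℕ → Fin n → Bool)
    (h : (((List.range M).map vec : List (Fin n → Bool)) : Multiset (Fin n → Bool)) ≠ 0)
    (I : Fin k ↪o Fin n) (x : Fin k → Bool) :
    (restrictDist (PMF.ofMultiset _ h) I x).toReal =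
      (hitCount M (fun s j => vec s (I j)) x : ℝ) / M := by
  classical
  rw [toReal_restrictDist]
  have h1 : ∀ a, (PMF.ofMultiset _ h a).toReal =
      (((Finset.range M).filter fun s => vec s = a).card : ℝ) / M := by
    intro a
    rw [PMF.ofMultiset_apply, ENNReal.toReal_div, ENNReal.toReal_natCast, ENNReal.toReal_natCast]
    congr 2
    · rw [← Multiset.map_coe, Multiset.count_map, Finset.card_def, Finset.filter_val]
      simp only [eq_comm]
      congr!
    · simp
  simp only [h1]
  rw [← Finset.sum_div, ← Nat.cast_sum, hitCount]
  congr 2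
  rw [Finset.card_eq_sum_card_fiberwise (f := vec)
    (t := Finset.univ.filter (fun a : Fin n → Bool => x = fun j => a (I j)))]
  · refine Finset.sum_congr rfl fun a ha => ?_
    rw [Finset.filter_filter]
    congr 1
    refine Finset.filter_congr fun s _ => ?_
    have := (Finset.mem_filter.1 ha).2
    constructor
    · rintro rfl
      exact ⟨this.symm, rfl⟩
    · exact fun h => h.2
  · intro s hs
    simp only [Finset.coe_filter, Finset.mem_range, Set.mem_ofPred_eq, Finset.mem_univ,
      true_and] at hs ⊢
    exact hs.2.symm

theorem isAlmostKWiseL1Set_of_l1Error_le {M : ℕ} (hM : 0 < M) {ε : ℝ} (vec : ℕ → Fin n → Bool)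
    (h : ∀ I : Fin k ↪o Fin n, l1Error M (fun s j => vec s (I j)) ≤ ε) :
    IsAlmostKWiseL1Set k ε
      (((List.range M).map vec : List (Fin n → Bool)) : Multiset (Fin n → Bool)) := by
  refine ⟨by simp; omega, fun I => ?_⟩
  refine le_trans (le_of_eq ?_) (h I)
  rw [l1Dist, l1Error]
  refine Finset.sum_congr rfl fun x _ => ?_
  rw [toReal_restrictDist_ofMultiset, toReal_restrictDist_uniform]

end Distributions

/-! ### Choice of parameters and the algorithm. -/

/-- The admissible inputs `(n, k, ε)`. -/
structure Input where
  n : ℕ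
  k : ℕ
  ε : ℚ
  one_le_k : 1 ≤ k
  k_le_n : k ≤ n
  ε_pos : 0 < ε
  ε_lt_one : ε < 1

namespace Input

/-- A natural number that is slightly larger than `1 / ε`. -/
def invEps (i : Input) : ℕ := i.ε.den / i.ε.num.natAbs + 1

/-- The quantities n, 2^k and 1/ε enter by value, because loops run through them; numerator and
denominator enter only by length, through the size of the code. -/
instance : Coded Input where
  enc i := encodeInput i.n i.k i.ε
  meas i := (encodeInput i.n i.k i.ε).size + i.n + 2 ^ i.k + i.invEps
  size_le i := by
    rw [add_assoc, add_assoc]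
    exact Nat.le_add_right _ _

theorem meas_eq (i : Input) :
    meas i = (encodeInput i.n i.k i.ε).size + i.n + 2 ^ i.k + i.invEps := rfl

/-- Whether `n` is so large that all `k`-tuples of field elements may be enumerated, for a field
with about `n ^ (1 / k)` elements. -/
def IsLarge (i : Input) : Prop := 8 * i.k ^ 3 * i.invEps ≤ 2 ^ (Nat.log 2 i.n / i.k)

instance (i : Input) : Decidable i.IsLarge :=
  inferInstanceAs (Decidable (_ ≤ _))

/-- A bound for the degree of the polynomials that define the hash functions. -/
def hashDegree (i : Input) : ℕ := if i.IsLarge then 2 * i.k else Nat.log 2 i.n + 1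

/-- The number of hash functions. -/
def numHash (i : Input) : ℕ := 4 * i.k ^ 2 * i.hashDegree * i.invEps

/-- The binary logarithm of the size of the field. -/
def fieldExp (i : Input) : ℕ :=
  if i.IsLarge then Nat.log 2 i.n / i.k else Nat.clog 2 (i.numHash * 2 ^ ((i.k + 1) / 2))

/-- The size of the field. -/
def fieldSize (i : Input) : ℕ := 2 ^ i.fieldExp

/-- The size of the sample on the coordinates indexed by the field. -/
def innerSize (i : Input) : ℕ :=
  if i.IsLarge then 64 * i.invEps ^ 2 * (2 ^ i.k + Nat.log 2 i.n + 1)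
  else i.fieldSize * i.fieldSize

/-- The polynomials of the inner sample, for large inputs. -/
noncomputable def polyList (i : Input) : List ℕ :=
  if i.IsLarge then greedyList (gfPoly i.fieldSize) i.fieldSize i.k (2 ^ i.k)
    (i.fieldSize ^ i.k) (8 * i.invEps) i.innerSize
  else []

/-- The bit at coordinate `z` of the element with index `l` of the inner sample. -/
noncomputable def innerBit (i : Input) (l z : ℕ) : ℕ :=
  if i.IsLarge then gfEval (gfPoly i.fieldSize) i.fieldSize (i.polyList.getD l 0) z i.k % 2
  else gfGeom (gfPoly i.fieldSize) i.fieldSize (l % i.fieldSize)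
    (gfMul (gfPoly i.fieldSize) i.fieldSize z (l / i.fieldSize)) i.k % 2

/-- The hash function with index `h`. -/
noncomputable def hash (i : Input) (h c : ℕ) : ℕ :=
  gfEval (gfPoly i.fieldSize) i.fieldSize c h i.hashDegree

/-- The bit at coordinate `c` of the element with index `s` of the sample. -/
noncomputable def bit (i : Input) (s c : ℕ) : ℕ :=
  i.innerBit (s % i.innerSize) (i.hash (s / i.innerSize) c)

/-- The output of the algorithm. -/
noncomputable def output (i : Input) : List (List ℕ) :=
  (List.range (i.numHash * i.innerSize)).map fun s => (List.range i.n).map (i.bit s)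

/-- The sample listed by the algorithm. -/
noncomputable def sample (i : Input) : List (Fin i.n → Bool) :=
  (List.range (i.numHash * i.innerSize)).map fun s c => decide (i.bit s c = 1)

theorem bit_le_one (i : Input) (s c : ℕ) : i.bit s c ≤ 1 := by
  rw [bit, innerBit]
  split_ifs <;> omega

theorem enc_output (i : Input) : enc i.output = encodeSample i.sample := by
  rw [enc_list, encodeSample, output, sample, List.map_map, List.map_map]
  congr 1
  refine List.map_congr_left fun s _ => ?_
  simp only [Function.comp, enc_list, encodeVec]
  congr 1
  refine List.ext_getElem (by simp) fun c h1 h2 => ?_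
  simp only [List.getElem_map, List.getElem_range, List.getElem_ofFn, enc_nat]
  congr 1
  have := i.bit_le_one s c
  interval_cases h : i.bit s c <;> rfl

/-! ### The output is computed in polynomial time -/

theorem n_pos (i : Input) : 0 < i.n := i.one_le_k.trans i.k_le_n

theorem two_pow_log_div_le (i : Input) : 2 ^ (Nat.log 2 i.n / i.k) ≤ i.n :=
  (Nat.pow_le_pow_right (by omega) (Nat.div_le_self _ _)).trans
    (Nat.pow_log_le_self 2 i.n_pos.ne')

theorem polyBounded_of_le_meas {g : Input → ℕ} (h : ∀ i, g i ≤ meas i) : PolyBounded g :=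
  PolyBounded.meas.mono h

@[fun_prop]
theorem polyTime_n : PolyTime Input.n :=
  .of_primitive .left (fun _ => rfl) (fun _ => rfl) (polyBounded_of_le_meas fun i => by
    have := Nat.one_le_two_pow (n := i.k)
    rw [meas_nat, meas_eq]
    omega)

theorem polyTime_right {β : Type} [Coded β] {g : Input → β} (P : Prog)
    (hP : ∀ i : Input, P.eval (enc i).right = enc (g i)) (ht : ∀ v, P.time v = (v.size + 1) ^ 2)
    (hb : PolyBounded fun i => meas (g i)) : PolyTime g := by
  have hr : ∀ v : SExp, v.right.size ≤ v.size := by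
    intro v
    have := v.one_le_size
    cases v <;> simp [SExp.right, SExp.size]
  refine ⟨.comp P .right, hP, ?_, hb⟩
  refine ((PolyBounded.const 1).add (((PolyBounded.meas.add (PolyBounded.const 1)).pow 2).add
    ((PolyBounded.meas.add (PolyBounded.const 1)).pow 2))).mono fun i => ?_
  have h1 := size_le i
  have h2 := hr (enc i)
  simp only [Prog.time, ht, Prog.eval]
  rw [add_assoc]
  gcongr
  exact h2.trans h1

@[fun_prop]
theorem polyTime_k : PolyTime Input.k :=
  polyTime_right .left (fun _ => rfl) (fun _ => rfl) (polyBounded_of_le_meas fun i => by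
    have := Nat.one_le_two_pow (n := i.k)
    have := i.k_le_n
    rw [meas_nat, meas_eq]
    omega)

/-- A rational number coded by numerator and denominator. -/
theorem polyTime_frac : PolyTime fun i : Input =>
    ((⟨i.ε.num.natAbs⟩, ⟨i.ε.den⟩) : BigNat × BigNat) :=
  polyTime_right .right (fun _ => rfl) (fun _ => rfl) (polyBounded_of_le_meas fun i => by
    have h : meas ((⟨i.ε.num.natAbs⟩, ⟨i.ε.den⟩) : BigNat × BigNat) =
      1 + (1 + i.ε.num.natAbs.size) + (1 + i.ε.den.size) := rfl
    rw [h, meas_eq]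
    have := Nat.two_pow_pos i.k
    simp only [encodeInput, SExp.size]
    omega)

@[fun_prop]
theorem polyTime_invEps : PolyTime invEps := by
  have h1 : PolyTimeBig fun i : Input => i.ε.num.natAbs := PolyTime.fst.comp polyTime_frac
  have h2 : PolyTimeBig fun i : Input => i.ε.den := PolyTime.snd.comp polyTime_frac
  exact .of_big ((h2.div h1).add (PolyTime.const 1).big) (polyBounded_of_le_meas fun i => by
    have := Nat.two_pow_pos i.k
    rw [meas_eq, invEps]
    omega)

@[fun_prop]
theorem polyTime_two_pow_k : PolyTime fun i : Input => 2 ^ i.k :=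
  .of_big (.pow (PolyTime.const 2).big polyTime_k) (polyBounded_of_le_meas fun i => by
    rw [meas_eq]
    omega)

theorem log_eq_card {n : ℕ} (hn : n ≠ 0) :
    Nat.log 2 n = ((Finset.range n).filter fun j => min (2 ^ (j + 1)) (n + 1) ≤ n).card := by
  have h : ((Finset.range n).filter fun j => min (2 ^ (j + 1)) (n + 1) ≤ n) =
      Finset.range (Nat.log 2 n) := by
    ext j
    rw [Finset.mem_filter, Finset.mem_range, Finset.mem_range, min_le_iff, or_iff_left (by omega),
      ← Nat.le_log_iff_pow_le one_lt_two hn]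
    have := Nat.log_lt_self 2 hn
    omega
  rw [h, Finset.card_range]

theorem clog_eq_card (n : ℕ) :
    Nat.clog 2 n = ((Finset.range n).filter fun j => min (2 ^ j) (n + 1) < n).card := by
  have h : ((Finset.range n).filter fun j => min (2 ^ j) (n + 1) < n) =
      Finset.range (Nat.clog 2 n) := by
    ext j
    rw [Finset.mem_filter, Finset.mem_range, Finset.mem_range, min_lt_iff, or_iff_left (by omega),
      Nat.lt_clog_iff_pow_lt one_lt_two]
    refine and_iff_right_of_imp fun h => lt_trans Nat.lt_two_pow_self h
  rw [h, Finset.card_range]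

theorem _root_.PolyTime.clog {α : Type} [Coded α] {f : α → ℕ} (hf : PolyTime f) :
    PolyTime fun a => Nat.clog 2 (f a) := by
  simp only [clog_eq_card]
  exact .count (p := fun a j => min (2 ^ j) (f a + 1) < f a)
    (.lt (.minPow (by fun_prop) (by fun_prop) (by fun_prop)) (by fun_prop)) hf

@[fun_prop]
theorem polyTime_log : PolyTime fun i : Input => Nat.log 2 i.n := by
  simp only [fun i : Input => log_eq_card i.n_pos.ne']
  exact .count (p := fun (i : Input) j => min (2 ^ (j + 1)) (i.n + 1) ≤ i.n)
    (.le (.minPow (by fun_prop) (by fun_prop) (by fun_prop)) (by fun_prop)) polyTime_n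

@[fun_prop]
theorem polyTime_pow_log_div : PolyTime fun i : Input => 2 ^ (Nat.log 2 i.n / i.k) :=
  .pow_of_le (.const 2) (by fun_prop) polyTime_n two_pow_log_div_le

theorem _root_.PolyTime.powConst {α : Type} [Coded α] {f : α → ℕ} (hf : PolyTime f) :
    ∀ t : ℕ, PolyTime fun a => f a ^ t
  | 0 => by simpa using PolyTime.const 1
  | t + 1 => by simpa only [pow_succ] using (PolyTime.powConst hf t).mul hf

theorem polyDec_isLarge : PolyDec IsLarge :=
  .le (.mul (.mul (.const 8) (.powConst polyTime_k 3)) polyTime_invEps) polyTime_pow_log_div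

@[fun_prop]
theorem polyTime_hashDegree : PolyTime hashDegree :=
  .ite polyDec_isLarge (by fun_prop) (by fun_prop)

@[fun_prop]
theorem polyTime_numHash : PolyTime numHash :=
  .mul (.mul (.mul (.const 4) (.powConst polyTime_k 2)) polyTime_hashDegree) polyTime_invEps

theorem two_pow_clog_le {t : ℕ} (ht : 0 < t) : 2 ^ Nat.clog 2 t ≤ 2 * t := by
  rcases Nat.eq_zero_or_pos (Nat.clog 2 t) with h | h
  · rw [h]
    omega
  · have := (Nat.lt_clog_iff_pow_lt one_lt_two (x := t) (y := Nat.clog 2 t - 1)).1 (by omega)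
    rw [show Nat.clog 2 t = Nat.clog 2 t - 1 + 1 by omega, pow_succ]
    omega

theorem invEps_pos (i : Input) : 0 < i.invEps := Nat.succ_pos _

theorem hashDegree_pos (i : Input) : 0 < i.hashDegree := by
  have := i.one_le_k
  rw [hashDegree]
  split_ifs <;> omega

theorem numHash_pos (i : Input) : 0 < i.numHash := by
  have := i.one_le_k
  have := i.invEps_pos
  have := i.hashDegree_pos
  rw [numHash]
  positivity

@[fun_prop]
theorem polyTime_fieldSize : PolyTime fieldSize := by
  have h1 : PolyTime fun i : Input => 2 ^ ((i.k + 1) / 2) :=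
    .pow_of_le (.const 2) (by fun_prop) polyTime_two_pow_k fun i =>
      Nat.pow_le_pow_right (by omega) (by have := i.one_le_k; omega)
  have h2 : PolyTime fun i : Input => 2 ^ Nat.clog 2 (i.numHash * 2 ^ ((i.k + 1) / 2)) :=
    .pow_of_le (.const 2) (.clog (.mul polyTime_numHash h1))
      (.mul (.const 2) (.mul polyTime_numHash h1)) fun i =>
        two_pow_clog_le (Nat.mul_pos i.numHash_pos (by positivity))
  have h : fieldSize = fun i => if i.IsLarge then 2 ^ (Nat.log 2 i.n / i.k)
      else 2 ^ Nat.clog 2 (i.numHash * 2 ^ ((i.k + 1) / 2)) := by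
    funext i
    rw [fieldSize, fieldExp]
    split_ifs <;> rfl
  rw [h]
  exact .ite polyDec_isLarge polyTime_pow_log_div h2

@[fun_prop]
theorem polyTime_innerSize : PolyTime innerSize :=
  .ite polyDec_isLarge (.mul (.mul (.const 64) (.powConst polyTime_invEps 2)) (by fun_prop))
    (by fun_prop)

theorem fieldSize_pow_le (i : Input) (h : i.IsLarge) : i.fieldSize ^ i.k ≤ 2 ^ Nat.log 2 i.n := by
  rw [fieldSize, fieldExp, if_pos h, ← pow_mul]
  exact Nat.pow_le_pow_right (by omega) (Nat.div_mul_le_self _ _)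

@[fun_prop]
theorem polyTime_polyList : PolyTime polyList := by
  -- The bound Q^k ≤ n holds only for large inputs, while each branch must be polynomial on every
  -- input; the cap at `i.n` ensures this and changes nothing where the branch is used.
  have h : polyList = fun i => if i.IsLarge then greedyList (gfPoly i.fieldSize) i.fieldSize i.k
      (2 ^ i.k) (min (i.fieldSize ^ i.k) i.n) (8 * i.invEps) i.innerSize else [] := by
    funext i
    rw [polyList]
    split_ifs with h
    · rw [min_eq_left ((i.fieldSize_pow_le h).trans (Nat.pow_log_le_self 2 i.n_pos.ne'))]
    · rfl
  rw [h]
  exact .ite polyDec_isLarge (.greedyList (by fun_prop) (by fun_prop) (by fun_prop) (by fun_prop)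
    (.minPow (by fun_prop) (by fun_prop) (by fun_prop)) (by fun_prop) (by fun_prop)) (by fun_prop)

theorem polyTime_innerBit {α : Type} [Coded α] {g : α → Input} {l z : α → ℕ} (hg : PolyTime g)
    (hl : PolyTime l) (hz : PolyTime z) : PolyTime fun a => (g a).innerBit (l a) (z a) := by
  obtain ⟨χ, hχ, h⟩ := polyDec_isLarge
  exact .ite ⟨fun a => χ (g a), hχ.comp hg, fun a => h (g a)⟩ (by fun_prop) (by fun_prop)

theorem polyTime_bit {α : Type} [Coded α] {g : α → Input} {s c : α → ℕ} (hg : PolyTime g)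
    (hs : PolyTime s) (hc : PolyTime c) : PolyTime fun a => (g a).bit (s a) (c a) :=
  polyTime_innerBit hg (by fun_prop) (.gfEval (by fun_prop) (by fun_prop) (by fun_prop)
    (by fun_prop) (by fun_prop))

theorem polyTime_output : PolyTime output :=
  .mapRange (f := fun (i : Input) s => (List.range i.n).map (i.bit s))
    (.mapRange (f := fun (p : Input × ℕ) c => p.1.bit p.2 c)
      (polyTime_bit (by fun_prop) (by fun_prop) (by fun_prop)) (by fun_prop))
    (by fun_prop)

/-! ### The output is almost `k`-wise independent -/

theorem fieldExp_ne_zero (i : Input) : i.fieldExp ≠ 0 := by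
  have h1 := i.one_le_k
  have h2 := i.invEps_pos
  rw [fieldExp]
  split_ifs with h
  · intro h0
    rw [IsLarge, h0, pow_zero] at h
    have : 0 < i.k ^ 3 * i.invEps := by positivity
    rw [mul_assoc] at h
    omega
  · rw [← Nat.pos_iff_ne_zero, Nat.lt_clog_iff_pow_lt one_lt_two, pow_zero]
    have h3 := i.hashDegree_pos
    have : 0 < i.k ^ 2 * i.hashDegree * i.invEps * 2 ^ ((i.k + 1) / 2) := by positivity
    rw [numHash]
    nlinarith

/-- Hash indices must be distinct field elements. For large inputs `numHash` is 4k²·2k·E = 8k³E,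
which is the threshold in `IsLarge`. -/
theorem numHash_le (i : Input) : i.numHash ≤ i.fieldSize := by
  rw [fieldSize, fieldExp]
  split_ifs with h
  · refine le_trans (le_of_eq ?_) h
    rw [numHash, hashDegree, if_pos h]
    ring
  · exact (Nat.le_mul_of_pos_right _ (by positivity)).trans (Nat.le_pow_clog one_lt_two _)

/-- Every coordinate must be given by `hashDegree` digits. For large inputs this rests on 2k⌊L/k⌋ ≥
k(⌊L/k⌋ + 1) > L, where ⌊L/k⌋ ≥ 1. -/
theorem n_lt (i : Input) : i.n < i.fieldSize ^ i.hashDegree := by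
  refine (Nat.lt_pow_succ_log_self one_lt_two i.n).trans_le ?_
  have hr := i.fieldExp_ne_zero
  rw [fieldSize, ← pow_mul]
  refine Nat.pow_le_pow_right (by omega) ?_
  rw [hashDegree]
  split_ifs with h
  · have hk := i.one_le_k
    rw [fieldExp, if_pos h] at hr ⊢
    have h1 := Nat.lt_mul_div_succ (Nat.log 2 i.n) (b := i.k) (by omega)
    generalize Nat.log 2 i.n / i.k = a at *
    have : 1 ≤ a := by omega
    nlinarith
  · exact Nat.le_mul_of_pos_left _ (by omega)

theorem hash_lt (i : Input) (h c : ℕ) : i.hash h c < i.fieldSize := by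
  obtain ⟨F, _, _, θ, hroot, -⟩ := exists_field_model i.fieldExp_ne_zero
  exact (gfEval_spec hroot i.fieldExp_ne_zero c h _).1

theorem innerSize_pos (i : Input) : 0 < i.innerSize := by
  have := i.invEps_pos
  rw [innerSize, fieldSize]
  split_ifs <;> positivity

theorem l1Error_innerBit_le (i : Input) (z : Fin i.k → ℕ) (hz : ∀ j, z j < i.fieldSize)
    (hinj : Function.Injective z) :
    l1Error i.innerSize (fun l j => decide (i.innerBit l (z j) = 1)) ≤ 1 / (2 * i.invEps) := by
  have hE : (0 : ℝ) < i.invEps := by exact_mod_cast i.invEps_pos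
  by_cases h : i.IsLarge
  -- With λ = 1/(8E) and m = 64E²M, both M/(λm) and λ equal 1/(8E), so the error is at most 1/(2E).
  -- The value of M is admissible because Q^k·2^(2^k) ≤ 2^M ≤ e^M.
  · have h1 := l1Error_greedyList_le i.fieldExp_ne_zero (e := 8 * i.invEps) (m := i.innerSize)
      (by have := i.invEps_pos; omega) i.innerSize_pos
      (M := ((2 ^ i.k + Nat.log 2 i.n + 1 : ℕ) : ℝ)) ?_ hz hinj
    · have h2 : ∀ l j, i.innerBit l (z j) = gfEval (gfPoly i.fieldSize) i.fieldSize
          ((greedyList (gfPoly i.fieldSize) i.fieldSize i.k (2 ^ i.k)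
            (i.fieldSize ^ i.k) (8 * i.invEps) i.innerSize).getD l 0) (z j) i.k % 2 := by
        intro l j
        rw [innerBit, if_pos h, polyList, if_pos h]
      simp only [h2]
      refine h1.trans (le_of_eq ?_)
      rw [innerSize, if_pos h]
      have : (0 : ℝ) < ((2 ^ i.k + Nat.log 2 i.n + 1 : ℕ) : ℝ) := by positivity
      rw [show 64 * i.invEps ^ 2 * (2 ^ i.k + Nat.log 2 i.n + 1) =
        64 * i.invEps ^ 2 * (2 ^ i.k + Nat.log 2 i.n + 1 : ℕ) from rfl]
      generalize 2 ^ i.k + Nat.log 2 i.n + 1 = t at *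
      push_cast
      field_simp
      norm_num
    · have h3 : ((i.fieldSize ^ i.k * 2 ^ 2 ^ i.k : ℕ) : ℝ) ≤
          ((2 ^ (2 ^ i.k + Nat.log 2 i.n + 1) : ℕ) : ℝ) := by
        refine Nat.cast_le.2 ((Nat.mul_le_mul_right _ (i.fieldSize_pow_le h)).trans ?_)
        rw [← pow_add]
        exact Nat.pow_le_pow_right (by omega) (by omega)
      rw [fieldSize] at h3
      push_cast at h3
      refine h3.trans ?_
      rw [← mul_one ((2 ^ i.k + Nat.log 2 i.n + 1 : ℕ) : ℝ), Real.exp_nat_mul]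
      refine pow_le_pow_left₀ zero_le_two ?_ _
      have := Real.add_one_le_exp 1
      linarith
  · have h1 := l1Error_gfGeom_sq_le i.fieldExp_ne_zero hz hinj
    have h2 : ∀ l j, i.innerBit l (z j) = gfGeom (gfPoly i.fieldSize) i.fieldSize
        (l % i.fieldSize) (gfMul (gfPoly i.fieldSize) i.fieldSize (z j) (l / i.fieldSize)) i.k % 2 :=
      fun l j => by rw [innerBit, if_neg h]
    simp only [h2]
    rw [innerSize, if_neg h]
    refine abs_le_of_sq_le_sq' (h1.trans ?_) (by positivity) |>.2
    -- The field is chosen so large that 2^{k/2}·k/Q ≤ 1/(2E); the exponent of 2 is k/2 rounded up.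
    have h3 : 2 * i.k * i.invEps * 2 ^ ((i.k + 1) / 2) ≤ 2 ^ i.fieldExp := by
      rw [fieldExp, if_neg h]
      refine le_trans ?_ (Nat.le_pow_clog one_lt_two _)
      refine Nat.mul_le_mul_right _ ?_
      rw [numHash, sq]
      have h4 := i.one_le_k
      have h5 := i.hashDegree_pos
      have h6 : 1 ≤ i.k * i.hashDegree := Nat.mul_pos h4 h5
      calc 2 * i.k * i.invEps ≤ 2 * i.k * i.invEps * (2 * (i.k * i.hashDegree)) :=
            Nat.le_mul_of_pos_right _ (by omega)
        _ = _ := by ring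
    have h4 : (2 * i.k * i.invEps * 2 ^ ((i.k + 1) / 2) : ℝ) ≤ 2 ^ i.fieldExp := by
      exact_mod_cast h3
    have h5 : (2 : ℝ) ^ i.k ≤ (2 ^ ((i.k + 1) / 2)) ^ 2 := by
      rw [← pow_mul]
      exact pow_le_pow_right₀ one_le_two (by omega)
    have h6 : (0 : ℝ) < 2 ^ i.fieldExp := by positivity
    calc (2 : ℝ) ^ i.k * (i.k / 2 ^ i.fieldExp) ^ 2
        ≤ (2 ^ ((i.k + 1) / 2)) ^ 2 * (i.k / 2 ^ i.fieldExp) ^ 2 :=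
          mul_le_mul_of_nonneg_right h5 (by positivity)
      _ = (2 ^ ((i.k + 1) / 2) * (i.k / 2 ^ i.fieldExp)) ^ 2 := by ring
      _ ≤ _ := by
          refine pow_le_pow_left₀ (by positivity) ?_ 2
          rw [← mul_div_assoc, div_le_div_iff₀ h6 (by positivity)]
          linarith

theorem one_div_invEps_le (i : Input) : 1 / (i.invEps : ℝ) ≤ (i.ε : ℝ) := by
  have hE : (0 : ℝ) < i.invEps := by exact_mod_cast i.invEps_pos
  have hnum : 0 < i.ε.num.natAbs := Int.natAbs_pos.2 (Rat.num_pos.2 i.ε_pos).ne'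
  have h1 : i.ε.den < i.invEps * i.ε.num.natAbs := by
    have := Nat.lt_mul_div_succ i.ε.den hnum
    rw [invEps, mul_comm]
    exact this
  have h2 : (i.ε : ℝ) = (i.ε.num.natAbs : ℝ) / i.ε.den := by
    rw [Rat.cast_def, Nat.cast_natAbs, abs_of_pos (Rat.num_pos.2 i.ε_pos)]
  have hden : (0 : ℝ) < i.ε.den := by exact_mod_cast i.ε.den_pos
  have h1' : (i.ε.den : ℝ) < i.invEps * i.ε.num.natAbs := by exact_mod_cast h1
  rw [h2, div_le_div_iff₀ hE hden]
  linarith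

theorem invEps_le (i : Input) : (i.invEps : ℝ) ≤ 1 / (i.ε : ℝ) + 1 := by
  have hnum : (0 : ℝ) < i.ε.num.natAbs := by
    exact_mod_cast Int.natAbs_pos.2 (Rat.num_pos.2 i.ε_pos).ne'
  have h2 : 1 / (i.ε : ℝ) = (i.ε.den : ℝ) / i.ε.num.natAbs := by
    rw [Rat.cast_def, Nat.cast_natAbs, abs_of_pos (Rat.num_pos.2 i.ε_pos), one_div_div]
  rw [h2, invEps]
  push_cast
  exact add_le_add_left Nat.cast_div_le 1

theorem isAlmostKWiseL1Set_sample (i : Input) :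
    IsAlmostKWiseL1Set i.k (i.ε : ℝ) (i.sample : Multiset (Fin i.n → Bool)) := by
  have hE : (0 : ℝ) < i.invEps := by exact_mod_cast i.invEps_pos
  refine isAlmostKWiseL1Set_of_l1Error_le (Nat.mul_pos i.numHash_pos i.innerSize_pos) _
    fun I => ?_
  have h := l1Error_hash_le (n := i.n) (d := i.hashDegree) i.numHash_pos i.innerSize_pos
    (H := i.hash) (bit := fun l z => decide (i.innerBit l z = 1)) (δ := 1 / (2 * i.invEps))
    (by positivity) i.hash_lt (fun a ha b hb hab => card_gfEval_eq_le i.fieldExp_ne_zero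
      i.numHash_le (ha.trans i.n_lt) (hb.trans i.n_lt) hab) i.l1Error_innerBit_le
    (I := fun j => (I j : ℕ)) (fun j => (I j).2) (fun a b hab => I.injective (Fin.ext hab))
  -- The collision term 2k²d/N equals 1/(2E) and adds to the inner error 1/(2E).
  refine (h.trans (le_of_eq ?_)).trans i.one_div_invEps_le
  have h1 : (0 : ℝ) < i.k := by exact_mod_cast i.one_le_k
  have h2 : (0 : ℝ) < i.hashDegree := by exact_mod_cast i.hashDegree_pos
  rw [numHash]
  push_cast
  field_simp
  norm_num

end Input

/-! ### Bounds for the input measure and the sample size. -/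

namespace Input

theorem meas_le (i : Input) :
    (meas i : ℝ) ≤ 11 * ((i.n : ℝ) + 2 ^ i.k + 1 / (i.ε : ℝ) + (i.ε.den.size : ℝ)) := by
  have hsize : ∀ m : ℕ, m.size ≤ m := fun m => Nat.size_le.2 Nat.lt_two_pow_self
  have h1 := hsize i.n
  have h2 := (hsize i.k).trans i.k_le_n
  have h3 : i.ε.num.natAbs.size ≤ i.ε.den.size := by
    refine Nat.size_le_size ?_
    have := Rat.num_lt_denom_iff.2 i.ε_lt_one
    have := Rat.num_pos.2 i.ε_pos
    omega
  have h4 := i.invEps_le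
  have h5 : meas i ≤ 7 + 3 * i.n + 2 * i.ε.den.size + 2 ^ i.k + i.invEps := by
    rw [meas_eq]
    simp only [encodeInput, SExp.size]
    omega
  have h6 : (meas i : ℝ) ≤ 7 + 3 * i.n + 2 * i.ε.den.size + 2 ^ i.k + i.invEps := by
    exact_mod_cast h5
  have h7 : (1 : ℝ) ≤ i.n := by exact_mod_cast i.n_pos
  have h8 : (0 : ℝ) ≤ i.ε.den.size := Nat.cast_nonneg _
  have h9 : (0 : ℝ) < 2 ^ i.k := by positivity
  have hε : (0 : ℝ) < i.ε := by exact_mod_cast i.ε_pos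
  have h10 : (0 : ℝ) < 1 / i.ε := by positivity
  linarith

theorem half_lt_log_two : 1 / 2 < Real.log 2 := by
  have := Real.log_two_gt_d9
  linarith

/-- The sample size in terms of the parameters. -/
theorem size_eq_of_isLarge (i : Input) (h : i.IsLarge) :
    i.numHash * i.innerSize = 512 * i.k ^ 3 * i.invEps ^ 3 * (2 ^ i.k + Nat.log 2 i.n + 1) := by
  rw [numHash, hashDegree, innerSize, if_pos h, if_pos h]
  ring

/-- Rounding up to a power of 2 at most doubles Q, so N·Q² ≤ 8N³·2^k, and 512 = 8·4³. -/
theorem size_le_of_not_isLarge (i : Input) (h : ¬ i.IsLarge) :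
    i.numHash * i.innerSize ≤
      512 * i.k ^ 6 * i.hashDegree ^ 3 * i.invEps ^ 3 * 2 ^ i.k := by
  have h1 : i.fieldSize ≤ 2 * (i.numHash * 2 ^ ((i.k + 1) / 2)) := by
    rw [fieldSize, fieldExp, if_neg h]
    exact two_pow_clog_le (Nat.mul_pos i.numHash_pos (by positivity))
  have h2 : (2 ^ ((i.k + 1) / 2)) ^ 2 ≤ 2 * 2 ^ i.k := by
    rw [← pow_mul, ← pow_succ']
    exact Nat.pow_le_pow_right (by omega) (by omega)
  rw [innerSize, if_neg h]
  calc i.numHash * (i.fieldSize * i.fieldSize)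
      ≤ i.numHash * ((2 * (i.numHash * 2 ^ ((i.k + 1) / 2))) *
          (2 * (i.numHash * 2 ^ ((i.k + 1) / 2)))) := by gcongr
    _ = 4 * i.numHash ^ 3 * (2 ^ ((i.k + 1) / 2)) ^ 2 := by ring
    _ ≤ 4 * i.numHash ^ 3 * (2 * 2 ^ i.k) := by gcongr
    _ = _ := by
      rw [numHash]
      ring

/-- The nearly optimal size of the sample, up to logarithmic factors. -/
noncomputable def sizeParam (i : Input) : ℝ := (2 ^ i.k + Real.log i.n) / (i.ε : ℝ) ^ 3

theorem log_n_nonneg (i : Input) : 0 ≤ Real.log i.n :=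
  Real.log_natCast_nonneg _

theorem ε_pos' (i : Input) : (0 : ℝ) < i.ε := by exact_mod_cast i.ε_pos

theorem ε_le_one' (i : Input) : (i.ε : ℝ) ≤ 1 := by exact_mod_cast i.ε_lt_one.le

theorem two_pow_div_le (i : Input) : 2 ^ i.k / (i.ε : ℝ) ^ 3 ≤ i.sizeParam := by
  have := i.ε_pos'
  have := i.log_n_nonneg
  exact div_le_div_of_nonneg_right (by linarith) (by positivity)

theorem one_div_pow_le (i : Input) : 1 / (i.ε : ℝ) ^ 3 ≤ i.sizeParam := by
  have := i.ε_pos'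
  refine le_trans ?_ i.two_pow_div_le
  exact div_le_div_of_nonneg_right (one_le_pow₀ one_le_two) (by positivity)

theorem one_div_ε_le (i : Input) : 1 / (i.ε : ℝ) ≤ i.sizeParam := by
  have h := i.ε_pos'
  refine le_trans ?_ i.one_div_pow_le
  refine one_div_le_one_div_of_le (by positivity) ?_
  exact pow_le_of_le_one h.le i.ε_le_one' (by norm_num)

theorem two_pow_le (i : Input) : 2 ^ i.k ≤ i.sizeParam := by
  have h := i.ε_pos'
  refine le_trans ?_ i.two_pow_div_le
  exact le_div_self (by positivity) (by positivity) (pow_le_one₀ h.le i.ε_le_one')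

theorem one_le_sizeParam (i : Input) : 1 ≤ i.sizeParam :=
  (one_le_pow₀ one_le_two).trans i.two_pow_le

theorem log_sizeParam_nonneg (i : Input) : 0 ≤ Real.log i.sizeParam :=
  Real.log_nonneg i.one_le_sizeParam

theorem k_le_log (i : Input) : (i.k : ℝ) ≤ 2 * (1 + Real.log i.sizeParam) := by
  have h := Real.log_le_log (by positivity) i.two_pow_le
  rw [Real.log_pow] at h
  have h1 : (0 : ℝ) ≤ i.k := Nat.cast_nonneg _
  nlinarith [half_lt_log_two]

theorem invEps_le_two_div (i : Input) : (i.invEps : ℝ) ≤ 2 / i.ε := by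
  have h := i.invEps_le
  have h1 : 1 ≤ 1 / (i.ε : ℝ) := by
    rw [le_div_iff₀ i.ε_pos', one_mul]
    exact i.ε_le_one'
  have h2 : 2 / (i.ε : ℝ) = 1 / i.ε + 1 / i.ε := by ring
  linarith

theorem invEps_pow_le (i : Input) : (i.invEps : ℝ) ^ 3 ≤ 8 / (i.ε : ℝ) ^ 3 := by
  refine (pow_le_pow_left₀ (Nat.cast_nonneg _) i.invEps_le_two_div 3).trans_eq ?_
  rw [div_pow]
  norm_num

theorem natLog_le (i : Input) : (Nat.log 2 i.n : ℝ) ≤ 2 * Real.log i.n := by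
  have h1 : ((2 ^ Nat.log 2 i.n : ℕ) : ℝ) ≤ i.n :=
    Nat.cast_le.2 (Nat.pow_log_le_self 2 i.n_pos.ne')
  have h2 := Real.log_le_log (by positivity) h1
  push_cast at h2
  rw [Real.log_pow] at h2
  have h3 : (0 : ℝ) ≤ Nat.log 2 i.n := Nat.cast_nonneg _
  nlinarith [half_lt_log_two]

/-- Failure of `IsLarge` means 2^⌊L/k⌋ < 8k³E, which is polynomial in X; so ⌊L/k⌋ is O(log X), and
so is k. -/
theorem hashDegree_le (i : Input) (h : ¬ i.IsLarge) :
    (i.hashDegree : ℝ) ≤ 16 * (1 + Real.log i.sizeParam) ^ 2 := by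
  have hk := i.one_le_k
  have h1 := Nat.lt_mul_div_succ (Nat.log 2 i.n) (b := i.k) (by omega)
  have h2 : i.hashDegree ≤ i.k * (Nat.log 2 i.n / i.k + 1) := by
    rw [hashDegree, if_neg h]
    exact h1
  rw [IsLarge, not_le] at h
  generalize Nat.log 2 i.n / i.k = a at *
  have h3 : (2 : ℝ) ^ a ≤ 16 * i.sizeParam ^ 4 := by
    calc (2 : ℝ) ^ a ≤ 8 * i.k ^ 3 * i.invEps := by exact_mod_cast h.le
      _ ≤ 8 * i.sizeParam ^ 3 * (2 * i.sizeParam) := by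
          have h4 : (i.k : ℝ) ≤ i.sizeParam := by
            refine le_trans ?_ i.two_pow_le
            exact_mod_cast Nat.lt_two_pow_self.le
          have h5 : (i.invEps : ℝ) ≤ 2 * i.sizeParam := by
            have h6 := i.one_div_ε_le
            have h7 := i.invEps_le
            have h8 := i.one_le_sizeParam
            linarith
          have h9 := i.one_le_sizeParam
          gcongr
      _ = _ := by ring
  have hX := i.one_le_sizeParam
  have h4 := Real.log_le_log (by positivity) h3
  rw [Real.log_pow, Real.log_mul (by norm_num) (by positivity), Real.log_pow,
    show (16 : ℝ) = 2 ^ 4 by norm_num, Real.log_pow] at h4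
  push_cast at h4
  have h5 := Real.log_two_lt_d9
  have h6 := i.log_sizeParam_nonneg
  have h7 : (0 : ℝ) ≤ a := Nat.cast_nonneg _
  have h8 : (a : ℝ) + 1 ≤ 8 * (1 + Real.log i.sizeParam) := by
    nlinarith [half_lt_log_two]
  calc (i.hashDegree : ℝ) ≤ i.k * (a + 1) := by exact_mod_cast h2
    _ ≤ (2 * (1 + Real.log i.sizeParam)) * (8 * (1 + Real.log i.sizeParam)) :=
        mul_le_mul i.k_le_log h8 (by positivity) (by positivity)
    _ = _ := by ring

theorem sample_length_le (i : Input) : (i.sample.length : ℝ) ≤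
    2 ^ 30 * i.sizeParam * (1 + Real.log i.sizeParam) ^ 12 := by
  have hlen : i.sample.length = i.numHash * i.innerSize := by simp [sample]
  have hε := i.ε_pos'
  have hL : 1 ≤ 1 + Real.log i.sizeParam := by linarith [i.log_sizeParam_nonneg]
  have hk := i.k_le_log
  have hE := i.invEps_pow_le
  have hX := i.one_le_sizeParam
  rw [hlen]
  by_cases h : i.IsLarge
  · rw [i.size_eq_of_isLarge h]
    push_cast
    have h1 : (2 : ℝ) ^ i.k + Nat.log 2 i.n + 1 ≤ 2 * (2 ^ i.k + Real.log i.n) := by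
      have := i.natLog_le
      have : (1 : ℝ) ≤ 2 ^ i.k := one_le_pow₀ one_le_two
      linarith
    calc (512 : ℝ) * i.k ^ 3 * i.invEps ^ 3 * (2 ^ i.k + Nat.log 2 i.n + 1)
        ≤ 512 * (2 * (1 + Real.log i.sizeParam)) ^ 3 * (8 / (i.ε : ℝ) ^ 3) *
          (2 * (2 ^ i.k + Real.log i.n)) := by gcongr
      _ = 2 ^ 16 * i.sizeParam * (1 + Real.log i.sizeParam) ^ 3 := by
          rw [sizeParam]
          ring
      _ ≤ _ := by
          gcongr
          · norm_num
          · norm_num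
          · norm_num
  · have h1 : ((i.numHash * i.innerSize : ℕ) : ℝ) ≤
        ((512 * i.k ^ 6 * i.hashDegree ^ 3 * i.invEps ^ 3 * 2 ^ i.k : ℕ) : ℝ) :=
      Nat.cast_le.2 (i.size_le_of_not_isLarge h)
    refine h1.trans ?_
    push_cast
    have h2 := i.hashDegree_le h
    -- The exponent 12 is 6 from k^6 plus 2·3 from d³; the constant is 2^9·2^6·2^12·2^3 = 2^30.
    calc (512 : ℝ) * i.k ^ 6 * i.hashDegree ^ 3 * i.invEps ^ 3 * 2 ^ i.k
        ≤ 512 * (2 * (1 + Real.log i.sizeParam)) ^ 6 *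
          (16 * (1 + Real.log i.sizeParam) ^ 2) ^ 3 * (8 / (i.ε : ℝ) ^ 3) * 2 ^ i.k := by gcongr
      _ = 2 ^ 30 * (2 ^ i.k / (i.ε : ℝ) ^ 3) * (1 + Real.log i.sizeParam) ^ 12 := by ring
      _ ≤ _ := by
          gcongr
          exact i.two_pow_div_le

end Input

/-- One program, with one polynomial time bound and one `Õ`-bound: for all `1 ≤ k ≤ n` and
rational `0 < ε < 1` it lists an `ε`-almost `k`-wise independent set in the `L_1`-norm of size
`Õ(X)`, that is at most `X` times a polynomial in `log X`, for `X = (2^k + log n) / ε^3`, in time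
polynomial in `n`, `2^k`, `1/ε` and the bit length of `ε`. -/
theorem theorem15 :
    ∃ (P : Prog) (c : ℕ), ∀ (n k : ℕ) (ε : ℚ), 1 ≤ k → k ≤ n → 0 < ε → ε < 1 →
      ∃ S : List (Fin n → Bool),
        P.eval (encodeInput n k ε) = encodeSample S ∧
        (P.time (encodeInput n k ε) : ℝ) ≤
          c * ((n : ℝ) + 2 ^ k + 1 / (ε : ℝ) + (ε.den.size : ℝ)) ^ c ∧
        (S.length : ℝ) ≤
          c * ((2 ^ k + Real.log n) / (ε : ℝ) ^ 3) *
            (1 + Real.log ((2 ^ k + Real.log n) / (ε : ℝ) ^ 3)) ^ c ∧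
        IsAlmostKWiseL1Set k (ε : ℝ) (S : Multiset (Fin n → Bool)) := by
  obtain ⟨P, hP, ⟨c, hc⟩, -⟩ := Input.polyTime_output
  -- A single constant serves as factor and exponent in both bounds; 11^c comes from
  -- `Input.meas_le`, 2^30 from `Input.sample_length_le`.
  obtain ⟨C, hC1, hC2, hC3⟩ : ∃ C, c * 11 ^ c ≤ C ∧ c ≤ C ∧ 2 ^ 30 ≤ C :=
    ⟨c * 11 ^ c + c + 2 ^ 30, by omega, by omega, by omega⟩
  refine ⟨P, C, fun n k ε h1 h2 h3 h4 => ?_⟩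
  set i : Input := ⟨n, k, ε, h1, h2, h3, h4⟩
  refine ⟨i.sample, (hP i).trans i.enc_output, ?_, ?_, i.isAlmostKWiseL1Set_sample⟩
  · have h5 : (P.time (encodeInput n k ε) : ℝ) ≤ c * (Coded.meas i : ℝ) ^ c := by
      exact_mod_cast hc i
    have h6 := i.meas_le
    change (Coded.meas i : ℝ) ≤ 11 * ((n : ℝ) + 2 ^ k + 1 / (ε : ℝ) + (ε.den.size : ℝ)) at h6
    have h7 : (1 : ℝ) ≤ (n : ℝ) + 2 ^ k + 1 / (ε : ℝ) + (ε.den.size : ℝ) := by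
      have h8 : (1 : ℝ) ≤ n := by exact_mod_cast h1.trans h2
      have h9 : (0 : ℝ) < 1 / ε := one_div_pos.2 i.ε_pos'
      have h10 : (0 : ℝ) < 2 ^ k := by positivity
      have h11 : (0 : ℝ) ≤ ε.den.size := Nat.cast_nonneg _
      linarith
    generalize (n : ℝ) + 2 ^ k + 1 / (ε : ℝ) + (ε.den.size : ℝ) = Y at h6 h7 ⊢
    calc (P.time (encodeInput n k ε) : ℝ) ≤ c * (11 * Y) ^ c :=
          h5.trans (by gcongr)
      _ = ((c * 11 ^ c : ℕ) : ℝ) * Y ^ c := by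
          push_cast
          ring
      _ ≤ C * Y ^ C := by gcongr
  · have h5 := i.sample_length_le
    have h6 := i.one_le_sizeParam
    have h7 := i.log_sizeParam_nonneg
    change (i.sample.length : ℝ) ≤ C * i.sizeParam * (1 + Real.log i.sizeParam) ^ C
    refine h5.trans ?_
    have h8 : (2 ^ 30 : ℝ) ≤ C := by exact_mod_cast hC3
    have h9 : 12 ≤ C := le_trans (by norm_num) hC3
    have h10 : 1 ≤ 1 + Real.log i.sizeParam := by linarith
    gcongr
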